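/- **Setting.** Let $\mathbb T^2=(\mathbb R/2\pi\mathbb Z)^2$. For $n=(n_1,n_2)\in\mathbb Z^2$ put $|n|=|n_1|+|n_2|$, and $\omega_n=n_1^3-n_2^2/n_1$ if $n_1\neq0$. Products of indices inside absolute values mean products of sizes: $|nm|=|n||m|$, $|nmp|=|n||m||p|$. Let $H^s$ be the space of real-valued $f=\sum_n f_n e^{i(n_1x+n_2y)}$ on $\mathbb T^2$ with $f_{(0,n_2)}=0$ for all $n_2$ and $\|f\|_{H^s}^2=\sum_{n_1\ne0}|n|^{2s}|f_n|^2<\infty$. Fix $s>1$. There are constants $\varepsilon_1,T_1,C_s>0$, depending only on $s$, with the following property. Let $(g_n)_{n_1>0}$ be independent identically distributed complex random variables whose law is invariant under multiplication by $e^{i\theta}$ for every $\theta$, let $(\lambda_n)_{n_1>0}$ be complex numbers, set $g_{-n}=\overline{g_n}$, $\lambda_{-n}=\overline{\lambda_n}$, and assume that $u_0=\sum_{n_1\neq0}\lambda_ng_ne^{i(n_1x+n_2y)}$ belongs to $L^\infty(\Omega,H^s)$ with norm $1$. For $n,m,p\in\mathbb Z^*\times\mathbb Z$ let $F_{n,m,p}(t)=0$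 if $n+m+p\neq0$, and if $n+m+p=0$ let $$F_{n,m,p}(t)=\frac{1-e^{i(\omega_n+\omega_m+\omega_p)t}}{\omega_n+\omega_m+\omega_p}\Big[E(|g_n|^2)^2\big(n_1|\lambda_m|^2|\lambda_p|^2+m_1|\lambda_p|^2|\lambda_n|^2+p_1|\lambda_n|^2|\lambda_m|^2\big)-\big(E(|g_n|^4)-2E(|g_n|^2)^2\big)\big(\delta_m^p\,m_1|\lambda_m|^4+\delta_p^n\,p_1|\lambda_p|^4+\delta_n^m\,n_1|\lambda_n|^4\big)\Big].$$ **Claim.** (i) The sum $\sum_{n,m,p}\sqrt{|n_1m_1p_1|}\,|nmp|^s\,|F_{n,m,p}(t)|$ over $n,m,p\in\mathbb Z^*\times\mathbb Z$ is bounded uniformly in $t\in\mathbb R$. (ii) For every $\varepsilon\in[0,\varepsilon_1)$, almost surely the KP-II equation $$\partial_x\big(\partial_tu+\partial_x^3u+\varepsilon u\,\partial_xu\big)+\partial_y^2u=0,\qquad u(0)=u_0,$$ has a unique solution $u=\sum_nu_n(t)e^{i(n_1x+n_2y)}$, continuous in time with values in $H^s$, for $|t|\le T_1\varepsilon^{-2}$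 (for all $t$ if $\varepsilon=0$); and for all such $t$ and all $n,m,p\in\mathbb Z^*\times\mathbb Z$ the product $u_n(t)u_m(t)u_p(t)$ is integrable and $$E\big(u_n(t)u_m(t)u_p(t)\big)=\varepsilon F_{n,m,p}(t)+\varepsilon^3\widetilde R(n,m,p,t,\varepsilon),\qquad|\widetilde R(n,m,p,t,\varepsilon)|\le C_s\,\min(|nm|,|mp|,|pn|)^{-s}\,|t|\,(1+|t|).$$ -/

import Mathlib

open MeasureTheory ProbabilityTheory Filter Topology
open scoped ENNReal ComplexConjugate

noncomputable section

namespace KPII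

/-- `2π > 0`, needed for the normalised Haar measure of the circle `ℝ / 2πℤ`. -/
instance factTwoPiPos : Fact (0 < 2 * Real.pi) := ⟨Real.two_pi_pos⟩

/-- The torus `𝕋² = (ℝ / 2πℤ)²`, with points `z = (x, y)`. -/
abbrev Torus : Type := AddCircle (2 * Real.pi) × AddCircle (2 * Real.pi)

/-- The normalised (total mass one) Haar measure `dx dy / (2π)²` on the torus. -/
def torusMeasure : Measure Torus :=
  (AddCircle.haarAddCircle (T := 2 * Real.pi)).prod (AddCircle.haarAddCircle (T := 2 * Real.pi))

/-- The exponential `e^{i(n₁ x + n₂ y)}`. -/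
def expMode (n : ℤ × ℤ) (z : Torus) : ℂ := fourier n.1 z.1 * fourier n.2 z.2

/-- The Fourier coefficient `f_n`, normalised such that `f = ∑ f_n e^{i(n₁ x + n₂ y)}`. -/
def coeff (f : Torus → ℝ) (n : ℤ × ℤ) : ℂ :=
  ∫ z, (f z : ℂ) * expMode (-n) z ∂torusMeasure

/-- `|n| = |n₁| + |n₂|`. -/
def size (n : ℤ × ℤ) : ℝ := |(n.1 : ℝ)| + |(n.2 : ℝ)|

/-- The space `H^s` of real-valued functions on the torus whose mean in `x` vanishes
(all the coefficients of index `(0, n₂)` are zero) and with `∑ |n|^{2s} |f_n|² < ∞`. -/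
structure MemHs (s : ℝ) (f : Torus → ℝ) : Prop where
  memLp : MemLp f 2 torusMeasure
  coeff_zero : ∀ n : ℤ × ℤ, n.1 = 0 → coeff f n = 0
  summable : Summable fun n : ℤ × ℤ => size n ^ (2 * s) * ‖coeff f n‖ ^ 2

/-- The norm of `H^s`. -/
def hsNorm (s : ℝ) (f : Torus → ℝ) : ℝ :=
  Real.sqrt (∑' n : ℤ × ℤ, size n ^ (2 * s) * ‖coeff f n‖ ^ 2)

/-- `u ∈ C(J, H^s)` is a solution on the time interval `J ∋ 0` of the KP-II equation
`∂ₓ(∂ₜ u + ∂ₓ³ u + (ε/2) ∂ₓ(u²)) + ∂_y² u = 0` with initial datum `f`.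
The equation holds in the sense of distributions on the torus, that is, tested against every
exponential `e^{-i(n₁ x + n₂ y)}`; `u²` is the pointwise square. -/
structure IsSolution (s ε : ℝ) (J : Set ℝ) (f : Torus → ℝ) (u : ℝ → Torus → ℝ) : Prop where
  memHs : ∀ t ∈ J, MemHs s (u t)
  continuous : ∀ t₀ ∈ J,
    Tendsto (fun t => hsNorm s (fun z => u t z - u t₀ z)) (𝓝[J] t₀) (𝓝 0)
  initial : u 0 =ᵐ[torusMeasure] f
  equation : ∀ n : ℤ × ℤ, ∀ t ∈ J, ∃ d : ℂ,
    HasDerivWithinAt (fun t' => coeff (u t') n) d J t ∧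
    (Complex.I * n.1) * (d + (Complex.I * n.1) ^ 3 * coeff (u t) n
        + (ε / 2 : ℂ) * ((Complex.I * n.1) * coeff (fun z => u t z ^ 2) n))
      + (Complex.I * n.2) ^ 2 * coeff (u t) n = 0

/-- The dispersion relation `ω_n = n₁³ - n₂² / n₁` (for `n₁ ≠ 0`). -/
def omega (n : ℤ × ℤ) : ℝ := (n.1 : ℝ) ^ 3 - (n.2 : ℝ) ^ 2 / (n.1 : ℝ)

/-- `u₀ = ∑_{n₁ ≠ 0} λ_n g_n e^{i(n₁ x + n₂ y)}` is a random element of `L^∞(Ω, H^s)` of norm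
one, where `λ_{-n}` and `g_{-n}` are the conjugates of `λ_n` and `g_n`, and the `g_n`, `n₁ > 0`,
are independent and identically distributed with a rotation invariant law. Only the indices with
`n₁ ≠ 0` are relevant. -/
structure IsRandomDatum {Ω : Type*} [MeasurableSpace Ω] (P : Measure Ω) (s : ℝ)
    (lam : ℤ × ℤ → ℂ) (g : ℤ × ℤ → Ω → ℂ) (u₀ : Ω → Torus → ℝ) : Prop where
  measurable : ∀ n : ℤ × ℤ, 0 < n.1 → Measurable (g n)
  indep : iIndepFun (fun n : {n : ℤ × ℤ // 0 < n.1} => g n) P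
  identDistrib : ∀ n m : ℤ × ℤ, 0 < n.1 → 0 < m.1 → IdentDistrib (g n) (g m) P P
  rotation : ∀ n : ℤ × ℤ, 0 < n.1 → ∀ θ : ℝ,
    IdentDistrib (fun ω => Complex.exp (Complex.I * θ) * g n ω) (g n) P P
  lam_neg : ∀ n : ℤ × ℤ, n.1 ≠ 0 → lam (-n) = conj (lam n)
  g_neg : ∀ n : ℤ × ℤ, n.1 ≠ 0 → ∀ ω, g (-n) ω = conj (g n ω)
  memHs : ∀ᵐ ω ∂P, MemHs s (u₀ ω)
  coeff_eq : ∀ᵐ ω ∂P, ∀ n : ℤ × ℤ, n.1 ≠ 0 → coeff (u₀ ω) n = lam n * g n ω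
  norm_eq_one : eLpNorm (fun ω => hsNorm s (u₀ ω)) ∞ P = 1

/-- The coefficient `F_{n,m,p}(t)` of `ε` in `E(u_n u_m u_p)`, for indices with
`n₁, m₁, p₁ ≠ 0`. -/
def momentTerm {Ω : Type*} [MeasurableSpace Ω] (P : Measure Ω)
    (lam : ℤ × ℤ → ℂ) (g : ℤ × ℤ → Ω → ℂ) (n m p : ℤ × ℤ) (t : ℝ) : ℂ :=
  if n + m + p = 0 then
    (1 - Complex.exp (Complex.I * ((omega n + omega m + omega p : ℝ) : ℂ) * (t : ℂ)))
        / ((omega n + omega m + omega p : ℝ) : ℂ)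
      * (((∫ ω, ‖g n ω‖ ^ 2 ∂P) ^ 2
            * ((n.1 : ℝ) * ‖lam m‖ ^ 2 * ‖lam p‖ ^ 2
              + (m.1 : ℝ) * ‖lam p‖ ^ 2 * ‖lam n‖ ^ 2
              + (p.1 : ℝ) * ‖lam n‖ ^ 2 * ‖lam m‖ ^ 2)
          - ((∫ ω, ‖g n ω‖ ^ 4 ∂P) - 2 * (∫ ω, ‖g n ω‖ ^ 2 ∂P) ^ 2)
            * ((if m = p then (m.1 : ℝ) * ‖lam m‖ ^ 4 else 0)
              + (if p = n then (p.1 : ℝ) * ‖lam p‖ ^ 4 else 0)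
              + (if n = m then (n.1 : ℝ) * ‖lam n‖ ^ 4 else 0)) : ℝ) : ℂ)
  else 0

/-- The times `|t| ≤ T₁ ε^{-2}` (all times if `ε = 0`). -/
def timeInterval (T₁ ε : ℝ) : Set ℝ := {t : ℝ | ε ^ 2 * |t| ≤ T₁}

end KPII

end

open MeasureTheory ProbabilityTheory Filter Topology
open scoped ENNReal ComplexConjugate

noncomputable section

namespace KPII

/-! ### Fourier series on the torus: completeness, Parseval, squares and real functions. -/

section FourierSeries

open Submodule Set

/-! The dynamics is studied in the interaction picture: a_n(t) = |n|^s e^{-iω_n t} u_n(t) satisfies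
∂_t a_n = -(iε/2) n_1 Σ_{k+l=n} e^{it(ω_k+ω_l-ω_n)} (|n|/(|k||l|))^s a_k a_l. For s > 1 the weighted
convolution is bounded on ℓ² (`memℓp_conv`, `norm_conv_le`), so the only obstruction to a direct
fixed point is the derivative n_1.

The sign in KP-II removes it. The resonance function ω_k+ω_l-ω_{k+l}, multiplied by k_1 l_1 (k+l)_1,
is minus a sum of two squares (`res_mul`), hence it has size at least 3|k_1 l_1 (k+l)_1|
(`le_abs_res`). An integration by parts in time divides by it and produces the normal form
(`IsMild.normalForm`): the datum, plus a bounded quadratic boundary term of size ε, plus the time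
integral of a bounded cubic term with the factor ε². This is a contraction as long as ε and ε²|t|
are small, which gives existence, uniqueness, an a priori bound and Lipschitz dependence on the
datum up to times of order ε^{-2}. The way back from the normal form to the equation is
`isMild_of_normalForm`: the quadratic correction is a small perturbation of the identity also at the
level of difference quotients.

For the moments, the time derivative of E(a_n a_m a_p) is ε times a combination of expectations of
quartic expressions. Along the flow a quartic expression equals its value at the datum, plus ε times
a quintic expression of the datum, plus O(ε²(1+|t|)) (`IsMild.norm_quartic_sub_le`). The law of the
datum is invariant under a ↦ -a and the quintic expression is odd, so its mean vanishes and one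
power of ε is gained (`norm_integral_quartic_sub_le`). The quartic means at the datum are explicit:
rotation invariance and independence leave only the pairings of the indices (`integral_quartic`),
and integrating the phase e^{-i(ω_n+ω_m+ω_p)t} in time yields F. The remainder is ε³|t|(1+|t|) times
|n_1|+|m_1|+|p_1| over the three weights, and s > 1 lets one weight absorb the first component
(`sum_fst_mul_le`).

The bound on the weighted sum of F uses the same nonresonance. With X = |n_1 m_1 p_1|, the
denominator gives 1/X, the weight of the sum gives √X, and the factor n_1 is at most 2√X because n_1
= -(m_1+p_1). What remains is summed by E Σ |V_m|²|V_p|² = E‖V‖⁴ ≤ 1 for the weighted datum V. -/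

instance : IsProbabilityMeasure torusMeasure := by unfold torusMeasure; infer_instance

/-- The exponential of index `n` as a continuous function. -/
def expModeC (n : ℤ × ℤ) : C(Torus, ℂ) where
  toFun := expMode n
  continuous_toFun := by unfold expMode; fun_prop

@[simp] lemma expModeC_apply (n : ℤ × ℤ) (z : Torus) : expModeC n z = expMode n z := rfl

lemma expMode_zero (z : Torus) : expMode 0 z = 1 := by simp [expMode]

lemma expMode_neg (n : ℤ × ℤ) (z : Torus) : expMode (-n) z = conj (expMode n z) := by
  simp [expMode]

lemma expMode_add (n m : ℤ × ℤ) (z : Torus) : expMode (n + m) z = expMode n z * expMode m z := by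
  simp only [expMode, Prod.fst_add, Prod.snd_add, fourier_add]; ring

/-- The star subalgebra of `C(𝕋², ℂ)` generated by the exponentials. -/
def expModeSubalgebra : StarSubalgebra ℂ C(Torus, ℂ) where
  toSubalgebra := Algebra.adjoin ℂ (range expModeC)
  star_mem' := by
    change Algebra.adjoin ℂ (range expModeC) ≤ star (Algebra.adjoin ℂ (range expModeC))
    refine Algebra.adjoin_le ?_
    rintro _ ⟨n, rfl⟩
    refine Algebra.subset_adjoin ⟨-n, ?_⟩
    ext1 x
    simp only [expModeC_apply, expMode_neg, starRingEnd_apply, ContinuousMap.star_apply]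

/-- The exponentials are closed under products, so the algebra they generate is no larger than their
linear span; this turns Stone–Weierstrass into density of trigonometric polynomials. -/
lemma expModeSubalgebra_coe :
    (expModeSubalgebra).toSubalgebra.toSubmodule = span ℂ (range expModeC) := by
  apply Algebra.adjoin_eq_span_of_subset
  refine .trans (fun x ↦ Submonoid.closure_induction (fun _ ↦ id) ⟨0, ?_⟩ ?_) subset_span
  · ext z
    simp [expMode_zero]
  · rintro _ _ _ _ ⟨m, rfl⟩ ⟨n, rfl⟩
    refine ⟨m + n, ?_⟩
    ext z
    simp [expMode_add]

lemma expModeSubalgebra_separatesPoints : (expModeSubalgebra).SeparatesPoints := by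
  intro x y hxy
  have : x.1 ≠ y.1 ∨ x.2 ≠ y.2 := by
    by_contra! h
    exact hxy (Prod.ext h.1 h.2)
  rcases this with h | h
  · refine ⟨_, ⟨expModeC (1, 0), Algebra.subset_adjoin ⟨(1, 0), rfl⟩, rfl⟩, ?_⟩
    simp only [expModeC_apply, expMode, fourier_zero, mul_one]
    rw [fourier_one, fourier_one, Ne, Circle.coe_inj]
    contrapose h
    exact AddCircle.injective_toCircle Real.two_pi_pos.ne' h
  · refine ⟨_, ⟨expModeC (0, 1), Algebra.subset_adjoin ⟨(0, 1), rfl⟩, rfl⟩, ?_⟩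
    simp only [expModeC_apply, expMode, fourier_zero, one_mul]
    rw [fourier_one, fourier_one, Ne, Circle.coe_inj]
    contrapose h
    exact AddCircle.injective_toCircle Real.two_pi_pos.ne' h

lemma span_expModeC_closure_eq_top :
    (span ℂ (range expModeC)).topologicalClosure = ⊤ := by
  rw [← expModeSubalgebra_coe]
  exact congr_arg (Subalgebra.toSubmodule <| StarSubalgebra.toSubalgebra ·)
    (ContinuousMap.starSubalgebra_topologicalClosure_eq_top_of_separatesPoints _
      expModeSubalgebra_separatesPoints)

/-- The exponential of index `n` as an element of `L²`. -/
abbrev expModeLp (n : ℤ × ℤ) : Lp ℂ 2 torusMeasure :=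
  ContinuousMap.toLp (E := ℂ) 2 torusMeasure ℂ (expModeC n)

lemma span_expModeLp_closure_eq_top :
    (span ℂ (range expModeLp)).topologicalClosure = ⊤ := by
  simpa only [map_span, ContinuousLinearMap.coe_coe, ← range_comp, Function.comp_def] using
    (ContinuousMap.toLp_denseRange ℂ torusMeasure ℂ
      (by norm_num : (2 : ℝ≥0∞) ≠ ∞)).topologicalClosure_map_submodule
      span_expModeC_closure_eq_top

lemma integral_fourier (n : ℤ) :
    ∫ x : AddCircle (2 * Real.pi), fourier n x ∂AddCircle.haarAddCircle = if n = 0 then 1 else 0 := by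
  have := (orthonormal_iff_ite.mp (orthonormal_fourier (T := 2 * Real.pi))) 0 n
  simp only [ContinuousMap.inner_toLp] at this
  simpa [eq_comm] using this

lemma integral_expMode (n : ℤ × ℤ) :
    ∫ z, expMode n z ∂torusMeasure = if n = 0 then 1 else 0 := by
  unfold expMode torusMeasure
  rw [integral_prod_mul (fun x => fourier n.1 x) (fun x => fourier n.2 x),
    integral_fourier, integral_fourier]
  by_cases h1 : n.1 = 0 <;> by_cases h2 : n.2 = 0 <;> simp [h1, h2, Prod.ext_iff]

lemma orthonormal_expModeLp : Orthonormal ℂ expModeLp := by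
  rw [orthonormal_iff_ite]
  intro m n
  simp only [ContinuousMap.inner_toLp, expModeC_apply, ← expMode_neg, ← expMode_add]
  rw [integral_expMode]
  congr 1
  rw [eq_iff_iff, add_neg_eq_zero, eq_comm]

/-- The exponentials form a Hilbert basis of `L²(𝕋²)`. -/
def expBasis : HilbertBasis (ℤ × ℤ) ℂ (Lp ℂ 2 torusMeasure) :=
  HilbertBasis.mk orthonormal_expModeLp span_expModeLp_closure_eq_top.ge

/-- Fourier coefficients of complex valued functions. -/
def ccoeff (F : Torus → ℂ) (n : ℤ × ℤ) : ℂ := ∫ z, F z * expMode (-n) z ∂torusMeasure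

lemma norm_expMode (n : ℤ × ℤ) (z : Torus) : ‖expMode n z‖ = 1 := by
  have h : ∀ (m : ℤ) (x : AddCircle (2 * Real.pi)), ‖fourier m x‖ = 1 := fun m x => by
    rw [fourier_apply]; exact Circle.norm_coe _
  rw [expMode, norm_mul, h, h, one_mul]

lemma continuous_expMode (n : ℤ × ℤ) : Continuous (expMode n) := (expModeC n).continuous

lemma memLp_mul_expMode {F : Torus → ℂ} {q : ℝ≥0∞} (hF : MemLp F q torusMeasure) (n : ℤ × ℤ) :
    MemLp (fun z => F z * expMode n z) q torusMeasure := by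
  refine hF.of_le (hF.1.mul (continuous_expMode n).aestronglyMeasurable) ?_
  filter_upwards with z
  simp [norm_expMode]

lemma expBasis_repr (F : Lp ℂ 2 torusMeasure) (n : ℤ × ℤ) : expBasis.repr F n = ccoeff F n := by
  rw [expBasis.repr_apply_apply, MeasureTheory.L2.inner_def, expBasis, HilbertBasis.coe_mk, ccoeff]
  apply integral_congr_ae
  filter_upwards [ContinuousMap.coeFn_toLp (p := 2) (𝕜 := ℂ) torusMeasure (expModeC n)] with z hz
  rw [hz, expMode_neg]
  simp

lemma ccoeff_congr {F G : Torus → ℂ} (h : F =ᵐ[torusMeasure] G) (n : ℤ × ℤ) :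
    ccoeff F n = ccoeff G n := by
  apply integral_congr_ae
  filter_upwards [h] with z hz
  rw [hz]

lemma hasSum_ccoeff {F G : Torus → ℂ} (hF : MemLp F 2 torusMeasure) (hG : MemLp G 2 torusMeasure) :
    HasSum (fun k => conj (ccoeff F k) * ccoeff G k) (∫ z, conj (F z) * G z ∂torusMeasure) := by
  have h := expBasis.hasSum_inner_mul_inner (hF.toLp F) (hG.toLp G)
  have h2 : inner ℂ (hF.toLp F) (hG.toLp G) = ∫ z, conj (F z) * G z ∂torusMeasure := by
    rw [MeasureTheory.L2.inner_def]
    apply integral_congr_ae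
    filter_upwards [hF.coeFn_toLp, hG.coeFn_toLp] with z h1 h2
    rw [h1, h2]
    simp [mul_comm]
  rw [h2] at h
  convert! h using 1
  funext k
  rw [← inner_conj_symm, ← expBasis.repr_apply_apply, ← expBasis.repr_apply_apply, expBasis_repr,
    expBasis_repr, ccoeff_congr hF.coeFn_toLp, ccoeff_congr hG.coeFn_toLp]

lemma ae_eq_of_ccoeff_eq {F G : Torus → ℂ} (hF : MemLp F 2 torusMeasure)
    (hG : MemLp G 2 torusMeasure) (h : ∀ n, ccoeff F n = ccoeff G n) : F =ᵐ[torusMeasure] G := by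
  have : hF.toLp F = hG.toLp G := by
    apply expBasis.repr.injective
    ext n
    rw [expBasis_repr, expBasis_repr, ccoeff_congr hF.coeFn_toLp, ccoeff_congr hG.coeFn_toLp, h]
  exact (MemLp.toLp_eq_toLp_iff hF hG).1 this

lemma exists_ccoeff_eq (a : lp (fun _ : ℤ × ℤ => ℂ) 2) :
    ∃ F : Torus → ℂ, MemLp F 2 torusMeasure ∧ ∀ n, ccoeff F n = a n := by
  refine ⟨expBasis.repr.symm a, Lp.memLp _, fun n => ?_⟩
  rw [← expBasis_repr]
  simp

lemma coeff_eq_ccoeff (f : Torus → ℝ) (n : ℤ × ℤ) : coeff f n = ccoeff (fun z => (f z : ℂ)) n := rfl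

lemma coeff_congr {f g : Torus → ℝ} (h : f =ᵐ[torusMeasure] g) (n : ℤ × ℤ) :
    coeff f n = coeff g n :=
  ccoeff_congr (h.mono fun z hz => by simp [hz]) n

lemma coeff_neg (f : Torus → ℝ) (n : ℤ × ℤ) : coeff f (-n) = conj (coeff f n) := by
  unfold coeff
  rw [← integral_conj]
  congr 1; ext z
  simp [expMode_neg]

lemma coeff_sub {f g : Torus → ℝ} (hf : MemLp f 2 torusMeasure) (hg : MemLp g 2 torusMeasure)
    (n : ℤ × ℤ) : coeff (fun z => f z - g z) n = coeff f n - coeff g n := by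
  unfold coeff
  rw [← integral_sub]
  · congr 1; ext z; push_cast; ring
  · exact ((memLp_mul_expMode hf.ofReal _).integrable (by norm_num))
  · exact ((memLp_mul_expMode hg.ofReal _).integrable (by norm_num))

/-- Parseval for the pair f e^{in·z} and f. Since f is only in L², its square is merely integrable,
but the coefficients of the square are still given by the convolution. -/
lemma hasSum_coeff_sq {f : Torus → ℝ} (hf : MemLp f 2 torusMeasure) (n : ℤ × ℤ) :
    HasSum (fun k => coeff f k * coeff f (n - k)) (coeff (fun z => f z ^ 2) n) := by
  have hf' : MemLp (fun z => (f z : ℂ)) 2 torusMeasure := hf.ofReal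
  have h := hasSum_ccoeff (memLp_mul_expMode hf' n) hf'
  have e : ∫ z, conj ((f z : ℂ) * expMode n z) * (f z : ℂ) ∂torusMeasure
      = coeff (fun z => f z ^ 2) n := by
    unfold coeff
    congr 1; ext z
    simp [expMode_neg]; ring
  rw [← e]
  convert! h using 1
  funext k
  have : ccoeff (fun z => (f z : ℂ) * expMode n z) k = coeff f (k - n) := by
    unfold coeff ccoeff
    congr 1; ext z
    rw [mul_assoc, ← expMode_add]; congr 2; abel
  rw [this, ← coeff_neg, neg_sub, mul_comm, ← coeff_eq_ccoeff]

lemma ae_eq_of_coeff_eq {f g : Torus → ℝ} (hf : MemLp f 2 torusMeasure)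
    (hg : MemLp g 2 torusMeasure) (h : ∀ n, coeff f n = coeff g n) : f =ᵐ[torusMeasure] g := by
  filter_upwards [ae_eq_of_ccoeff_eq hf.ofReal hg.ofReal h] with z hz
  exact_mod_cast hz

/-- The real part of the L² function with coefficients a_n has the coefficients (a_n + conj
a_{-n})/2, which are a_n again by the symmetry. -/
lemma exists_coeff_eq (a : lp (fun _ : ℤ × ℤ => ℂ) 2) (ha : ∀ n, a (-n) = conj (a n)) :
    ∃ f : Torus → ℝ, MemLp f 2 torusMeasure ∧ ∀ n, coeff f n = a n := by
  obtain ⟨F, hF, h⟩ := exists_ccoeff_eq a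
  refine ⟨fun z => (F z).re, hF.re, fun n => ?_⟩
  have h1 : Integrable (fun z => F z * expMode (-n) z) torusMeasure :=
    (memLp_mul_expMode hF _).integrable (by norm_num)
  have h2 : Integrable (fun z => conj (F z * expMode n z)) torusMeasure :=
    ((memLp_mul_expMode hF n).integrable (by norm_num)).congr' (by
      exact (Complex.continuous_conj.comp_aestronglyMeasurable (memLp_mul_expMode hF n).1))
      (by filter_upwards with z; simp)
  have e : coeff (fun z => (F z).re) n
      = (∫ z, (F z * expMode (-n) z + conj (F z * expMode n z)) ∂torusMeasure) / 2 := by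
    unfold coeff
    rw [← integral_div]
    congr 1; ext z
    rw [map_mul, ← expMode_neg, ← add_mul, Complex.add_conj]
    push_cast; ring
  rw [e, integral_add h1 h2, integral_conj]
  have h3 := h n
  have h4 := h (-n)
  unfold ccoeff at h3 h4
  rw [neg_neg] at h4
  rw [h3, h4, ha]
  simp

end FourierSeries

/-! ### Weighted convolutions with bounded kernels on ℓ², that is, the algebra property of H^s for s
> 1. -/

section SequenceSpace

/-- Square summable sequences. A function `u` in `H^s` is represented by `|n|^s u_n`. -/
abbrev Seq : Type := lp (fun _ : ℤ × ℤ => ℂ) 2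

lemma Seq.hasSum_norm_sq (a : Seq) : HasSum (fun n => ‖a n‖ ^ 2) (‖a‖ ^ 2) := by
  have := lp.hasSum_norm (p := 2) (by norm_num) a
  simpa using this

lemma memℓp_two_iff {f : ℤ × ℤ → ℂ} : Memℓp f 2 ↔ Summable fun n => ‖f n‖ ^ 2 := by
  rw [memℓp_gen_iff (by norm_num)]
  simp

lemma Seq.norm_apply_le (a : Seq) (n : ℤ × ℤ) : ‖a n‖ ≤ ‖a‖ :=
  lp.norm_apply_le_norm (by norm_num) a n

/-- The evaluation of a sequence at an index. -/
def evalSeq (n : ℤ × ℤ) : Seq →L[ℂ] ℂ := lp.evalCLM ℂ (fun _ : ℤ × ℤ => ℂ) 2 n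

@[simp] lemma evalSeq_apply (n : ℤ × ℤ) (a : Seq) : evalSeq n a = a n := rfl

lemma size_nonneg (n : ℤ × ℤ) : 0 ≤ size n := by unfold size; positivity

lemma size_neg (n : ℤ × ℤ) : size (-n) = size n := by simp [size]

lemma size_add_le (n m : ℤ × ℤ) : size (n + m) ≤ size n + size m := by
  simp only [size, Prod.fst_add, Prod.snd_add, Int.cast_add]
  have := abs_add_le (n.1 : ℝ) m.1
  have := abs_add_le (n.2 : ℝ) m.2
  linarith

lemma abs_fst_le_size (n : ℤ × ℤ) : |(n.1 : ℝ)| ≤ size n := by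
  unfold size; linarith [abs_nonneg (n.2 : ℝ)]

lemma one_le_abs_cast {k : ℤ} (h : k ≠ 0) : (1 : ℝ) ≤ |(k : ℝ)| := by
  exact_mod_cast Int.one_le_abs h

lemma one_le_size {n : ℤ × ℤ} (h : n.1 ≠ 0) : 1 ≤ size n :=
  (one_le_abs_cast h).trans (abs_fst_le_size n)

/-- The weight `max(1, |n|)^s`. -/
def weight (s : ℝ) (n : ℤ × ℤ) : ℝ := (max 1 (size n)) ^ s

lemma weight_pos (s : ℝ) (n : ℤ × ℤ) : 0 < weight s n :=
  Real.rpow_pos_of_pos (lt_of_lt_of_le one_pos (le_max_left _ _)) _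

lemma weight_eq (s : ℝ) {n : ℤ × ℤ} (h : n.1 ≠ 0) : weight s n = size n ^ s := by
  rw [weight, max_eq_right (one_le_size h)]

lemma weight_zero (s : ℝ) : weight s 0 = 1 := by simp [weight, size]

lemma weight_neg (s : ℝ) (n : ℤ × ℤ) : weight s (-n) = weight s n := by simp [weight, size_neg]

lemma weight_add_le {s : ℝ} (hs : 0 ≤ s) (k l : ℤ × ℤ) :
    weight s (k + l) ≤ 2 ^ s * (weight s k + weight s l) := by
  have h1 : max 1 (size (k + l)) ≤ 2 * max (max 1 (size k)) (max 1 (size l)) := by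
    have := size_add_le k l
    have h2 : size k ≤ max (max 1 (size k)) (max 1 (size l)) :=
      (le_max_right _ _).trans (le_max_left _ _)
    have h3 : size l ≤ max (max 1 (size k)) (max 1 (size l)) :=
      (le_max_right _ _).trans (le_max_right _ _)
    have h4 : 1 ≤ max (max 1 (size k)) (max 1 (size l)) :=
      (le_max_left _ _).trans (le_max_left _ _)
    refine max_le (by linarith) (by linarith)
  calc weight s (k + l) ≤ (2 * max (max 1 (size k)) (max 1 (size l))) ^ s :=
        Real.rpow_le_rpow (by positivity) h1 hs
    _ = 2 ^ s * (max (max 1 (size k)) (max 1 (size l))) ^ s :=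
        Real.mul_rpow (by norm_num) (by positivity)
    _ ≤ _ := by
        gcongr
        rcases max_cases (max 1 (size k)) (max 1 (size l)) with h | h
        · rw [h.1]
          have := (weight_pos s l).le
          unfold weight at *; linarith
        · rw [h.1]
          have := (weight_pos s k).le
          unfold weight at *; linarith

/-- A lattice sum over ℤ² of a power 2s > 2, compared with the sup norm Eisenstein sum. The index 0
is added separately, since there the weight is 1 while the power of the norm is not a useful bound.
-/
lemma summable_inv_weight_sq {s : ℝ} (hs : 1 < s) : Summable fun n => (weight s n ^ 2)⁻¹ := by
  have h := (EisensteinSeries.summable_one_div_norm_rpow (k := 2 * s) (by linarith))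
  rw [← (finTwoArrowEquiv ℤ).symm.summable_iff] at h
  have h0 : Summable (fun n : ℤ × ℤ => if n = 0 then (1 : ℝ) else 0) :=
    summable_of_ne_finset_zero (s := {0}) (by simp)
  refine Summable.of_nonneg_of_le (fun n => by positivity) (fun n => ?_) (h.add h0)
  by_cases hn : n = 0
  · subst hn
    simp only [weight_zero, if_true, Function.comp]
    have : 0 ≤ ‖(finTwoArrowEquiv ℤ).symm (0 : ℤ × ℤ)‖ ^ (-(2 * s)) := by positivity
    linarith [this, show ((1 : ℝ) ^ 2)⁻¹ = 1 by norm_num]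
  · simp only [hn, if_false, add_zero, Function.comp]
    have hpos : 0 < ‖(finTwoArrowEquiv ℤ).symm n‖ := by
      rw [norm_pos_iff]
      intro h
      exact hn ((finTwoArrowEquiv ℤ).symm.injective (h.trans (by
        ext i; fin_cases i <;> rfl)))
    have hle : ‖(finTwoArrowEquiv ℤ).symm n‖ ≤ max 1 (size n) := by
      refine le_trans ?_ (le_max_right _ _)
      rw [pi_norm_le_iff_of_nonneg (size_nonneg n)]
      intro i
      fin_cases i
      · simpa [Int.norm_eq_abs] using abs_fst_le_size n
      · have : |(n.2 : ℝ)| ≤ size n := by unfold size; linarith [abs_nonneg (n.1 : ℝ)]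
        simpa [Int.norm_eq_abs] using this
    have : (weight s n ^ 2)⁻¹ = (max 1 (size n)) ^ (-(2 * s)) := by
      rw [weight, Real.rpow_neg (by positivity), mul_comm, Real.rpow_mul (by positivity)]
      norm_num
    rw [this]
    exact Real.rpow_le_rpow_of_nonpos hpos hle (by linarith)

/-- The ratio of weights in the convolution of weighted sequences. -/
def ratio (s : ℝ) (k l : ℤ × ℤ) : ℝ := weight s (k + l) / (weight s k * weight s l)

lemma ratio_nonneg (s : ℝ) (k l : ℤ × ℤ) : 0 ≤ ratio s k l := by
  have := weight_pos s k; have := weight_pos s l; have := weight_pos s (k + l)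
  unfold ratio; positivity

lemma ratio_sq_le {s : ℝ} (hs : 0 ≤ s) (k l : ℤ × ℤ) :
    ratio s k l ^ 2 ≤ 2 * (2 ^ s) ^ 2 * ((weight s k ^ 2)⁻¹ + (weight s l ^ 2)⁻¹) := by
  have hk := weight_pos s k
  have hl := weight_pos s l
  have h : ratio s k l ≤ 2 ^ s * ((weight s k)⁻¹ + (weight s l)⁻¹) := by
    unfold ratio
    rw [div_le_iff₀ (by positivity)]
    refine (weight_add_le hs k l).trans (le_of_eq ?_)
    field_simp
    ring
  calc ratio s k l ^ 2 ≤ (2 ^ s * ((weight s k)⁻¹ + (weight s l)⁻¹)) ^ 2 := by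
        gcongr
        exact ratio_nonneg s k l
    _ = (2 ^ s) ^ 2 * ((weight s k)⁻¹ + (weight s l)⁻¹) ^ 2 := by ring
    _ ≤ (2 ^ s) ^ 2 * (2 * ((weight s k)⁻¹ ^ 2 + (weight s l)⁻¹ ^ 2)) := by
        gcongr
        nlinarith [sq_nonneg ((weight s k)⁻¹ - (weight s l)⁻¹)]
    _ = _ := by rw [inv_pow, inv_pow]; ring

/-- The constant of the bilinear estimates. -/
def convConst (s : ℝ) : ℝ := 1 + 4 * (2 ^ s) ^ 2 * ∑' n, (weight s n ^ 2)⁻¹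

lemma one_le_convConst (s : ℝ) : 1 ≤ convConst s := by
  unfold convConst
  have : 0 ≤ ∑' n, (weight s n ^ 2)⁻¹ := tsum_nonneg fun n => by positivity
  have : (0 : ℝ) ≤ 4 * (2 ^ s) ^ 2 * ∑' n, (weight s n ^ 2)⁻¹ := by positivity
  linarith

/-- The larger of the weights of k and n - k controls the weight of n, so the ratio is bounded by
the inverse weights of k and n - k. The resulting bound does not depend on n; this uniformity is
where s > 1 is needed. -/
lemma summable_ratio_sq {s : ℝ} (hs : 1 < s) (n : ℤ × ℤ) :
    (Summable fun k => ratio s k (n - k) ^ 2) ∧ ∑' k, ratio s k (n - k) ^ 2 ≤ convConst s := by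
  have h := summable_inv_weight_sq hs
  have h' : Summable fun k => (weight s (n - k) ^ 2)⁻¹ := (Equiv.subLeft n).summable_iff.2 h
  have hb := (h.add h').mul_left (2 * ((2 : ℝ) ^ s) ^ 2)
  have hle : ∀ k, ratio s k (n - k) ^ 2 ≤ 2 * (2 ^ s) ^ 2 *
      ((weight s k ^ 2)⁻¹ + (weight s (n - k) ^ 2)⁻¹) :=
    fun k => ratio_sq_le (by linarith) k (n - k)
  have hsum := Summable.of_nonneg_of_le (fun k => sq_nonneg _) hle hb
  refine ⟨hsum, (hsum.tsum_le_tsum hle hb).trans ?_⟩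
  have e : ∑' k, (weight s (n - k) ^ 2)⁻¹ = ∑' k, (weight s k ^ 2)⁻¹ :=
    (Equiv.subLeft n).tsum_eq (fun k => (weight s k ^ 2)⁻¹)
  rw [tsum_mul_left, h.tsum_add h', e, convConst]
  linarith

lemma summable_mul_of_sq {ι : Type*} {f g : ι → ℝ} (hf0 : ∀ i, 0 ≤ f i) (hg0 : ∀ i, 0 ≤ g i)
    (hf : Summable fun i => f i ^ 2) (hg : Summable fun i => g i ^ 2) :
    (Summable fun i => f i * g i) ∧
      (∑' i, f i * g i) ^ 2 ≤ (∑' i, f i ^ 2) * ∑' i, g i ^ 2 := by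
  have h := Real.summable_and_inner_le_Lp_mul_Lq_tsum_of_nonneg (p := 2) (q := 2)
    Real.HolderConjugate.two_two hf0 hg0 (by simpa using hf) (by simpa using hg)
  refine ⟨h.1, ?_⟩
  have h2 := h.2
  simp only [Real.rpow_two] at h2
  rw [← Real.sqrt_eq_rpow, ← Real.sqrt_eq_rpow] at h2
  calc (∑' i, f i * g i) ^ 2 ≤ (√(∑' i, f i ^ 2) * √(∑' i, g i ^ 2)) ^ 2 := by
        gcongr
        exact tsum_nonneg fun i => mul_nonneg (hf0 i) (hg0 i)
    _ = _ := by
        rw [mul_pow, Real.sq_sqrt (tsum_nonneg fun i => sq_nonneg _),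
          Real.sq_sqrt (tsum_nonneg fun i => sq_nonneg _)]

/-- Bounded kernels of bilinear operators. -/
def Kernel : Type := {κ : ℤ × ℤ → ℤ × ℤ → ℂ // ∀ k l, ‖κ k l‖ ≤ 1}

instance : CoeFun Kernel fun _ => ℤ × ℤ → ℤ × ℤ → ℂ := ⟨Subtype.val⟩

/-- The term of index `k` in the weighted convolution. -/
def convTerm (s : ℝ) (κ : ℤ × ℤ → ℤ × ℤ → ℂ) (a b : ℤ × ℤ → ℂ) (n k : ℤ × ℤ) : ℂ :=
  κ k (n - k) * ratio s k (n - k) * (a k * b (n - k))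

/-- The change of variables `(n, k) ↦ (k, n - k)`. -/
def splitEquiv : (ℤ × ℤ) × (ℤ × ℤ) ≃ (ℤ × ℤ) × (ℤ × ℤ) where
  toFun q := (q.2, q.1 - q.2)
  invFun q := (q.1 + q.2, q.1)
  left_inv q := by simp
  right_inv q := by simp

lemma summable_pairs {κ : ℤ × ℤ → ℤ × ℤ → ℂ} {M : ℝ} (hκ : ∀ k l, ‖κ k l‖ ≤ M) (a b : Seq) :
    Summable fun q : (ℤ × ℤ) × (ℤ × ℤ) => (‖κ q.1 q.2‖ * (‖a q.1‖ * ‖b q.2‖)) ^ 2 := by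
  have h := (a.hasSum_norm_sq.summable.mul_of_nonneg b.hasSum_norm_sq.summable
    (fun _ => sq_nonneg _) (fun _ => sq_nonneg _)).mul_left (M ^ 2)
  refine Summable.of_nonneg_of_le (fun _ => sq_nonneg _) (fun q => ?_) h
  rw [mul_pow, mul_pow]
  gcongr
  exact hκ _ _

/-- Cauchy–Schwarz in k, with the ratio of weights as one factor. The kernel stays inside the other
factor rather than being replaced by its bound, which later allows dominated convergence when the
kernel varies. -/
lemma summable_convTerm {s : ℝ} (hs : 1 < s) {κ : ℤ × ℤ → ℤ × ℤ → ℂ} {M : ℝ}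
    (hκ : ∀ k l, ‖κ k l‖ ≤ M) (a b : Seq) (n : ℤ × ℤ) :
    (Summable fun k => ‖convTerm s κ a b n k‖) ∧ (∑' k, ‖convTerm s κ a b n k‖) ^ 2 ≤
      convConst s * ∑' k, (‖κ k (n - k)‖ * (‖a k‖ * ‖b (n - k)‖)) ^ 2 := by
  have h1 := summable_ratio_sq hs n
  have h2 : Summable fun k => (‖κ k (n - k)‖ * (‖a k‖ * ‖b (n - k)‖)) ^ 2 :=
    (splitEquiv.summable_iff.2 (summable_pairs hκ a b)).prod_factor n
  have h3 := summable_mul_of_sq (fun k => ratio_nonneg s k (n - k)) (fun k => by positivity) h1.1 h2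
  have e : ∀ k, ‖convTerm s κ a b n k‖
      = ratio s k (n - k) * (‖κ k (n - k)‖ * (‖a k‖ * ‖b (n - k)‖)) := fun k => by
    simp only [convTerm, norm_mul, Complex.norm_real, Real.norm_of_nonneg (ratio_nonneg _ _ _)]
    ring
  have hs' : Summable fun k => ‖convTerm s κ a b n k‖ := by simpa only [e] using h3.1
  refine ⟨hs', ?_⟩
  simp only [e]
  refine h3.2.trans ?_
  exact mul_le_mul_of_nonneg_right h1.2 (tsum_nonneg fun k => sq_nonneg _)

lemma memℓp_conv {s : ℝ} (hs : 1 < s) {κ : ℤ × ℤ → ℤ × ℤ → ℂ} {M : ℝ}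
    (hκ : ∀ k l, ‖κ k l‖ ≤ M) (a b : Seq) :
    (Summable fun n => ‖∑' k, convTerm s κ a b n k‖ ^ 2) ∧
    ∑' n, ‖∑' k, convTerm s κ a b n k‖ ^ 2 ≤
      convConst s * ∑' q : (ℤ × ℤ) × (ℤ × ℤ), (‖κ q.1 q.2‖ * (‖a q.1‖ * ‖b q.2‖)) ^ 2 := by
  have hp := splitEquiv.summable_iff.2 (summable_pairs hκ a b)
  have h := hp.prod.mul_left (convConst s)
  have hle := fun n => (pow_le_pow_left₀ (norm_nonneg _)
    (norm_tsum_le_tsum_norm (summable_convTerm hs hκ a b n).1) 2).trans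
      (summable_convTerm hs hκ a b n).2
  have hsum := Summable.of_nonneg_of_le (fun n => sq_nonneg _) hle h
  refine ⟨hsum, (hsum.tsum_le_tsum hle h).trans (le_of_eq ?_)⟩
  rw [tsum_mul_left]
  congr 1
  exact hp.tsum_prod.symm.trans (splitEquiv.tsum_eq
    (fun q : (ℤ × ℤ) × (ℤ × ℤ) => (‖κ q.1 q.2‖ * (‖a q.1‖ * ‖b q.2‖)) ^ 2))

variable {s : ℝ} [hs : Fact (1 < s)]

variable (s) in
/-- The weighted convolution with a bounded kernel, as a continuous bilinear map. -/
def conv (κ : Kernel) : Seq →L[ℂ] Seq →L[ℂ] Seq :=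
  LinearMap.mkContinuous₂
    (LinearMap.mk₂ ℂ
      (fun a b => (⟨fun n => ∑' k, convTerm s κ a b n k,
        memℓp_two_iff.2 (memℓp_conv hs.out κ.2 a b).1⟩ : Seq))
      (fun a a' b => by
        ext n
        have h := (summable_convTerm hs.out κ.2 a b n).1.of_norm
        have h' := (summable_convTerm hs.out κ.2 a' b n).1.of_norm
        simp only [lp.coeFn_add, Pi.add_apply]
        rw [← h.tsum_add h']
        congr 1; ext k
        simp only [convTerm, Pi.add_apply]; ring)
      (fun c a b => by
        ext n
        simp only [lp.coeFn_smul, Pi.smul_apply, smul_eq_mul]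
        rw [← tsum_mul_left]
        congr 1; ext k
        simp only [convTerm, Pi.smul_apply, smul_eq_mul]; ring)
      (fun a b b' => by
        ext n
        have h := (summable_convTerm hs.out κ.2 a b n).1.of_norm
        have h' := (summable_convTerm hs.out κ.2 a b' n).1.of_norm
        simp only [lp.coeFn_add, Pi.add_apply]
        rw [← h.tsum_add h']
        congr 1; ext k
        simp only [convTerm, Pi.add_apply]; ring)
      (fun c a b => by
        ext n
        simp only [lp.coeFn_smul, Pi.smul_apply, smul_eq_mul]
        rw [← tsum_mul_left]
        congr 1; ext k
        simp only [convTerm, Pi.smul_apply, smul_eq_mul]; ring))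
    (convConst s)
    (fun a b => by
      have hK := one_le_convConst s
      refine le_of_sq_le_sq ?_ (by positivity)
      rw [LinearMap.mk₂_apply, ← (Seq.hasSum_norm_sq _).tsum_eq]
      refine (memℓp_conv hs.out κ.2 a b).2.trans ?_
      have h1 : ∑' q : (ℤ × ℤ) × (ℤ × ℤ), (‖κ q.1 q.2‖ * (‖a q.1‖ * ‖b q.2‖)) ^ 2
          ≤ ‖a‖ ^ 2 * ‖b‖ ^ 2 := by
        have hm := a.hasSum_norm_sq.summable.mul_of_nonneg b.hasSum_norm_sq.summable
          (fun _ => sq_nonneg _) (fun _ => sq_nonneg _)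
        rw [← a.hasSum_norm_sq.tsum_eq, ← b.hasSum_norm_sq.tsum_eq,
          a.hasSum_norm_sq.summable.tsum_mul_tsum b.hasSum_norm_sq.summable hm]
        refine (summable_pairs κ.2 a b).tsum_le_tsum (fun q => ?_) hm
        rw [mul_pow, mul_pow]
        refine mul_le_of_le_one_left (by positivity) ?_
        exact pow_le_one₀ (norm_nonneg _) (κ.2 _ _)
      calc _ ≤ convConst s * (‖a‖ ^ 2 * ‖b‖ ^ 2) := by gcongr
        _ ≤ convConst s ^ 2 * (‖a‖ ^ 2 * ‖b‖ ^ 2) := by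
            gcongr
            nlinarith
        _ = _ := by ring)

lemma conv_apply (κ : Kernel) (a b : Seq) (n : ℤ × ℤ) :
    conv s κ a b n = ∑' k, convTerm s κ a b n k := rfl

lemma norm_conv_le (κ : Kernel) (a b : Seq) : ‖conv s κ a b‖ ≤ convConst s * ‖a‖ * ‖b‖ :=
  (conv s κ).le_of_opNorm₂_le_of_le
    (LinearMap.mkContinuous₂_norm_le _ (zero_le_one.trans (one_le_convConst s)) _) le_rfl le_rfl

lemma hasSum_conv (κ : Kernel) (a b : Seq) (n : ℤ × ℤ) :
    HasSum (convTerm s κ a b n) (conv s κ a b n) :=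
  (summable_convTerm hs.out κ.2 a b n).1.of_norm.hasSum

/-- A bound for the sum of the absolute values at one output index, uniform over bounded sequences;
it justifies exchanging this sum with the expectation. -/
lemma tsum_norm_convTerm_le (κ : Kernel) (a b : Seq) (n : ℤ × ℤ) :
    ∑' k, ‖convTerm s κ a b n k‖ ≤ convConst s * ‖a‖ * ‖b‖ := by
  have hK := one_le_convConst s
  refine le_of_sq_le_sq ?_ (by positivity)
  refine (summable_convTerm hs.out κ.2 a b n).2.trans ?_
  have hm := a.hasSum_norm_sq.summable.mul_of_nonneg b.hasSum_norm_sq.summable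
    (fun _ => sq_nonneg _) (fun _ => sq_nonneg _)
  have hinj : Function.Injective fun k : ℤ × ℤ => (k, n - k) := fun k k' h =>
    congrArg Prod.fst h
  have hs1 := (summable_pairs κ.2 a b).comp_injective hinj
  have hs2 := hm.comp_injective hinj
  have hle : ∀ k, (‖κ k (n - k)‖ * (‖a k‖ * ‖b (n - k)‖)) ^ 2
      ≤ ‖a k‖ ^ 2 * ‖b (n - k)‖ ^ 2 := fun k => by
    rw [mul_pow, mul_pow]
    exact mul_le_of_le_one_left (by positivity) (pow_le_one₀ (norm_nonneg _) (κ.2 _ _))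
  have h1 : ∑' k, (‖κ k (n - k)‖ * (‖a k‖ * ‖b (n - k)‖)) ^ 2 ≤ ‖a‖ ^ 2 * ‖b‖ ^ 2 := by
    rw [← a.hasSum_norm_sq.tsum_eq, ← b.hasSum_norm_sq.tsum_eq,
      a.hasSum_norm_sq.summable.tsum_mul_tsum b.hasSum_norm_sq.summable hm]
    refine (hs1.tsum_le_tsum hle hs2).trans ?_
    exact tsum_comp_le_tsum_of_inj hm (fun _ => by positivity) hinj
  calc _ ≤ convConst s * (‖a‖ ^ 2 * ‖b‖ ^ 2) := by gcongr
    _ ≤ convConst s ^ 2 * (‖a‖ ^ 2 * ‖b‖ ^ 2) := by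
        gcongr
        nlinarith
    _ = _ := by ring

/-- Strong continuity of the convolution with respect to the kernel and the arguments. -/
lemma tendsto_conv {ι : Type*} {l : Filter ι} [l.IsCountablyGenerated] {κ : ι → Kernel}
    {κ₀ : Kernel}
    {a b : ι → Seq} {a₀ b₀ : Seq} (hκ : ∀ k m, Tendsto (fun i => κ i k m) l (𝓝 (κ₀ k m)))
    (ha : Tendsto a l (𝓝 a₀)) (hb : Tendsto b l (𝓝 b₀)) :
    Tendsto (fun i => conv s (κ i) (a i) (b i)) l (𝓝 (conv s κ₀ a₀ b₀)) := by
  have hK := one_le_convConst s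
  have e : ∀ i, conv s (κ i) (a i) (b i) = conv s (κ i) (a i - a₀) (b i)
      + conv s (κ i) a₀ (b i - b₀) + conv s (κ i) a₀ b₀ := fun i => by
    simp only [map_sub, sub_apply]; abel
  simp only [e]
  have h1 : Tendsto (fun i => conv s (κ i) (a i - a₀) (b i)) l (𝓝 0) := by
    refine squeeze_zero_norm (fun i => norm_conv_le _ _ _) ?_
    have := ((tendsto_iff_norm_sub_tendsto_zero.1 ha).const_mul (convConst s)).mul hb.norm
    simpa using this
  have h2 : Tendsto (fun i => conv s (κ i) a₀ (b i - b₀)) l (𝓝 0) := by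
    refine squeeze_zero_norm (fun i => norm_conv_le _ _ _) ?_
    have := (tendsto_iff_norm_sub_tendsto_zero.1 hb).const_mul (convConst s * ‖a₀‖)
    simpa using this
  -- The oscillating kernels depend on time through unbounded frequencies, so no convergence in
  -- operator norm is available. With fixed arguments, pointwise convergence of the kernels suffices
  -- by dominated convergence over pairs of indices.
  have h3 : Tendsto (fun i => conv s (κ i) a₀ b₀) l (𝓝 (conv s κ₀ a₀ b₀)) := by
    rw [tendsto_iff_norm_sub_tendsto_zero]
    have hb2 : ∀ i k m, ‖κ i k m - κ₀ k m‖ ≤ 2 := fun i k m =>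
      (norm_sub_le _ _).trans (by linarith [(κ i).2 k m, κ₀.2 k m])
    have hd : Tendsto (fun i => ∑' q : (ℤ × ℤ) × (ℤ × ℤ),
        (‖κ i q.1 q.2 - κ₀ q.1 q.2‖ * (‖a₀ q.1‖ * ‖b₀ q.2‖)) ^ 2) l (𝓝 0) := by
      have := tendsto_tsum_of_dominated_convergence (𝓕 := l)
        (f := fun i (q : (ℤ × ℤ) × (ℤ × ℤ)) =>
          (‖κ i q.1 q.2 - κ₀ q.1 q.2‖ * (‖a₀ q.1‖ * ‖b₀ q.2‖)) ^ 2) (g := fun _ => 0)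
        (summable_pairs (κ := fun _ _ => 2) (M := 2) (by simp) a₀ b₀) (fun q => by
          have := ((tendsto_iff_norm_sub_tendsto_zero.1 (hκ q.1 q.2)).mul_const
            (‖a₀ q.1‖ * ‖b₀ q.2‖)).pow 2
          simpa using this)
        (Eventually.of_forall fun i q => by
          rw [Real.norm_of_nonneg (sq_nonneg _)]
          have h2 : ‖(2 : ℂ)‖ = 2 := by norm_num
          have := hb2 i q.1 q.2
          rw [h2]
          gcongr)
      simpa using this
    have hd2 := (hd.const_mul (convConst s)).sqrt
    rw [mul_zero, Real.sqrt_zero] at hd2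
    refine squeeze_zero (fun _ => norm_nonneg _) (fun i => ?_) hd2
    refine Real.le_sqrt_of_sq_le ?_
    rw [← (Seq.hasSum_norm_sq _).tsum_eq]
    convert! (memℓp_conv hs.out (κ := fun k m => κ i k m - κ₀ k m) (hb2 i) a₀ b₀).2 using 4 with n
    simp only [lp.coeFn_sub, Pi.sub_apply, conv_apply]
    rw [← (hasSum_conv (κ i) a₀ b₀ n).summable.tsum_sub (hasSum_conv κ₀ a₀ b₀ n).summable]
    refine congrArg norm (tsum_congr fun k => ?_)
    simp only [convTerm]; ring
  simpa using (h1.add h2).add h3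

end SequenceSpace

/-! ### Nonresonance of KP-II and the oscillating kernels divided by the resonance function. -/

section Resonance

/-- All the first components in the interaction `k + l` are nonzero. -/
def Good (k l : ℤ × ℤ) : Prop := k.1 ≠ 0 ∧ l.1 ≠ 0 ∧ (k + l).1 ≠ 0

instance (k l : ℤ × ℤ) : Decidable (Good k l) := by unfold Good; infer_instance

lemma Good.symm {k l : ℤ × ℤ} (h : Good k l) : Good l k := ⟨h.2.1, h.1, by rw [add_comm]; exact h.2.2⟩

lemma good_comm {k l : ℤ × ℤ} : Good k l ↔ Good l k := ⟨Good.symm, Good.symm⟩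

/-- The resonance function. -/
def res (k l : ℤ × ℤ) : ℝ := omega k + omega l - omega (k + l)

lemma res_comm (k l : ℤ × ℤ) : res k l = res l k := by unfold res; rw [add_comm k l]; ring

/-- Both squares carry the same sign. For the opposite sign of the n_2²/n_1 term in the dispersion
relation they could cancel, and resonances would appear. -/
lemma res_mul {k l : ℤ × ℤ} (h : Good k l) :
    res k l * ((k.1 : ℝ) * l.1 * (k + l).1) =
      -(3 * ((k.1 : ℝ) * l.1 * (k + l).1) ^ 2 + ((k.1 : ℝ) * l.2 - l.1 * k.2) ^ 2) := by
  obtain ⟨h1, h2, h3⟩ := h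
  have h1' : (k.1 : ℝ) ≠ 0 := by exact_mod_cast h1
  have h2' : (l.1 : ℝ) ≠ 0 := by exact_mod_cast h2
  have h3' : ((k.1 : ℝ) + l.1) ≠ 0 := by exact_mod_cast h3
  simp only [res, omega, Prod.fst_add, Prod.snd_add, Int.cast_add]
  field_simp
  ring

/-- The KP-II equation has no resonances. -/
lemma le_abs_res {k l : ℤ × ℤ} (h : Good k l) :
    3 * (|(k.1 : ℝ)| * |(l.1 : ℝ)| * |((k + l).1 : ℝ)|) ≤ |res k l| := by
  have h0 := res_mul h
  obtain ⟨h1, h2, h3⟩ := h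
  have hpos : 0 < |(k.1 : ℝ)| * |(l.1 : ℝ)| * |((k + l).1 : ℝ)| := by
    have := one_le_abs_cast h1
    have := one_le_abs_cast h2
    have := one_le_abs_cast h3
    positivity
  have h4 := congrArg abs h0
  rw [abs_mul, abs_neg, abs_mul, abs_mul,
    abs_of_nonneg (by positivity : (0 : ℝ) ≤ 3 * ((k.1 : ℝ) * l.1 * (k + l).1) ^ 2
      + ((k.1 : ℝ) * l.2 - l.1 * k.2) ^ 2)] at h4
  have h5 : ((k.1 : ℝ) * l.1 * (k + l).1) ^ 2
      = (|(k.1 : ℝ)| * |(l.1 : ℝ)| * |((k + l).1 : ℝ)|) ^ 2 := by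
    rw [mul_pow, mul_pow, mul_pow, mul_pow, sq_abs, sq_abs, sq_abs]
  rw [h5] at h4
  nlinarith [sq_nonneg ((k.1 : ℝ) * l.2 - l.1 * k.2)]

lemma three_le_abs_res {k l : ℤ × ℤ} (h : Good k l) : 3 ≤ |res k l| := by
  refine le_trans ?_ (le_abs_res h)
  have h1 := one_le_abs_cast h.1
  have h2 := one_le_abs_cast h.2.1
  have h3 := one_le_abs_cast h.2.2
  have := one_le_mul_of_one_le_of_one_le (one_le_mul_of_one_le_of_one_le h1 h2) h3
  linarith

lemma res_ne_zero {k l : ℤ × ℤ} (h : Good k l) : res k l ≠ 0 := by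
  have := three_le_abs_res h
  intro h0
  rw [h0] at this
  norm_num at this

/-- The oscillating symbol with coefficient `c`. -/
def symb (c : ℤ × ℤ → ℤ × ℤ → ℝ) (t : ℝ) (k l : ℤ × ℤ) : ℂ :=
  if Good k l then (c k l : ℂ) * Complex.exp (Complex.I * ((res k l * t : ℝ) : ℂ)) else 0

lemma norm_exp_I_mul (x : ℝ) : ‖Complex.exp (Complex.I * (x : ℂ))‖ = 1 := by
  rw [mul_comm]; exact Complex.norm_exp_ofReal_mul_I x

lemma norm_symb_le {c : ℤ × ℤ → ℤ × ℤ → ℝ} (hc : ∀ k l, Good k l → |c k l| ≤ 1) (t : ℝ)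
    (k l : ℤ × ℤ) : ‖symb c t k l‖ ≤ 1 := by
  unfold symb
  split_ifs with h
  · rw [norm_mul, norm_exp_I_mul, mul_one, Complex.norm_real]
    exact hc k l h
  · simp

lemma continuous_symb (c : ℤ × ℤ → ℤ × ℤ → ℝ) (k l : ℤ × ℤ) : Continuous fun t => symb c t k l := by
  unfold symb
  split_ifs
  · fun_prop
  · fun_prop

/-- All kernels divided by the resonance function have a numerator that is a product of some of the
three first components; as these are at least 1 in absolute value, the full product dominates it. -/
lemma abs_div_res_le {k l : ℤ × ℤ} (h : Good k l) {x : ℝ}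
    (hx : |x| ≤ |(k.1 : ℝ)| * |(l.1 : ℝ)| * |((k + l).1 : ℝ)|) : |x / res k l| ≤ 1 := by
  rw [abs_div, div_le_one (by linarith [three_le_abs_res h])]
  have := le_abs_res h
  have : (0 : ℝ) ≤ |(k.1 : ℝ)| * |(l.1 : ℝ)| * |((k + l).1 : ℝ)| := by positivity
  linarith

/-- The kernel of the nonlinearity in the interaction representation. -/
def kerNL (t : ℝ) : Kernel :=
  ⟨symb (fun _ _ => 1) t, norm_symb_le (by simp) t⟩

/-- The kernel of the normal form transformation. -/
def kerNF (t : ℝ) : Kernel :=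
  ⟨symb (fun k l => ((k + l).1 : ℝ) / res k l) t, norm_symb_le (fun k l h => abs_div_res_le h (by
    have h1 := one_le_abs_cast h.1
    have h2 := one_le_abs_cast h.2.1
    have h3 := one_le_abs_cast h.2.2
    nlinarith [one_le_mul_of_one_le_of_one_le h1 h2])) t⟩

/-- The kernel of the cubic nonlinearity after the normal form transformation. -/
def kerCub (t : ℝ) : Kernel :=
  ⟨symb (fun k l => ((k + l).1 : ℝ) * k.1 / res k l) t,
    norm_symb_le (fun k l h => abs_div_res_le h (by
    have h1 := one_le_abs_cast h.1
    have h2 := one_le_abs_cast h.2.1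
    have h3 := one_le_abs_cast h.2.2
    rw [abs_mul]
    nlinarith [one_le_mul_of_one_le_of_one_le h1 h3])) t⟩

/-- The kernel `kerCub` without the factor of the output frequency. -/
def kerHalf (t : ℝ) : Kernel :=
  ⟨symb (fun k l => (k.1 : ℝ) / res k l) t, norm_symb_le (fun k l h => abs_div_res_le h (by
    have h1 := one_le_abs_cast h.1
    have h2 := one_le_abs_cast h.2.1
    have h3 := one_le_abs_cast h.2.2
    nlinarith [one_le_mul_of_one_le_of_one_le h2 h3])) t⟩

/-- The kernel `kerNF` without the factor of the output frequency. -/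
def kerInv (t : ℝ) : Kernel :=
  ⟨symb (fun k l => 1 / res k l) t, norm_symb_le (fun k l h => abs_div_res_le h (by
    have h1 := one_le_abs_cast h.1
    have h2 := one_le_abs_cast h.2.1
    have h3 := one_le_abs_cast h.2.2
    rw [abs_one]
    exact one_le_mul_of_one_le_of_one_le (one_le_mul_of_one_le_of_one_le h1 h2) h3)) t⟩

lemma norm_exp_sub_exp_le (r t t' : ℝ) :
    ‖Complex.exp (Complex.I * ((r * t' : ℝ) : ℂ)) - Complex.exp (Complex.I * ((r * t : ℝ) : ℂ))‖
      ≤ |r| * |t' - t| := by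
  have : Complex.exp (Complex.I * ((r * t' : ℝ) : ℂ)) - Complex.exp (Complex.I * ((r * t : ℝ) : ℂ))
      = Complex.exp (Complex.I * ((r * t : ℝ) : ℂ)) *
        (Complex.exp (Complex.I * ((r * (t' - t) : ℝ) : ℂ)) - 1) := by
    rw [mul_sub, ← Complex.exp_add, mul_one]
    congr 2
    push_cast; ring
  rw [this, norm_mul, norm_exp_I_mul, one_mul, ← abs_mul]
  exact Real.norm_exp_I_mul_ofReal_sub_one_le

/-- The difference quotient of `kerInv`. -/
def kerSlope (t t' : ℝ) : Kernel :=
  ⟨fun k l => ((t' - t : ℝ) : ℂ)⁻¹ * (kerInv t' k l - kerInv t k l), fun k l => by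
    change ‖((t' - t : ℝ) : ℂ)⁻¹ * (symb _ t' k l - symb _ t k l)‖ ≤ 1
    unfold symb
    split_ifs with h
    · rw [← mul_sub, norm_mul, norm_mul, norm_inv, Complex.norm_real, Complex.norm_real]
      have h1 := norm_exp_sub_exp_le (res k l) t t'
      have h3 : 0 < |res k l| := by linarith [three_le_abs_res h]
      rcases eq_or_ne t' t with rfl | hne
      · simp
      have h2 : 0 < |t' - t| := abs_pos.2 (sub_ne_zero.2 hne)
      rw [Real.norm_eq_abs, Real.norm_eq_abs, abs_div, abs_one]
      calc |t' - t|⁻¹ * (1 / |res k l| * _) ≤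
          |t' - t|⁻¹ * (1 / |res k l| * (|res k l| * |t' - t|)) := by gcongr
        _ = 1 := by field_simp
    · simp⟩

/-- The kernel `i · kerNL`. -/
def kerINL (t : ℝ) : Kernel :=
  ⟨fun k l => Complex.I * kerNL t k l, fun k l => by
    rw [norm_mul, Complex.norm_I, one_mul]; exact (kerNL t).2 k l⟩

/-- Differentiating e^{i res t}/res in time cancels the denominator. The limit holds for each pair
of indices only, which is what `tendsto_conv` requires. -/
lemma tendsto_kerSlope (t : ℝ) (k l : ℤ × ℤ) :
    Tendsto (fun t' => kerSlope t t' k l) (𝓝[≠] t) (𝓝 (kerINL t k l)) := by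
  have h : HasDerivAt (fun t' => kerInv t' k l) (kerINL t k l) t := by
    change HasDerivAt (fun t' => symb (fun k l => 1 / res k l) t' k l)
      (Complex.I * symb (fun _ _ => 1) t k l) t
    unfold symb
    split_ifs with h
    · have h1 : HasDerivAt (fun x : ℝ => Complex.I * ((res k l * x : ℝ) : ℂ))
          (Complex.I * (res k l : ℂ)) t := by
        have := ((hasDerivAt_id t).const_mul (res k l)).ofReal_comp.const_mul Complex.I
        simpa using this
      have h2 := h1.cexp.const_mul (((1 / res k l : ℝ)) : ℂ)
      refine h2.congr_deriv ?_
      have : (res k l : ℂ) ≠ 0 := by exact_mod_cast res_ne_zero h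
      push_cast
      field_simp
    · rw [mul_zero]; exact hasDerivAt_const _ _
  refine (hasDerivAt_iff_tendsto_slope.1 h).congr fun t' => ?_
  simp only [slope, vsub_eq_sub, kerSlope, Complex.real_smul, Complex.ofReal_inv]

end Resonance

/-! ### Fourier multipliers, the antiderivative in x, and differentiation of the normal form
correction. -/

section Multipliers

variable {s : ℝ} [hs : Fact (1 < s)]

/-- Bounded multipliers. -/
def Mult : Type := {m : ℤ × ℤ → ℂ // ∀ n, ‖m n‖ ≤ 1}

instance : CoeFun Mult fun _ => ℤ × ℤ → ℂ := ⟨Subtype.val⟩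

variable (s) in
/-- The action of a bounded multiplier on sequences. -/
def mulSeq (m : Mult) : Seq →L[ℂ] Seq :=
  -- Convolution with the unit mass at index 0, where the weight is 1 and the ratio of weights is
  -- therefore 1. Multipliers thus inherit boundedness and strong continuity from the convolutions.
  conv s ⟨fun _ l => m l, fun _ l => m.2 l⟩ (lp.single 2 0 1)

lemma mulSeq_apply (m : Mult) (a : Seq) (n : ℤ × ℤ) : mulSeq s m a n = m n * a n := by
  rw [mulSeq]
  refine (conv_apply (s := s) _ _ _ n).trans ?_
  rw [tsum_eq_single 0]
  · have := (weight_pos s n).ne'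
    simp [convTerm, ratio, weight_zero, this]
  · intro k hk
    simp [convTerm, hk]

lemma tendsto_mulSeq {ι : Type*} {l : Filter ι} [l.IsCountablyGenerated] {m : ι → Mult}
    {m₀ : Mult} {a : ι → Seq} {a₀ : Seq} (hm : ∀ n, Tendsto (fun i => m i n) l (𝓝 (m₀ n)))
    (ha : Tendsto a l (𝓝 a₀)) :
    Tendsto (fun i => mulSeq s (m i) (a i)) l (𝓝 (mulSeq s m₀ a₀)) :=
  tendsto_conv (fun _ n => hm n) tendsto_const_nhds ha

variable (s) in
/-- The antiderivative in `x`, up to the factor `i`. -/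
def antideriv : Seq →L[ℂ] Seq :=
  mulSeq s ⟨fun n => (n.1 : ℂ)⁻¹, fun n => by
    rw [norm_inv, Complex.norm_intCast]
    by_cases h : n.1 = 0
    · simp [h]
    · exact inv_le_one_of_one_le₀ (one_le_abs_cast h)⟩

lemma antideriv_apply (a : Seq) (n : ℤ × ℤ) : antideriv s a n = (n.1 : ℂ)⁻¹ * a n :=
  mulSeq_apply _ _ _

/-- The antiderivative multiplies by the inverse of n_1, which is 0 by convention when n_1 = 0, so
equality on those modes has to be supplied. -/
lemma antideriv_injective {a b : Seq} (h : antideriv s a = antideriv s b)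
    (h0 : ∀ n : ℤ × ℤ, n.1 = 0 → a n = b n) : a = b := by
  ext n
  by_cases hn : n.1 = 0
  · exact h0 n hn
  · have := congrArg (fun x : Seq => x n) h
    simp only [antideriv_apply] at this
    exact mul_left_cancel₀ (inv_ne_zero (by exact_mod_cast hn)) this

lemma conv_comm {κ : Kernel} (hκ : ∀ k l, κ k l = κ l k) (a b : Seq) :
    conv s κ a b = conv s κ b a := by
  ext n
  rw [conv_apply, conv_apply, ← (Equiv.subLeft n).tsum_eq]
  refine tsum_congr fun k => ?_
  simp only [convTerm, Equiv.subLeft_apply, sub_sub_cancel, ratio]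
  rw [hκ, add_comm k, mul_comm (weight s k)]
  ring

lemma symb_comm {c : ℤ × ℤ → ℤ × ℤ → ℝ} (hc : ∀ k l, c k l = c l k) (t : ℝ) (k l : ℤ × ℤ) :
    symb c t k l = symb c t l k := by
  unfold symb
  rw [hc, res_comm, if_congr good_comm rfl rfl]

lemma kerInv_comm (t : ℝ) (a b : Seq) : conv s (kerInv t) a b = conv s (kerInv t) b a :=
  conv_comm (symb_comm (fun k l => by rw [res_comm]) t) a b

lemma antideriv_conv {κ κ' : Kernel} (h : ∀ k l, ((k + l).1 : ℂ)⁻¹ * κ k l = κ' k l) (a b : Seq) :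
    antideriv s (conv s κ a b) = conv s κ' a b := by
  ext n
  rw [antideriv_apply, conv_apply, conv_apply, ← tsum_mul_left]
  refine tsum_congr fun k => ?_
  simp only [convTerm]
  rw [← h, add_sub_cancel]
  ring

lemma antideriv_kerNF (t : ℝ) (a b : Seq) :
    antideriv s (conv s (kerNF t) a b) = conv s (kerInv t) a b := by
  refine antideriv_conv (fun k l => ?_) a b
  change _ * symb (fun k l => ((k + l).1 : ℝ) / res k l) t k l
    = symb (fun k l => 1 / res k l) t k l
  unfold symb
  split_ifs with h
  · have := h.2.2
    have h3 : (((k + l).1 : ℤ) : ℂ) ≠ 0 := by exact_mod_cast h.2.2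
    push_cast
    field_simp
  · simp

lemma antideriv_kerCub (t : ℝ) (a b : Seq) :
    antideriv s (conv s (kerCub t) a b) = conv s (kerHalf t) a b := by
  refine antideriv_conv (fun k l => ?_) a b
  change _ * symb (fun k l => ((k + l).1 : ℝ) * k.1 / res k l) t k l
    = symb (fun k l => (k.1 : ℝ) / res k l) t k l
  unfold symb
  split_ifs with h
  · have h3 : (((k + l).1 : ℤ) : ℂ) ≠ 0 := by exact_mod_cast h.2.2
    push_cast
    field_simp
  · simp

/-- The factor k_1 in `kerHalf` undoes the antiderivative in the first argument. Hence the
correction can be differentiated along curves for which only the antiderivative is differentiable.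
-/
lemma kerHalf_antideriv (t : ℝ) (a b : Seq) :
    conv s (kerHalf t) (antideriv s a) b = conv s (kerInv t) a b := by
  ext n
  rw [conv_apply, conv_apply]
  refine tsum_congr fun k => ?_
  simp only [convTerm, antideriv_apply]
  change symb (fun k l => (k.1 : ℝ) / res k l) t k (n - k) * _ * _
    = symb (fun k l => 1 / res k l) t k (n - k) * _ * _
  unfold symb
  split_ifs with h
  · have h3 : (k.1 : ℂ) ≠ 0 := by exact_mod_cast h.1
    push_cast
    field_simp
  · simp

lemma conv_eq_zero {c : ℤ × ℤ → ℤ × ℤ → ℝ} {κ : Kernel} {t : ℝ} (hκ : κ.1 = symb c t) (a b : Seq)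
    {n : ℤ × ℤ} (hn : n.1 = 0) : conv s κ a b n = 0 := by
  rw [conv_apply]
  convert tsum_zero with k
  have : ¬ Good k (n - k) := fun h => h.2.2 (by simpa using hn)
  simp [convTerm, hκ, symb, this]

lemma conv_kerINL (t : ℝ) (a b : Seq) :
    conv s (kerINL t) a b = Complex.I • conv s (kerNL t) a b := by
  ext n
  simp only [lp.coeFn_smul, Pi.smul_apply, smul_eq_mul]
  rw [conv_apply, conv_apply, ← tsum_mul_left]
  refine tsum_congr fun k => ?_
  simp only [convTerm, kerINL]
  ring

lemma conv_kerSlope (t t' : ℝ) (a b : Seq) :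
    conv s (kerSlope t t') a b
      = (t' - t)⁻¹ • (conv s (kerInv t') a b - conv s (kerInv t) a b) := by
  ext n
  simp only [lp.coeFn_smul, Pi.smul_apply, lp.coeFn_sub, Pi.sub_apply, Complex.real_smul]
  rw [conv_apply, conv_apply, conv_apply,
    ← (hasSum_conv (kerInv t') a b n).summable.tsum_sub (hasSum_conv (kerInv t) a b n).summable,
    ← tsum_mul_left]
  refine tsum_congr fun k => ?_
  simp only [convTerm, kerSlope]
  push_cast
  ring

lemma real_smul_seq (r : ℝ) (x : Seq) : r • x = (r : ℂ) • x := by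
  ext n
  simp only [lp.coeFn_smul, Pi.smul_apply, Complex.real_smul, smul_eq_mul]

/-- A discrete product rule: one term from the kernel, and one from the polarisation B(a',a') -
B(a,a) = B(a' - a, a' + a) of the symmetric form, where the difference enters only through its
antiderivative. -/
lemma slope_conv_kerInv (a : ℝ → Seq) (t t' : ℝ) :
    slope (fun τ => conv s (kerInv τ) (a τ) (a τ)) t t'
      = conv s (kerSlope t t') (a t) (a t)
        + conv s (kerHalf t') (slope (fun τ => antideriv s (a τ)) t t') (a t' + a t) := by
  have h1 : conv s (kerInv t') (a t') (a t') - conv s (kerInv t') (a t) (a t)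
      = conv s (kerHalf t') (antideriv s (a t') - antideriv s (a t)) (a t' + a t) := by
    rw [← map_sub, kerHalf_antideriv]
    simp only [map_sub, map_add, sub_apply]
    rw [kerInv_comm t' (a t) (a t')]
    abel
  rw [conv_kerSlope]
  simp only [slope, vsub_eq_sub, real_smul_seq, map_smul, smul_apply]
  rw [← h1, ← smul_add]
  congr 1
  abel

/-- The derivative of the normal form correction along a curve. -/
lemma hasDerivAt_conv_kerInv {a : ℝ → Seq} {t : ℝ} {z : Seq} (ha : ContinuousAt a t)
    (hz : HasDerivAt (fun τ => antideriv s (a τ)) z t) :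
    HasDerivAt (fun τ => conv s (kerInv τ) (a τ) (a τ))
      (Complex.I • conv s (kerNL t) (a t) (a t) + (2 : ℝ) • conv s (kerHalf t) z (a t)) t := by
  rw [hasDerivAt_iff_tendsto_slope]
  have e : (2 : ℝ) • conv s (kerHalf t) z (a t) = conv s (kerHalf t) z (a t + a t) := by
    rw [map_add, two_smul]
  rw [← conv_kerINL, e]
  refine Tendsto.congr (fun t' => (slope_conv_kerInv a t t').symm) ?_
  have ha' : Tendsto a (𝓝[≠] t) (𝓝 (a t)) := ha.tendsto.mono_left nhdsWithin_le_nhds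
  refine (tendsto_conv (tendsto_kerSlope t) tendsto_const_nhds tendsto_const_nhds).add ?_
  refine tendsto_conv (fun k l => ?_) (hasDerivAt_iff_tendsto_slope.1 hz)
    (ha'.add tendsto_const_nhds)
  exact (continuous_symb (fun k l => (k.1 : ℝ) / res k l) k l).continuousAt.tendsto.mono_left nhdsWithin_le_nhds

/-- If the normal form variable has the derivative given by the cubic equation, then the original
variable has the derivative given by the quadratic equation. -/
lemma hasDerivAt_antideriv_of_normalForm {a : ℝ → Seq} {t ε : ℝ} (hε : 0 ≤ ε)
    (ha : ContinuousAt a t) (hsmall : ε * (convConst s * (2 * ‖a t‖)) < 1)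
    (hG : HasDerivAt (fun τ => antideriv s (a τ) + (ε / 2) • conv s (kerInv τ) (a τ) (a τ))
      (-(Complex.I * (ε ^ 2 / 2)) • conv s (kerHalf t) (conv s (kerNL t) (a t) (a t)) (a t)) t) :
    HasDerivAt (fun τ => antideriv s (a τ))
      (-(Complex.I * (ε / 2)) • conv s (kerNL t) (a t) (a t)) t := by
  rw [hasDerivAt_iff_tendsto_slope] at hG ⊢
  set S := fun t' => slope (fun τ => antideriv s (a τ)) t t' with hS
  set z := -(Complex.I * (ε / 2)) • conv s (kerNL t) (a t) (a t) with hz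
  have ha' : Tendsto a (𝓝[≠] t) (𝓝 (a t)) := ha.tendsto.mono_left nhdsWithin_le_nhds
  have hsl : ∀ t', slope (fun τ => antideriv s (a τ) + (ε / 2) • conv s (kerInv τ) (a τ) (a τ)) t t'
      = S t' + (ε / 2) • (conv s (kerSlope t t') (a t) (a t)
        + conv s (kerHalf t') (S t') (a t' + a t)) := fun t' => by
    rw [hS, ← slope_conv_kerInv]
    simp only [slope, vsub_eq_sub]
    module
  -- The error made by the expected limit z in the difference quotient identity. The limit of r is
  -- zero because z cancels the quadratic term and turns the remaining one into the cubic term of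
  -- the assumed derivative.
  set r := fun t' => slope (fun τ => antideriv s (a τ)
      + (ε / 2) • conv s (kerInv τ) (a τ) (a τ)) t t' - z
      - (ε / 2) • (conv s (kerSlope t t') (a t) (a t)
        + conv s (kerHalf t') z (a t' + a t)) with hr
  have hr0 : Tendsto r (𝓝[≠] t) (𝓝 0) := by
    have h1 := tendsto_conv (s := s) (tendsto_kerSlope t)
      (tendsto_const_nhds (x := a t)) (tendsto_const_nhds (x := a t))
    have h2 : Tendsto (fun t' => conv s (kerHalf t') z (a t' + a t)) (𝓝[≠] t)
        (𝓝 (conv s (kerHalf t) z (a t + a t))) :=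
      tendsto_conv (fun k l => (continuous_symb (fun k l => (k.1 : ℝ) / res k l) k l).continuousAt.tendsto.mono_left
        nhdsWithin_le_nhds) tendsto_const_nhds (ha'.add tendsto_const_nhds)
    have h3 := (hG.sub_const z).sub ((h1.add h2).const_smul (ε / 2))
    convert h3 using 2
    rw [conv_kerINL, hz]
    simp only [map_smul, smul_apply, map_add, real_smul_seq]
    push_cast
    module
  -- The deviation S - z solves a linear equation with right-hand side r. By the smallness of ε the
  -- bilinear term has norm at most half of that of S - z near t, so ‖S - z‖ ≤ 2‖r‖ tends to zero.
  have hid : ∀ t', S t' - z + (ε / 2) • conv s (kerHalf t') (S t' - z) (a t' + a t) = r t' :=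
    fun t' => by
      rw [hr]
      simp only [hsl, map_sub, sub_apply]
      module
  have hev : ∀ᶠ t' in 𝓝[≠] t, ε * (convConst s * (‖a t'‖ + ‖a t‖)) < 1 := by
    have h1 : Tendsto (fun t' => ε * (convConst s * (‖a t'‖ + ‖a t‖))) (𝓝[≠] t)
        (𝓝 (ε * (convConst s * (‖a t‖ + ‖a t‖)))) :=
      ((ha'.norm.add tendsto_const_nhds).const_mul _).const_mul _
    refine h1.eventually_lt_const ?_
    rwa [← two_mul]
  rw [tendsto_iff_norm_sub_tendsto_zero]
  have hlim : Tendsto (fun t' => 2 * ‖r t'‖) (𝓝[≠] t) (𝓝 0) := by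
    simpa using hr0.norm.const_mul 2
  refine squeeze_zero' (Eventually.of_forall fun _ => norm_nonneg _) ?_ hlim
  filter_upwards [hev] with t' ht'
  have h1 : ‖S t' - z‖ ≤ ‖r t'‖ + (ε / 2) * (convConst s * ‖S t' - z‖ * (‖a t'‖ + ‖a t‖)) := by
    have h2 : S t' - z = r t' - (ε / 2) • conv s (kerHalf t') (S t' - z) (a t' + a t) := by
      rw [← hid t']; abel
    calc ‖S t' - z‖ ≤ ‖r t'‖ + ‖(ε / 2) • conv s (kerHalf t') (S t' - z) (a t' + a t)‖ := by
          conv_lhs => rw [h2]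
          exact norm_sub_le _ _
      _ ≤ _ := by
          rw [norm_smul, Real.norm_of_nonneg (by positivity : 0 ≤ ε / 2)]
          gcongr
          refine (norm_conv_le _ _ _).trans ?_
          have := one_le_convConst s
          gcongr
          exact norm_add_le _ _
  nlinarith [norm_nonneg (S t' - z)]

end Multipliers

/-! ### The integrated equation, its normal form, the a priori bound and Lipschitz dependence. -/

section Dynamics

variable {s : ℝ} [hs : Fact (1 < s)]

variable (s) in
/-- The quadratic nonlinearity in the interaction representation. -/
def quad (t : ℝ) (a : Seq) : Seq := conv s (kerNL t) a a

variable (s) in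
/-- The quadratic term of the normal form. -/
def normalQuad (t : ℝ) (a : Seq) : Seq := conv s (kerNF t) a a

variable (s) in
/-- The cubic term of the normal form. -/
def cubic (t : ℝ) (a : Seq) : Seq := conv s (kerCub t) (quad s t a) a

lemma continuous_conv {X : Type*} [TopologicalSpace X] [FirstCountableTopology X] {κ : X → Kernel}
    {a b : X → Seq} (hκ : ∀ k l, Continuous fun x => κ x k l) (ha : Continuous a)
    (hb : Continuous b) : Continuous fun x => conv s (κ x) (a x) (b x) :=
  continuous_iff_continuousAt.2 fun x =>
    tendsto_conv (fun k l => (hκ k l).tendsto x) (ha.tendsto x) (hb.tendsto x)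

lemma continuous_quad {X : Type*} [TopologicalSpace X] [FirstCountableTopology X] {τ : X → ℝ}
    {a : X → Seq} (hτ : Continuous τ) (ha : Continuous a) : Continuous fun x => quad s (τ x) (a x) :=
  continuous_conv (fun k l => (continuous_symb (fun _ _ => 1) k l).comp hτ) ha ha

lemma continuous_normalQuad {X : Type*} [TopologicalSpace X] [FirstCountableTopology X] {τ : X → ℝ}
    {a : X → Seq} (hτ : Continuous τ) (ha : Continuous a) :
    Continuous fun x => normalQuad s (τ x) (a x) :=
  continuous_conv (fun k l => (continuous_symb (fun k l => ((k + l).1 : ℝ) / res k l) k l).comp hτ)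
    ha ha

lemma continuous_cubic {X : Type*} [TopologicalSpace X] [FirstCountableTopology X] {τ : X → ℝ}
    {a : X → Seq} (hτ : Continuous τ) (ha : Continuous a) :
    Continuous fun x => cubic s (τ x) (a x) :=
  continuous_conv
    (fun k l => (continuous_symb (fun k l => ((k + l).1 : ℝ) * k.1 / res k l) k l).comp hτ)
    (continuous_quad hτ ha) ha

lemma continuous_quad_curve {a : ℝ → Seq} (ha : Continuous a) :
    Continuous fun τ => quad s τ (a τ) := continuous_quad continuous_id ha

lemma continuous_cubic_curve {a : ℝ → Seq} (ha : Continuous a) :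
    Continuous fun τ => cubic s τ (a τ) := continuous_cubic continuous_id ha

lemma continuous_smul_quad {a : ℝ → Seq} (ha : Continuous a) (c : ℂ) :
    Continuous fun τ => c • quad s τ (a τ) :=
  (continuous_quad_curve ha).fun_const_smul c

lemma norm_conv_self_sub_le (κ : Kernel) (a b : Seq) :
    ‖conv s κ a a - conv s κ b b‖ ≤ convConst s * (‖a‖ + ‖b‖) * ‖a - b‖ := by
  have e : conv s κ a a - conv s κ b b = conv s κ (a - b) a + conv s κ b (a - b) := by
    simp only [map_sub, sub_apply]; abel
  rw [e]
  refine (norm_add_le _ _).trans ?_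
  refine (add_le_add (norm_conv_le _ _ _) (norm_conv_le _ _ _)).trans (le_of_eq ?_)
  ring

lemma norm_cubic_le (t : ℝ) {a : Seq} {M : ℝ} (ha : ‖a‖ ≤ M) :
    ‖cubic s t a‖ ≤ convConst s ^ 2 * M ^ 3 := by
  have hK := one_le_convConst s
  have hM : 0 ≤ M := (norm_nonneg _).trans ha
  have h1 : ‖quad s t a‖ ≤ convConst s * M * M :=
    (norm_conv_le _ _ _).trans (by gcongr)
  calc ‖cubic s t a‖ ≤ convConst s * ‖quad s t a‖ * ‖a‖ := norm_conv_le _ _ _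
    _ ≤ convConst s * (convConst s * M * M) * M := by gcongr
    _ = _ := by ring

lemma norm_cubic_sub_le (t : ℝ) {a b : Seq} {M : ℝ} (ha : ‖a‖ ≤ M) (hb : ‖b‖ ≤ M) :
    ‖cubic s t a - cubic s t b‖ ≤ 3 * convConst s ^ 2 * M ^ 2 * ‖a - b‖ := by
  have hK := one_le_convConst s
  have hM : 0 ≤ M := (norm_nonneg _).trans ha
  have e : cubic s t a - cubic s t b = conv s (kerCub t) (quad s t a - quad s t b) a
      + conv s (kerCub t) (quad s t b) (a - b) := by
    simp only [cubic, map_sub, sub_apply]; abel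
  rw [e]
  have h1 : ‖quad s t a - quad s t b‖ ≤ convConst s * (M + M) * ‖a - b‖ :=
    (norm_conv_self_sub_le _ _ _).trans (by gcongr)
  have h2 : ‖quad s t b‖ ≤ convConst s * M * M := (norm_conv_le _ _ _).trans (by gcongr)
  calc _ ≤ convConst s * ‖quad s t a - quad s t b‖ * ‖a‖
        + convConst s * ‖quad s t b‖ * ‖a - b‖ :=
        (norm_add_le _ _).trans (add_le_add (norm_conv_le _ _ _) (norm_conv_le _ _ _))
    _ ≤ convConst s * (convConst s * (M + M) * ‖a - b‖) * M
        + convConst s * (convConst s * M * M) * ‖a - b‖ := by gcongr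
    _ = _ := by ring

variable (s) in
/-- Solutions of the equation in the interaction representation, integrated in space and time. -/
structure IsMild (ε T : ℝ) (a₀ : Seq) (a : ℝ → Seq) : Prop where
  cont : Continuous a
  init : a 0 = a₀
  zero_mode : ∀ t, |t| ≤ T → ∀ n : ℤ × ℤ, n.1 = 0 → a t n = 0
  eq : ∀ t, |t| ≤ T → antideriv s (a t) = antideriv s a₀
    + ∫ τ in (0 : ℝ)..t, (-(Complex.I * (ε / 2))) • quad s τ (a τ)

variable (s) in
/-- The right hand side of the integrated normal form equation. -/
def normalForm (ε : ℝ) (a₀ : Seq) (a : ℝ → Seq) (t : ℝ) : Seq :=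
  a₀ + (ε / 2 : ℂ) • (normalQuad s 0 a₀ - normalQuad s t (a t))
    - (Complex.I * (ε ^ 2 / 2)) • ∫ τ in (0 : ℝ)..t, cubic s τ (a τ)

lemma mem_of_mem_uIoo {t τ T : ℝ} (ht : |t| ≤ T) (h : τ ∈ Set.Ioo (min 0 t) (max 0 t)) :
    |τ| < T := by
  obtain ⟨h1, h2⟩ := h
  rw [abs_lt]
  rw [abs_le] at ht
  rcases le_total 0 t with h0 | h0
  · rw [min_eq_left h0] at h1; rw [max_eq_right h0] at h2
    constructor <;> linarith
  · rw [min_eq_right h0] at h1; rw [max_eq_left h0] at h2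
    constructor <;> linarith

lemma abs_le_of_mem_uIoc {t τ T : ℝ} (ht : |t| ≤ T) (h : τ ∈ Set.uIoc 0 t) : |τ| ≤ T := by
  rw [Set.mem_uIoc] at h
  rw [abs_le] at ht ⊢
  rcases h with h | h <;> constructor <;> linarith [h.1, h.2]

lemma integral_seq_apply {f : ℝ → Seq} (hf : Continuous f) (t₀ t : ℝ) (n : ℤ × ℤ) :
    (∫ τ in t₀..t, f τ) n = ∫ τ in t₀..t, f τ n :=
  ((evalSeq n).intervalIntegral_comp_comm (hf.intervalIntegrable _ _)).symm

lemma eventually_abs_le {t T : ℝ} (ht : |t| < T) : ∀ᶠ τ in 𝓝 t, |τ| ≤ T := by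
  filter_upwards [continuous_abs.continuousAt.eventually_lt continuousAt_const ht] with τ h
  exact h.le

lemma IsMild.hasDerivAt {ε T : ℝ} {a₀ : Seq} {a : ℝ → Seq} (h : IsMild s ε T a₀ a) {t : ℝ}
    (ht : |t| < T) : HasDerivAt (fun τ => antideriv s (a τ))
      (-(Complex.I * (ε / 2)) • quad s t (a t)) t := by
  have hc : Continuous fun τ => (-(Complex.I * ((ε : ℂ) / 2))) • quad s τ (a τ) :=
    continuous_smul_quad h.cont _
  have h1 := (hc.integral_hasStrictDerivAt 0 t).hasDerivAt.const_add (antideriv s a₀)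
  refine h1.congr_of_eventuallyEq ?_
  filter_upwards [eventually_abs_le ht] with τ hτ
  exact h.eq τ hτ

lemma antideriv_normalQuad (t : ℝ) (a : Seq) :
    antideriv s (normalQuad s t a) = conv s (kerInv t) a a := antideriv_kerNF t a a

lemma antideriv_cubic (t : ℝ) (a : Seq) :
    antideriv s (cubic s t a) = conv s (kerHalf t) (quad s t a) a := antideriv_kerCub t _ a

lemma continuous_conv_kerInv {a : ℝ → Seq} (ha : Continuous a) :
    Continuous fun τ => conv s (kerInv τ) (a τ) (a τ) :=
  continuous_conv (fun k l => continuous_symb (fun k l => 1 / res k l) k l) ha ha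

lemma continuous_conv_kerHalf {a : ℝ → Seq} (ha : Continuous a) :
    Continuous fun τ => conv s (kerHalf τ) (quad s τ (a τ)) (a τ) :=
  continuous_conv (fun k l => continuous_symb (fun k l => (k.1 : ℝ) / res k l) k l)
    (continuous_quad continuous_id ha) ha

lemma normalForm_zero_mode {ε : ℝ} {a₀ : Seq} {a : ℝ → Seq} (ha : Continuous a)
    (h0 : ∀ n : ℤ × ℤ, n.1 = 0 → a₀ n = 0) (t : ℝ) {n : ℤ × ℤ} (hn : n.1 = 0) :
    normalForm s ε a₀ a t n = 0 := by
  have h1 : ∀ t a, normalQuad s t a n = 0 := fun t a => conv_eq_zero (t := t) rfl a a hn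
  have h2 : ∀ t a, cubic s t a n = 0 := fun t a => conv_eq_zero (t := t) rfl _ a hn
  simp only [normalForm, lp.coeFn_sub, lp.coeFn_add, lp.coeFn_smul, Pi.sub_apply, Pi.add_apply,
    Pi.smul_apply, smul_eq_mul]
  rw [integral_seq_apply (continuous_cubic_curve ha), h0 n hn, h1, h1]
  simp [h2]

lemma antideriv_normalForm (ε : ℝ) (a₀ : Seq) {a : ℝ → Seq} (ha : Continuous a) (t : ℝ) :
    antideriv s (normalForm s ε a₀ a t) = antideriv s a₀
      + (ε / 2 : ℂ) • (conv s (kerInv 0) a₀ a₀ - conv s (kerInv t) (a t) (a t))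
      - (Complex.I * (ε ^ 2 / 2)) • ∫ τ in (0 : ℝ)..t, conv s (kerHalf τ) (quad s τ (a τ)) (a τ) := by
  have := (antideriv s).intervalIntegral_comp_comm
    ((continuous_cubic_curve (s := s) ha).intervalIntegrable 0 t (μ := volume))
  simp only [antideriv_cubic] at this
  simp only [normalForm, map_sub, map_add, map_smul, antideriv_normalQuad]
  rw [this]

/-- Solutions of the equation satisfy the normal form equation. -/
lemma IsMild.normalForm {ε T : ℝ} {a₀ : Seq} {a : ℝ → Seq} (h : IsMild s ε T a₀ a) {t : ℝ}
    (ht : |t| ≤ T) : a t = normalForm s ε a₀ a t := by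
  have h0 : |(0 : ℝ)| ≤ T := by rw [abs_zero]; exact (abs_nonneg _).trans ht
  have hz : ∀ n : ℤ × ℤ, n.1 = 0 → a₀ n = 0 := fun n hn => h.init ▸ h.zero_mode 0 h0 n hn
  refine antideriv_injective (s := s) ?_ fun n hn => by
    rw [h.zero_mode t ht n hn, normalForm_zero_mode h.cont hz t hn]
  rw [antideriv_normalForm _ _ h.cont]
  have hG : Continuous fun τ => antideriv s (a τ)
      + (ε / 2 : ℂ) • conv s (kerInv τ) (a τ) (a τ) :=
    ((antideriv s).continuous.comp h.cont).add
      ((continuous_conv_kerInv h.cont).fun_const_smul _)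
  have hG' : Continuous fun τ => -(Complex.I * ((ε : ℂ) ^ 2 / 2)) •
      conv s (kerHalf τ) (quad s τ (a τ)) (a τ) :=
    (continuous_conv_kerHalf h.cont).fun_const_smul _
  -- The kernel derivative of the correction cancels the quadratic nonlinearity, leaving only the
  -- cubic term. The equation is differentiated at interior times only, since nothing is assumed
  -- beyond time T.
  have hd : ∀ τ ∈ Set.Ioo (min 0 t) (max 0 t), HasDerivWithinAt (fun τ => antideriv s (a τ)
      + (ε / 2 : ℂ) • conv s (kerInv τ) (a τ) (a τ))
      (-(Complex.I * ((ε : ℂ) ^ 2 / 2)) • conv s (kerHalf τ) (quad s τ (a τ)) (a τ))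
      (Set.Ioi τ) τ := fun τ hτ => by
    have hd := h.hasDerivAt (mem_of_mem_uIoo ht hτ)
    have h2 := hd.add ((hasDerivAt_conv_kerInv h.cont.continuousAt hd).const_smul (ε / 2 : ℂ))
    refine HasDerivAt.hasDerivWithinAt (h2.congr_deriv ?_)
    simp only [real_smul_seq, quad, map_smul, smul_apply]
    push_cast
    module
  have hI := intervalIntegral.integral_eq_sub_of_hasDeriv_right hG.continuousOn hd
    (hG'.intervalIntegrable _ _)
  rw [intervalIntegral.integral_smul, h.init] at hI
  rw [sub_eq_add_neg, ← neg_smul, hI]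
  module

/-- Bounded solutions of the normal form equation satisfy the original equation. -/
lemma isMild_of_normalForm {ε T : ℝ} (hε : 0 ≤ ε) (hsmall : ε * convConst s * 4 < 1)
    {a₀ : Seq}
    {a : ℝ → Seq} (ha : Continuous a) (h0 : ∀ n : ℤ × ℤ, n.1 = 0 → a₀ n = 0) (hinit : a 0 = a₀)
    (hb : ∀ t, |t| ≤ T → ‖a t‖ ≤ 2)
    (h : ∀ t, |t| ≤ T → a t = normalForm s ε a₀ a t) : IsMild s ε T a₀ a := by
  have hK := one_le_convConst s
  refine ⟨ha, hinit, fun t ht n hn => by rw [h t ht, normalForm_zero_mode ha h0 t hn],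
    fun t ht => ?_⟩
  -- The normal form only says that the sum of the antiderivative and the correction is
  -- differentiable; smallness of ε and the bound on the curve separate the two.
  have hd : ∀ τ, |τ| < T → HasDerivAt (fun τ => antideriv s (a τ))
      (-(Complex.I * (ε / 2)) • quad s τ (a τ)) τ := fun τ hτ => by
    refine hasDerivAt_antideriv_of_normalForm hε ha.continuousAt ?_ ?_
    · have := hb τ hτ.le
      calc ε * (convConst s * (2 * ‖a τ‖)) ≤ ε * (convConst s * (2 * 2)) := by gcongr
        _ < 1 := by linarith
    · have hc := continuous_conv_kerHalf (s := s) ha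
      have h1 := ((hc.integral_hasStrictDerivAt 0 τ).hasDerivAt.const_smul
        (-(Complex.I * ((ε : ℂ) ^ 2 / 2)))).const_add
          (antideriv s a₀ + (ε / 2 : ℂ) • conv s (kerInv 0) a₀ a₀)
      refine h1.congr_of_eventuallyEq ?_
      filter_upwards [eventually_abs_le hτ] with x hx
      have h2 := congrArg (antideriv s) (h x hx)
      rw [antideriv_normalForm _ _ ha] at h2
      rw [h2]
      simp only [real_smul_seq, Pi.smul_apply]
      push_cast
      module
  have hI := intervalIntegral.integral_eq_sub_of_hasDeriv_right
    (f := fun τ => antideriv s (a τ)) (a := 0) (b := t)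
    ((antideriv s).continuous.comp ha).continuousOn
    (fun τ hτ => (hd τ (mem_of_mem_uIoo ht hτ)).hasDerivWithinAt)
    ((continuous_smul_quad ha _).intervalIntegrable _ _)
  rw [hI, hinit]
  abel

variable (s) in
/-- The smallness conditions on `ε` and on the length of the time interval. -/
structure Small (ε T : ℝ) : Prop where
  eps_nonneg : 0 ≤ ε
  time_nonneg : 0 ≤ T
  eps_le : 100 * convConst s * ε ≤ 1
  time_le : 1000 * convConst s ^ 2 * (ε ^ 2 * T) ≤ 1

/-- The gap between the assumed radius 3 and the obtained radius 2 is what makes the continuity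
argument close. The cubic integral comes with ε², so only ε²T has to be small. -/
lemma norm_normalForm_le {ε T : ℝ} (hS : Small s ε T) {a₀ : Seq} (h₀ : ‖a₀‖ ≤ 1) {a : ℝ → Seq}
    {t : ℝ} (ht : |t| ≤ T) (hb : ∀ τ ∈ Set.uIcc 0 t, ‖a τ‖ ≤ 3) :
    ‖normalForm s ε a₀ a t‖ ≤ 2 := by
  have hK := one_le_convConst s
  have hε := hS.eps_nonneg
  have h1 : ‖normalQuad s 0 a₀‖ ≤ convConst s :=
    (norm_conv_le _ _ _).trans (by
      calc convConst s * ‖a₀‖ * ‖a₀‖ ≤ convConst s * 1 * 1 := by gcongr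
        _ = _ := by ring)
  have h2 : ‖normalQuad s t (a t)‖ ≤ 9 * convConst s :=
    (norm_conv_le _ _ _).trans (by
      have := hb t Set.right_mem_uIcc
      calc convConst s * ‖a t‖ * ‖a t‖ ≤ convConst s * 3 * 3 := by gcongr
        _ = _ := by ring)
  have h3 : ‖∫ τ in (0 : ℝ)..t, cubic s τ (a τ)‖ ≤ convConst s ^ 2 * 3 ^ 3 * |t - 0| :=
    intervalIntegral.norm_integral_le_of_norm_le_const fun τ hτ =>
      norm_cubic_le τ (hb τ (Set.uIoc_subset_uIcc hτ))
  rw [sub_zero] at h3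
  have hn1 : ‖(ε / 2 : ℂ)‖ = ε / 2 := by
    rw [show (ε / 2 : ℂ) = ((ε / 2 : ℝ) : ℂ) by push_cast; ring, Complex.norm_real,
      Real.norm_of_nonneg (by positivity)]
  have hn2 : ‖Complex.I * ((ε : ℂ) ^ 2 / 2)‖ = ε ^ 2 / 2 := by
    rw [show ((ε : ℂ) ^ 2 / 2) = ((ε ^ 2 / 2 : ℝ) : ℂ) by push_cast; ring, norm_mul, Complex.norm_I,
      one_mul, Complex.norm_real, Real.norm_of_nonneg (by positivity)]
  calc ‖normalForm s ε a₀ a t‖ ≤ ‖a₀‖ + (ε / 2) * (‖normalQuad s 0 a₀‖ + ‖normalQuad s t (a t)‖)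
        + (ε ^ 2 / 2) * ‖∫ τ in (0 : ℝ)..t, cubic s τ (a τ)‖ := by
        unfold normalForm
        refine (norm_sub_le _ _).trans ?_
        rw [norm_smul, hn2]
        gcongr
        refine (norm_add_le _ _).trans ?_
        rw [norm_smul, hn1]
        gcongr
        exact norm_sub_le _ _
    _ ≤ 1 + (ε / 2) * (convConst s + 9 * convConst s)
        + (ε ^ 2 / 2) * (convConst s ^ 2 * 3 ^ 3 * T) := by
        gcongr
        exact h3.trans (by gcongr)
    _ ≤ 2 := by linarith [hS.eps_le, hS.time_le]

/-- The factor 1/2 in front of M gives the contraction of the Picard map, and, with M the maximum of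
the difference of two solutions, the Lipschitz estimate. -/
lemma norm_normalForm_sub_le {ε T : ℝ} (hS : Small s ε T) {a₀ b₀ : Seq} (h₀ : ‖a₀‖ ≤ 1)
    (h₀' : ‖b₀‖ ≤ 1) {a b : ℝ → Seq} (hac : Continuous a) (hbc : Continuous b)
    {t : ℝ} (ht : |t| ≤ T) (ha : ∀ τ, |τ| ≤ T → ‖a τ‖ ≤ 3) (hb : ∀ τ, |τ| ≤ T → ‖b τ‖ ≤ 3) {M : ℝ}
    (hM : ∀ τ, |τ| ≤ T → ‖a τ - b τ‖ ≤ M) :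
    ‖normalForm s ε a₀ a t - normalForm s ε b₀ b t‖ ≤ 2 * ‖a₀ - b₀‖ + M / 2 := by
  have hK := one_le_convConst s
  have hε := hS.eps_nonneg
  have hM0 : 0 ≤ M := (norm_nonneg _).trans (hM t ht)
  have h1 : ‖normalQuad s 0 a₀ - normalQuad s 0 b₀‖ ≤ convConst s * (1 + 1) * ‖a₀ - b₀‖ :=
    (norm_conv_self_sub_le _ _ _).trans (by gcongr)
  have h2 : ‖normalQuad s t (a t) - normalQuad s t (b t)‖ ≤ convConst s * (3 + 3) * M :=
    (norm_conv_self_sub_le _ _ _).trans (by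
      have := ha t ht
      have := hb t ht
      have := hM t ht
      gcongr)
  have h3 : ‖(∫ τ in (0 : ℝ)..t, cubic s τ (a τ)) - ∫ τ in (0 : ℝ)..t, cubic s τ (b τ)‖
      ≤ 3 * convConst s ^ 2 * 3 ^ 2 * M * |t - 0| := by
    rw [← intervalIntegral.integral_sub
      ((continuous_cubic_curve hac).intervalIntegrable _ _)
      ((continuous_cubic_curve hbc).intervalIntegrable _ _)]
    refine intervalIntegral.norm_integral_le_of_norm_le_const fun τ hτ => ?_
    have hτ' := abs_le_of_mem_uIoc ht hτ
    refine (norm_cubic_sub_le _ (ha τ hτ') (hb τ hτ')).trans ?_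
    gcongr
    exact hM τ hτ'
  rw [sub_zero] at h3
  have hn1 : ‖(ε / 2 : ℂ)‖ = ε / 2 := by
    rw [show (ε / 2 : ℂ) = ((ε / 2 : ℝ) : ℂ) by push_cast; ring, Complex.norm_real,
      Real.norm_of_nonneg (by positivity)]
  have hn2 : ‖Complex.I * ((ε : ℂ) ^ 2 / 2)‖ = ε ^ 2 / 2 := by
    rw [show ((ε : ℂ) ^ 2 / 2) = ((ε ^ 2 / 2 : ℝ) : ℂ) by push_cast; ring, norm_mul, Complex.norm_I,
      one_mul, Complex.norm_real, Real.norm_of_nonneg (by positivity)]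
  have e : normalForm s ε a₀ a t - normalForm s ε b₀ b t = (a₀ - b₀)
      + (ε / 2 : ℂ) • ((normalQuad s 0 a₀ - normalQuad s 0 b₀)
        - (normalQuad s t (a t) - normalQuad s t (b t)))
      - (Complex.I * (ε ^ 2 / 2)) • ((∫ τ in (0 : ℝ)..t, cubic s τ (a τ))
        - ∫ τ in (0 : ℝ)..t, cubic s τ (b τ)) := by
    unfold normalForm; module
  have hε1 := hS.eps_le
  have hT1 := hS.time_le
  calc ‖normalForm s ε a₀ a t - normalForm s ε b₀ b t‖
      ≤ ‖a₀ - b₀‖ + (ε / 2) * (convConst s * (1 + 1) * ‖a₀ - b₀‖ + convConst s * (3 + 3) * M)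
        + (ε ^ 2 / 2) * (3 * convConst s ^ 2 * 3 ^ 2 * M * T) := by
        rw [e]
        refine (norm_sub_le _ _).trans ?_
        rw [norm_smul, hn2]
        refine add_le_add ((norm_add_le _ _).trans ?_) ?_
        · rw [norm_smul, hn1]
          gcongr
          exact (norm_sub_le _ _).trans (add_le_add h1 h2)
        · gcongr
          exact h3.trans (by gcongr)
    _ = ‖a₀ - b₀‖ * (1 + convConst s * ε)
        + M * (3 * (convConst s * ε) + 27 / 2 * (convConst s ^ 2 * (ε ^ 2 * T))) := by ring
    _ ≤ ‖a₀ - b₀‖ * 2 + M * (1 / 2) := by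
        gcongr
        · linarith
        · linarith
    _ = _ := by ring

/-- The a priori bound. -/
lemma IsMild.norm_le {ε T : ℝ} (hS : Small s ε T) {a₀ : Seq} (h₀ : ‖a₀‖ ≤ 1) {a : ℝ → Seq}
    (h : IsMild s ε T a₀ a) {t : ℝ} (ht : |t| ≤ T) : ‖a t‖ ≤ 2 := by
  -- Positive and negative times are treated together by moving along the segment from 0 to t.
  have key : ∀ r ∈ Set.Icc (0 : ℝ) 1, (∀ r' ∈ Set.Icc 0 r, ‖a (r' * t)‖ ≤ 3) → ‖a (r * t)‖ ≤ 2 := by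
    intro r hr hb
    have hrt : |r * t| ≤ T := by
      rw [abs_mul, abs_of_nonneg hr.1]
      exact (mul_le_of_le_one_left (abs_nonneg _) hr.2).trans ht
    rw [h.normalForm hrt]
    refine norm_normalForm_le hS h₀ hrt fun τ hτ => ?_
    rcases eq_or_ne t 0 with rfl | ht0
    · have := hb 0 ⟨le_rfl, hr.1⟩
      rw [mul_zero, Set.uIcc_self, Set.mem_singleton_iff] at hτ
      simpa [hτ] using this
    · have := hb (τ / t) (by
        rw [Set.mem_uIcc] at hτ
        rcases lt_or_gt_of_ne ht0 with h0 | h0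
        · rw [Set.mem_Icc, le_div_iff_of_neg h0, div_le_iff_of_neg h0]
          rcases hτ with hτ | hτ <;> constructor <;> nlinarith [hτ.1, hτ.2, hr.1, hr.2]
        · rw [Set.mem_Icc, le_div_iff₀ h0, div_le_iff₀ h0]
          rcases hτ with hτ | hτ <;> constructor <;> nlinarith [hτ.1, hτ.2, hr.1, hr.2])
      rwa [div_mul_cancel₀ _ ht0] at this
  have hφ : Continuous fun r : ℝ => ‖a (r * t)‖ := (h.cont.comp (by fun_prop)).norm
  -- Otherwise there is a first r at which the norm reaches 5/2. Up to it the norm is at most 3, so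
  -- the improved bound 2 holds there, a contradiction; any level strictly between 2 and 3 would
  -- serve.
  have hempty : ∀ r ∈ Set.Icc (0 : ℝ) 1, ‖a (r * t)‖ < 5 / 2 := by
    by_contra! hne
    obtain ⟨r₁, hr₁, hr₁'⟩ := hne
    obtain ⟨r, ⟨hr, hr'⟩, hmin⟩ := (isCompact_Icc.inter_right
      (isClosed_Ici.preimage hφ : IsClosed ((fun r : ℝ => ‖a (r * t)‖) ⁻¹' Set.Ici (5 / 2)))
        ).exists_isMinOn ⟨r₁, hr₁, hr₁'⟩ continuousOn_id
    have h00 : ‖a (0 * t)‖ ≤ 1 := by rw [zero_mul, h.init]; exact h₀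
    obtain ⟨r₂, hr₂, hr₂'⟩ := intermediate_value_Icc hr.1 hφ.continuousOn
      (⟨h00.trans (by norm_num), hr'⟩ : (5 / 2 : ℝ) ∈ Set.Icc _ _)
    have hr₂'' : ‖a (r₂ * t)‖ = 5 / 2 := hr₂'
    have heq : r = r₂ := le_antisymm
      (hmin ⟨⟨hr₂.1, hr₂.2.trans hr.2⟩, hr₂''.ge⟩) hr₂.2
    have := key r hr fun r' hr'' => by
      by_contra! hlt
      have hm : r ≤ r' := hmin ⟨⟨hr''.1, hr''.2.trans hr.2⟩, by
        change 5 / 2 ≤ ‖a (r' * t)‖; linarith⟩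
      have : r' = r := le_antisymm hr''.2 hm
      rw [this, heq, hr₂''] at hlt
      norm_num at hlt
    rw [heq, hr₂''] at this
    norm_num at this
  have := key 1 ⟨zero_le_one, le_rfl⟩ fun r' hr' => (hempty r' hr').le.trans (by norm_num)
  rwa [one_mul] at this

/-- Lipschitz dependence of the solutions on the initial data. -/
lemma IsMild.dist_le {ε T : ℝ} (hS : Small s ε T) {a₀ b₀ : Seq} (h₀ : ‖a₀‖ ≤ 1)
    (h₀' : ‖b₀‖ ≤ 1) {a b : ℝ → Seq} (ha : IsMild s ε T a₀ a) (hb : IsMild s ε T b₀ b) {t : ℝ}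
    (ht : |t| ≤ T) : ‖a t - b t‖ ≤ 4 * ‖a₀ - b₀‖ := by
  -- At the time of maximal distance M the estimate reads M ≤ 2‖a₀ - b₀‖ + M/2.
  obtain ⟨t₁, ht₁, hmax⟩ := (isCompact_Icc (a := -T) (b := T)).exists_isMaxOn
    ⟨t, abs_le.1 ht⟩ (ha.cont.sub hb.cont).norm.continuousOn
  have ht₁' : |t₁| ≤ T := abs_le.2 ht₁
  have h1 := norm_normalForm_sub_le hS h₀ h₀' ha.cont hb.cont ht₁'
    (fun τ hτ => (ha.norm_le hS h₀ hτ).trans (by norm_num))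
    (fun τ hτ => (hb.norm_le hS h₀' hτ).trans (by norm_num))
    (M := ‖a t₁ - b t₁‖) (fun τ hτ => hmax (abs_le.1 hτ))
  rw [← ha.normalForm ht₁', ← hb.normalForm ht₁'] at h1
  have h2 : ‖a t - b t‖ ≤ ‖a t₁ - b t₁‖ := hmax (abs_le.1 ht)
  linarith

end Dynamics

/-! ### Construction of solutions by the contraction principle for the normal form. -/

section Existence

variable {s : ℝ} [hs : Fact (1 < s)]

open BoundedContinuousFunction

lemma continuous_normalForm (ε : ℝ) (a₀ : Seq) {a : ℝ → Seq} (ha : Continuous a) :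
    Continuous (normalForm s ε a₀ a) := by
  have h1 : Continuous fun t => normalQuad s t (a t) := continuous_normalQuad continuous_id ha
  have h2 : Continuous fun t => ∫ τ in (0 : ℝ)..t, cubic s τ (a τ) :=
    intervalIntegral.continuous_primitive
      (fun _ _ => (continuous_cubic_curve ha).intervalIntegrable _ _) 0
  exact (continuous_const.add ((continuous_const.sub h1).fun_const_smul _)).sub
    (h2.fun_const_smul _)

/-- The projection of time to `[-T, T]`. -/
def clampTime (T t : ℝ) : ℝ := max (-T) (min t T)

lemma continuous_clampTime (T : ℝ) : Continuous (clampTime T) := by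
  unfold clampTime; fun_prop

lemma abs_clampTime_le {T : ℝ} (hT : 0 ≤ T) (t : ℝ) : |clampTime T t| ≤ T :=
  abs_le.2 ⟨le_max_left _ _, max_le (by linarith) (min_le_right _ _)⟩

lemma clampTime_of_abs_le {T t : ℝ} (h : |t| ≤ T) : clampTime T t = t := by
  rw [abs_le] at h
  rw [clampTime, min_eq_left h.2, max_eq_right h.1]

lemma exists_bound_comp_clampTime {f : ℝ → Seq} (hf : Continuous f) (T : ℝ) (hT : 0 ≤ T) :
    ∃ C, ∀ t, ‖f (clampTime T t)‖ ≤ C := by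
  obtain ⟨C, hC⟩ := (isCompact_Icc (a := -T) (b := T)).exists_bound_of_continuousOn hf.continuousOn
  exact ⟨C, fun t => hC _ (abs_le.1 (abs_clampTime_le hT t))⟩

variable (s) in
/-- The Picard map of the normal form equation. -/
def picard (ε : ℝ) {T : ℝ} (hT : 0 ≤ T) (a₀ : Seq) (v : ℝ →ᵇ Seq) : ℝ →ᵇ Seq :=
  ofNormedAddCommGroup (fun t => normalForm s ε a₀ v (clampTime T t))
    ((continuous_normalForm ε a₀ v.continuous).comp (continuous_clampTime T))
    (exists_bound_comp_clampTime (continuous_normalForm ε a₀ v.continuous) T hT).choose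
    (exists_bound_comp_clampTime (continuous_normalForm ε a₀ v.continuous) T hT).choose_spec

/-- Clamping the time to [-T, T] lets the fixed point live in the bounded continuous functions on
the whole line. The fixed point solves the normal form, which at time zero still contains the
unknown value v(0); that it equals the datum has to be derived before returning to the equation. -/
lemma exists_isMild {ε T : ℝ} (hS : Small s ε T) {a₀ : Seq} (h₀ : ‖a₀‖ ≤ 1)
    (hz : ∀ n : ℤ × ℤ, n.1 = 0 → a₀ n = 0) : ∃ a, IsMild s ε T a₀ a := by
  have hT := hS.time_nonneg
  have hball : ∀ v ∈ Metric.closedBall (0 : ℝ →ᵇ Seq) 2, ∀ t, ‖v t‖ ≤ 3 := fun v hv t =>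
    (v.norm_coe_le_norm t).trans ((mem_closedBall_zero_iff.1 hv).trans (by norm_num))
  have hmaps : Set.MapsTo (picard s ε hT a₀) (Metric.closedBall 0 2) (Metric.closedBall 0 2) := by
    intro v hv
    rw [mem_closedBall_zero_iff, BoundedContinuousFunction.norm_le (by norm_num)]
    intro t
    exact norm_normalForm_le hS h₀ (abs_clampTime_le hT t) fun τ _ => hball v hv τ
  have hcontr : ContractingWith (1 / 2)
      (hmaps.restrict (picard s ε hT a₀) (Metric.closedBall 0 2) (Metric.closedBall 0 2)) := by
    refine ⟨by rw [← NNReal.coe_lt_coe]; norm_num, LipschitzWith.of_dist_le_mul fun v w => ?_⟩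
    rw [Subtype.dist_eq, Subtype.dist_eq, dist_eq_norm, dist_eq_norm,
      BoundedContinuousFunction.norm_le (by positivity)]
    intro t
    have := norm_normalForm_sub_le hS h₀ h₀ v.1.continuous w.1.continuous (abs_clampTime_le hT t)
      (fun τ _ => hball v v.2 τ) (fun τ _ => hball w w.2 τ)
      (M := ‖(v : ℝ →ᵇ Seq) - w‖) (fun τ _ => ((v : ℝ →ᵇ Seq) - w).norm_coe_le_norm τ)
    rw [sub_self, norm_zero, mul_zero, zero_add] at this
    refine this.trans (le_of_eq ?_)
    simp only [NNReal.coe_div, NNReal.coe_one, NNReal.coe_ofNat]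
    ring
  obtain ⟨v, hv, hfix, -⟩ := hcontr.exists_fixedPoint' Metric.isClosed_closedBall.isComplete hmaps
    (x := 0) (by simp) (edist_ne_top _ _)
  have hv' : ∀ t, |t| ≤ T → v t = normalForm s ε a₀ v t := fun t ht => by
    have := congrArg (fun w : ℝ →ᵇ Seq => w t) hfix.eq
    conv_lhs => rw [← this]
    change normalForm s ε a₀ v (clampTime T t) = _
    rw [clampTime_of_abs_le ht]
  have hb2 : ∀ t, ‖v t‖ ≤ 2 := fun t => (v.norm_coe_le_norm t).trans (mem_closedBall_zero_iff.1 hv)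
  have h00 := hv' 0 (by rwa [abs_zero])
  have hinit : v 0 = a₀ := by
    -- the correction at time zero is a contraction
    have hK := one_le_convConst s
    have h1 : v 0 - a₀ = (ε / 2 : ℂ) • (normalQuad s 0 a₀ - normalQuad s 0 (v 0)) := by
      conv_lhs => rw [h00]
      simp [normalForm]
    have hn1 : ‖(ε / 2 : ℂ)‖ = ε / 2 := by
      rw [show (ε / 2 : ℂ) = ((ε / 2 : ℝ) : ℂ) by push_cast; ring, Complex.norm_real,
        Real.norm_of_nonneg (by linarith [hS.eps_nonneg])]
    have h2 : ‖v 0 - a₀‖ ≤ (ε / 2) * (convConst s * (1 + 2) * ‖v 0 - a₀‖) := by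
      have hε := hS.eps_nonneg
      conv_lhs => rw [h1]
      rw [norm_smul, hn1, norm_sub_rev (v 0)]
      gcongr
      refine (norm_conv_self_sub_le _ _ _).trans ?_
      have := hb2 0
      gcongr
    have h3 : ‖v 0 - a₀‖ ≤ (1 / 2) * ‖v 0 - a₀‖ := by
      refine h2.trans ?_
      have := hS.eps_le
      rw [show (ε / 2) * (convConst s * (1 + 2) * ‖v 0 - a₀‖)
        = (3 / 2 * (convConst s * ε)) * ‖v 0 - a₀‖ by ring]
      gcongr
      linarith
    have h4 : ‖v 0 - a₀‖ = 0 := le_antisymm (by linarith) (norm_nonneg _)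
    exact sub_eq_zero.1 (norm_eq_zero.1 h4)
  refine ⟨v, isMild_of_normalForm hS.eps_nonneg ?_ v.continuous hz hinit (fun t _ => hb2 t) hv'⟩
  have := hS.eps_le
  linarith

lemma IsMild.mono {ε T T' : ℝ} {a₀ : Seq} {a : ℝ → Seq} (h : IsMild s ε T a₀ a) (hT : T' ≤ T) :
    IsMild s ε T' a₀ a :=
  ⟨h.cont, h.init, fun t ht => h.zero_mode t (ht.trans hT), fun t ht => h.eq t (ht.trans hT)⟩

/-- One curve serves all admissible times, so that `flow` needs no time horizon. For ε > 0 it is the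
solution on the longest admissible interval; for ε = 0 there is no longest one, and the curve is
constant. -/
lemma exists_isMild_forall {ε : ℝ} (hε : 0 ≤ ε) (hε1 : 100 * convConst s * ε ≤ 1) {a₀ : Seq}
    (h₀ : ‖a₀‖ ≤ 1) (hz : ∀ n : ℤ × ℤ, n.1 = 0 → a₀ n = 0) :
    ∃ a, ∀ T, Small s ε T → IsMild s ε T a₀ a := by
  have hK := one_le_convConst s
  rcases hε.eq_or_lt with rfl | hpos
  · refine ⟨fun _ => a₀, fun T _ => ⟨continuous_const, rfl, fun _ _ n hn => hz n hn, fun t _ => ?_⟩⟩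
    simp
  · have hS : Small s ε (1 / (1000 * convConst s ^ 2 * ε ^ 2)) :=
      ⟨hε, by positivity, hε1, le_of_eq (by field_simp)⟩
    obtain ⟨a, ha⟩ := exists_isMild hS h₀ hz
    refine ⟨a, fun T hT => ha.mono ?_⟩
    rw [le_div_iff₀ (by positivity)]
    linarith [hT.time_le]

variable (s) in
/-- The solution with initial datum `a₀`. -/
def flow (ε : ℝ) (a₀ : Seq) : ℝ → Seq :=
  open scoped Classical in
  if h : ∃ a, ∀ T, Small s ε T → IsMild s ε T a₀ a then h.choose else 0

lemma isMild_flow {ε T : ℝ} (hS : Small s ε T) {a₀ : Seq}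
    (h₀ : ‖a₀‖ ≤ 1) (hz : ∀ n : ℤ × ℤ, n.1 = 0 → a₀ n = 0) :
    IsMild s ε T a₀ (flow s ε a₀) := by
  have h := exists_isMild_forall hS.eps_nonneg hS.eps_le h₀ hz
  rw [flow, dif_pos h]
  exact h.choose_spec T hS

end Existence

/-! ### Expansion of the solution and of quartic expressions in powers of ε. -/

section Expansion

variable {s : ℝ} [hs : Fact (1 < s)]

variable (s) in
/-- The first order term of the solution. -/
def firstOrder (t : ℝ) (a : Seq) : Seq :=
  (1 / 2 : ℂ) • (normalQuad s 0 a - normalQuad s t a)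

lemma norm_conv_self_le (κ : Kernel) {a : Seq} {M : ℝ} (h : ‖a‖ ≤ M) :
    ‖conv s κ a a‖ ≤ convConst s * M ^ 2 := by
  have hK := one_le_convConst s
  have hM : 0 ≤ M := (norm_nonneg _).trans h
  calc ‖conv s κ a a‖ ≤ convConst s * ‖a‖ * ‖a‖ := norm_conv_le _ _ _
    _ ≤ convConst s * M * M := by gcongr
    _ = _ := by ring

lemma norm_firstOrder_le (t : ℝ) {a : Seq} (h : ‖a‖ ≤ 1) : ‖firstOrder s t a‖ ≤ convConst s := by
  unfold firstOrder
  rw [norm_smul]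
  have h1 : ‖normalQuad s 0 a - normalQuad s t a‖ ≤ convConst s * 1 ^ 2 + convConst s * 1 ^ 2 :=
    (norm_sub_le _ _).trans (add_le_add (norm_conv_self_le _ h) (norm_conv_self_le _ h))
  calc ‖(1 / 2 : ℂ)‖ * ‖normalQuad s 0 a - normalQuad s t a‖
      ≤ (1 / 2) * (convConst s * 1 ^ 2 + convConst s * 1 ^ 2) := by
        gcongr
        norm_num
    _ = _ := by ring

lemma norm_eps_half {ε : ℝ} (hε : 0 ≤ ε) : ‖(ε / 2 : ℂ)‖ = ε / 2 := by
  rw [show (ε / 2 : ℂ) = ((ε / 2 : ℝ) : ℂ) by push_cast; ring, Complex.norm_real,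
    Real.norm_of_nonneg (by positivity)]

lemma norm_I_eps_sq_half (ε : ℝ) : ‖Complex.I * ((ε : ℂ) ^ 2 / 2)‖ = ε ^ 2 / 2 := by
  rw [show ((ε : ℂ) ^ 2 / 2) = ((ε ^ 2 / 2 : ℝ) : ℂ) by push_cast; ring, norm_mul, Complex.norm_I,
    one_mul, Complex.norm_real, Real.norm_of_nonneg (by positivity)]

lemma IsMild.norm_integral_cubic_le {ε T : ℝ} (hS : Small s ε T) {a₀ : Seq} (h₀ : ‖a₀‖ ≤ 1)
    {a : ℝ → Seq} (h : IsMild s ε T a₀ a) {t : ℝ} (ht : |t| ≤ T) :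
    ‖(Complex.I * ((ε : ℂ) ^ 2 / 2)) • ∫ τ in (0 : ℝ)..t, cubic s τ (a τ)‖
      ≤ 4 * convConst s ^ 2 * (ε ^ 2 * |t|) := by
  have h3 : ‖∫ τ in (0 : ℝ)..t, cubic s τ (a τ)‖ ≤ convConst s ^ 2 * 2 ^ 3 * |t - 0| :=
    intervalIntegral.norm_integral_le_of_norm_le_const fun τ hτ =>
      norm_cubic_le τ (h.norm_le hS h₀ (abs_le_of_mem_uIoc ht hτ))
  rw [sub_zero] at h3
  rw [norm_smul, norm_I_eps_sq_half]
  calc ε ^ 2 / 2 * _ ≤ ε ^ 2 / 2 * (convConst s ^ 2 * 2 ^ 3 * |t|) := by gcongr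
    _ = _ := by ring

lemma IsMild.norm_sub_init_le {ε T : ℝ} (hS : Small s ε T) {a₀ : Seq} (h₀ : ‖a₀‖ ≤ 1)
    {a : ℝ → Seq} (h : IsMild s ε T a₀ a) {t : ℝ} (ht : |t| ≤ T) :
    ‖a t - a₀‖ ≤ 4 * convConst s ^ 2 * (ε * (1 + ε * |t|)) := by
  have hK := one_le_convConst s
  have hε := hS.eps_nonneg
  have h1 : ‖normalQuad s 0 a₀ - normalQuad s t (a t)‖ ≤ convConst s * 1 ^ 2 + convConst s * 2 ^ 2 :=
    (norm_sub_le _ _).trans (add_le_add (norm_conv_self_le _ h₀)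
      (norm_conv_self_le _ (h.norm_le hS h₀ ht)))
  have h3 := h.norm_integral_cubic_le hS h₀ ht
  have e : a t - a₀ = (ε / 2 : ℂ) • (normalQuad s 0 a₀ - normalQuad s t (a t))
      - (Complex.I * (ε ^ 2 / 2)) • ∫ τ in (0 : ℝ)..t, cubic s τ (a τ) := by
    conv_lhs => rw [h.normalForm ht]
    unfold KPII.normalForm
    abel
  rw [e]
  calc _ ≤ (ε / 2) * (convConst s * 1 ^ 2 + convConst s * 2 ^ 2)
        + 4 * convConst s ^ 2 * (ε ^ 2 * |t|) := by
        refine (norm_sub_le _ _).trans (add_le_add ?_ h3)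
        rw [norm_smul, norm_eps_half hε]
        gcongr
    _ ≤ 4 * convConst s ^ 2 * ε + 4 * convConst s ^ 2 * (ε ^ 2 * |t|) := by
        refine add_le_add_left ?_ _
        nlinarith [mul_nonneg hε (by nlinarith : 0 ≤ convConst s * (convConst s - 1)), mul_nonneg hε (by linarith : 0 ≤ convConst s)]
    _ = _ := by ring

omit hs in
lemma Small.eps_le_one {ε T : ℝ} (hS : Small s ε T) : ε ≤ 1 := by
  have hK := one_le_convConst s
  have := hS.eps_le
  have := hS.eps_nonneg
  nlinarith

omit hs in
lemma Small.eps_sq_mul_le_one {ε T : ℝ} (hS : Small s ε T) {t : ℝ} (ht : |t| ≤ T) :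
    ε ^ 2 * |t| ≤ 1 := by
  have hK := one_le_convConst s
  have h1 : ε ^ 2 * |t| ≤ ε ^ 2 * T := by gcongr
  have h2 := hS.time_le
  have h3 : 0 ≤ ε ^ 2 * T := mul_nonneg (sq_nonneg _) hS.time_nonneg
  nlinarith [sq_nonneg (convConst s - 1)]

/-- Because ε²|t| ≤ 1, the square of ε|t| is at most |t|; this keeps the growth of second order
errors linear in |t|. -/
lemma IsMild.norm_sub_init_sq_le {ε T : ℝ} (hS : Small s ε T) {a₀ : Seq} (h₀ : ‖a₀‖ ≤ 1)
    {a : ℝ → Seq} (h : IsMild s ε T a₀ a) {t : ℝ} (ht : |t| ≤ T) :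
    ‖a t - a₀‖ ^ 2 ≤ 32 * convConst s ^ 4 * (ε ^ 2 * (1 + |t|)) := by
  have h1 := h.norm_sub_init_le hS h₀ ht
  have h2 := hS.eps_sq_mul_le_one ht
  have h3 : (1 + ε * |t|) ^ 2 ≤ 2 * (1 + |t|) := by
    nlinarith [sq_nonneg (1 - ε * |t|), abs_nonneg t, mul_le_mul_of_nonneg_right h2 (abs_nonneg t)]
  calc ‖a t - a₀‖ ^ 2 ≤ (4 * convConst s ^ 2 * (ε * (1 + ε * |t|))) ^ 2 := by gcongr
    _ = 16 * convConst s ^ 4 * ε ^ 2 * (1 + ε * |t|) ^ 2 := by ring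
    _ ≤ 16 * convConst s ^ 4 * ε ^ 2 * (2 * (1 + |t|)) := by gcongr
    _ = _ := by ring

/-- In the normal form the cubic integral already is O(ε²|t|), and replacing a(t) by the datum in
the quadratic correction costs ε times the distance of a(t) to the datum. -/
lemma IsMild.norm_sub_firstOrder_le {ε T : ℝ} (hS : Small s ε T) {a₀ : Seq} (h₀ : ‖a₀‖ ≤ 1)
    {a : ℝ → Seq} (h : IsMild s ε T a₀ a) {t : ℝ} (ht : |t| ≤ T) :
    ‖a t - a₀ - (ε : ℂ) • firstOrder s t a₀‖ ≤ 10 * convConst s ^ 3 * (ε ^ 2 * (1 + |t|)) := by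
  have hK := one_le_convConst s
  have hε := hS.eps_nonneg
  have hε1 := hS.eps_le_one
  have h1 := h.norm_sub_init_le hS h₀ ht
  have h2 := h.norm_le hS h₀ ht
  have h3 := h.norm_integral_cubic_le hS h₀ ht
  have e : a t - a₀ - (ε : ℂ) • firstOrder s t a₀
      = -((ε / 2 : ℂ) • (normalQuad s t (a t) - normalQuad s t a₀))
      - (Complex.I * (ε ^ 2 / 2)) • ∫ τ in (0 : ℝ)..t, cubic s τ (a τ) := by
    conv_lhs => rw [h.normalForm ht]
    unfold KPII.normalForm firstOrder
    module
  rw [e]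
  have h4 : ‖normalQuad s t (a t) - normalQuad s t a₀‖
      ≤ convConst s * (2 + 1) * (4 * convConst s ^ 2 * (ε * (1 + ε * |t|))) :=
    (norm_conv_self_sub_le _ _ _).trans (by gcongr)
  calc _ ≤ (ε / 2) * (convConst s * (2 + 1) * (4 * convConst s ^ 2 * (ε * (1 + ε * |t|))))
        + 4 * convConst s ^ 2 * (ε ^ 2 * |t|) := by
        refine (norm_sub_le _ _).trans (add_le_add ?_ h3)
        rw [norm_neg, norm_smul, norm_eps_half hε]
        gcongr
    _ = 6 * convConst s ^ 3 * (ε ^ 2 * (1 + ε * |t|)) + 4 * convConst s ^ 2 * (ε ^ 2 * |t|) := by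
        ring
    _ ≤ 6 * convConst s ^ 3 * (ε ^ 2 * (1 + 1 * |t|))
        + 4 * convConst s ^ 3 * (ε ^ 2 * (1 + |t|)) := by
        gcongr
        · norm_num
        · linarith
    _ = _ := by ring

variable (s) in
/-- The first order term of the quadratic nonlinearity. -/
def quadFirstOrder (t : ℝ) (a : Seq) : Seq :=
  conv s (kerNL t) (firstOrder s t a) a + conv s (kerNL t) a (firstOrder s t a)

lemma norm_quadFirstOrder_le (t : ℝ) {a : Seq} (h : ‖a‖ ≤ 1) :
    ‖quadFirstOrder s t a‖ ≤ 2 * convConst s ^ 2 := by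
  have hK := one_le_convConst s
  have h1 := norm_firstOrder_le (s := s) t h
  calc ‖quadFirstOrder s t a‖ ≤ convConst s * ‖firstOrder s t a‖ * ‖a‖
        + convConst s * ‖a‖ * ‖firstOrder s t a‖ :=
        (norm_add_le _ _).trans (add_le_add (norm_conv_le _ _ _) (norm_conv_le _ _ _))
    _ ≤ convConst s * convConst s * 1 + convConst s * 1 * convConst s := by gcongr
    _ = _ := by ring

/-- Expand the quadratic form around the datum: the terms left over are the form at the increment δ,
and the form linearised at the datum applied to the second order remainder r. -/
lemma IsMild.norm_quad_sub_le {ε T : ℝ} (hS : Small s ε T) {a₀ : Seq} (h₀ : ‖a₀‖ ≤ 1)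
    {a : ℝ → Seq} (h : IsMild s ε T a₀ a) {t : ℝ} (ht : |t| ≤ T) :
    ‖quad s t (a t) - quad s t a₀ - (ε : ℂ) • quadFirstOrder s t a₀‖
      ≤ 52 * convConst s ^ 5 * (ε ^ 2 * (1 + |t|)) := by
  have hK := one_le_convConst s
  have h1 := h.norm_sub_init_sq_le hS h₀ ht
  have h2 := h.norm_sub_firstOrder_le hS h₀ ht
  set δ := a t - a₀ with hδ
  set r := a t - a₀ - (ε : ℂ) • firstOrder s t a₀ with hr
  have e : quad s t (a t) - quad s t a₀ - (ε : ℂ) • quadFirstOrder s t a₀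
      = conv s (kerNL t) δ δ + (conv s (kerNL t) r a₀ + conv s (kerNL t) a₀ r) := by
    simp only [hr, hδ, quad, quadFirstOrder, map_sub, map_smul, sub_apply, smul_apply]
    module
  rw [e]
  have h3 : ‖conv s (kerNL t) δ δ‖ ≤ convConst s * ‖δ‖ ^ 2 := norm_conv_self_le _ le_rfl
  calc _ ≤ convConst s * ‖δ‖ ^ 2 + (convConst s * ‖r‖ * ‖a₀‖ + convConst s * ‖a₀‖ * ‖r‖) :=
        (norm_add_le _ _).trans (add_le_add h3 ((norm_add_le _ _).trans
          (add_le_add (norm_conv_le _ _ _) (norm_conv_le _ _ _))))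
    _ ≤ convConst s * (32 * convConst s ^ 4 * (ε ^ 2 * (1 + |t|)))
        + (convConst s * (10 * convConst s ^ 3 * (ε ^ 2 * (1 + |t|))) * 1
          + convConst s * 1 * (10 * convConst s ^ 3 * (ε ^ 2 * (1 + |t|)))) := by gcongr
    _ = (32 * convConst s ^ 5 + 20 * convConst s ^ 4) * (ε ^ 2 * (1 + |t|)) := by ring
    _ ≤ (32 * convConst s ^ 5 + 20 * convConst s ^ 5) * (ε ^ 2 * (1 + |t|)) := by
        have : convConst s ^ 4 ≤ convConst s ^ 5 := pow_le_pow_right₀ hK (by norm_num)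
        gcongr
    _ = _ := by ring

/-- A Taylor expansion of a product of three factors. Here η plays the role of ε²(1+|t|): increments
are of order √η, so only products of two increments and second order remainders remain. The crude
bound on d - d₀ serves for the product of all three increments. -/
lemma norm_mul_mul_sub_le {x c d x₀ c₀ d₀ x₁ c₁ d₁ e : ℂ} {B η : ℝ} (hB : 1 ≤ B) (hη : 0 ≤ η)
    (hx₀ : ‖x₀‖ ≤ B) (hc₀ : ‖c₀‖ ≤ B) (hd₀ : ‖d₀‖ ≤ B) (hdB : ‖d - d₀‖ ≤ 2 * B)
    (hx : ‖x - x₀‖ ^ 2 ≤ B * η) (hc : ‖c - c₀‖ ^ 2 ≤ B * η) (hd : ‖d - d₀‖ ^ 2 ≤ B * η)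
    (hx' : ‖x - x₀ - e * x₁‖ ≤ B * η) (hc' : ‖c - c₀ - e * c₁‖ ≤ B * η)
    (hd' : ‖d - d₀ - e * d₁‖ ≤ B * η) :
    ‖x * c * d - (x₀ * c₀ * d₀ + e * (x₁ * c₀ * d₀ + x₀ * c₁ * d₀ + x₀ * c₀ * d₁))‖
      ≤ 8 * B ^ 3 * η := by
  have key : ∀ u v : ℂ, ‖u‖ ^ 2 ≤ B * η → ‖v‖ ^ 2 ≤ B * η → ‖u * v‖ ≤ B * η := fun u v hu hv => by
    rw [norm_mul]
    nlinarith [sq_nonneg (‖u‖ - ‖v‖)]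
  have hBη : 0 ≤ B * η := by positivity
  have e' : x * c * d - (x₀ * c₀ * d₀ + e * (x₁ * c₀ * d₀ + x₀ * c₁ * d₀ + x₀ * c₀ * d₁))
      = (x - x₀ - e * x₁) * (c₀ * d₀) + (c - c₀ - e * c₁) * (x₀ * d₀)
        + (d - d₀ - e * d₁) * (x₀ * c₀) + ((x - x₀) * (c - c₀)) * d₀
        + ((x - x₀) * (d - d₀)) * c₀ + ((c - c₀) * (d - d₀)) * x₀
        + ((x - x₀) * (c - c₀)) * (d - d₀) := by ring
  rw [e']
  have b1 : ‖(x - x₀ - e * x₁) * (c₀ * d₀)‖ ≤ (B * η) * (B * B) := by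
    rw [norm_mul, norm_mul]; gcongr
  have b2 : ‖(c - c₀ - e * c₁) * (x₀ * d₀)‖ ≤ (B * η) * (B * B) := by
    rw [norm_mul, norm_mul]; gcongr
  have b3 : ‖(d - d₀ - e * d₁) * (x₀ * c₀)‖ ≤ (B * η) * (B * B) := by
    rw [norm_mul, norm_mul]; gcongr
  have b4 : ‖((x - x₀) * (c - c₀)) * d₀‖ ≤ (B * η) * B := by
    rw [norm_mul]; gcongr; exact key _ _ hx hc
  have b5 : ‖((x - x₀) * (d - d₀)) * c₀‖ ≤ (B * η) * B := by
    rw [norm_mul]; gcongr; exact key _ _ hx hd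
  have b6 : ‖((c - c₀) * (d - d₀)) * x₀‖ ≤ (B * η) * B := by
    rw [norm_mul]; gcongr; exact key _ _ hc hd
  have b7 : ‖((x - x₀) * (c - c₀)) * (d - d₀)‖ ≤ (B * η) * (2 * B) := by
    rw [norm_mul]; gcongr; exact key _ _ hx hc
  -- Three remainders, three products of two increments and the triple product give 3B³ + 3B² + 2B²,
  -- at most 8B³ since B ≥ 1.
  have htot : (B * η) * (B * B) * 3 + (B * η) * B * 3 + (B * η) * (2 * B) ≤ 8 * B ^ 3 * η := by
    have h2 : 0 ≤ B ^ 2 * η * (B - 1) := by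
      have : 0 ≤ B - 1 := by linarith
      positivity
    nlinarith
  refine (norm_add_le _ _).trans ?_
  refine (add_le_add ((norm_add_le _ _).trans (add_le_add ((norm_add_le _ _).trans
    (add_le_add ((norm_add_le _ _).trans (add_le_add ((norm_add_le _ _).trans
    (add_le_add ((norm_add_le _ _).trans (add_le_add b1 b2)) b3)) b4)) b5)) b6)) b7).trans ?_
  linarith

variable (s) in
/-- The quartic form in the time derivative of the third moments. -/
def quartic (n m p : ℤ × ℤ) (t : ℝ) (a : Seq) : ℂ := quad s t a n * a m * a p

variable (s) in
/-- The first order term of the quartic form. -/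
def quinticTerm (n m p : ℤ × ℤ) (t : ℝ) (a : Seq) : ℂ :=
  quadFirstOrder s t a n * a m * a p + quad s t a n * firstOrder s t a m * a p
    + quad s t a n * a m * firstOrder s t a p

variable (s) in
/-- The constant in the expansion of the quartic form. -/
def quarticConst : ℝ := 8 * (288 * convConst s ^ 6) ^ 3

omit hs in
lemma quarticConst_pos : 0 < quarticConst s := by
  have hK := one_le_convConst s
  unfold quarticConst; positivity

lemma norm_seq_sub_apply_le (a b : Seq) (n : ℤ × ℤ) : ‖a n - b n‖ ≤ ‖a - b‖ :=
  (a - b).norm_apply_le n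

lemma norm_seq_sub_smul_apply_le (a b c : Seq) (e : ℂ) (n : ℤ × ℤ) :
    ‖a n - b n - e * c n‖ ≤ ‖a - b - e • c‖ :=
  (a - b - e • c).norm_apply_le n

/-- The three factors are the quadratic term and two coefficients. The common bound 288 K⁶, with K
the convolution constant, is dictated by the squared increment of the quadratic term, (3K)² · 32K⁴.
-/
lemma IsMild.norm_quartic_sub_le {ε T : ℝ} (hS : Small s ε T) {a₀ : Seq} (h₀ : ‖a₀‖ ≤ 1)
    {a : ℝ → Seq} (h : IsMild s ε T a₀ a) {t : ℝ} (ht : |t| ≤ T) (n m p : ℤ × ℤ) :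
    ‖quartic s n m p t (a t) - (quartic s n m p t a₀ + ε * quinticTerm s n m p t a₀)‖
      ≤ quarticConst s * (ε ^ 2 * (1 + |t|)) := by
  have hK := one_le_convConst s
  have hpow : ∀ k ≤ 6, convConst s ^ k ≤ convConst s ^ 6 := fun k hk => pow_le_pow_right₀ hK hk
  have h1 := h.norm_sub_init_sq_le hS h₀ ht
  have h2 := h.norm_sub_firstOrder_le hS h₀ ht
  have h3 := h.norm_quad_sub_le hS h₀ ht
  have h4 := h.norm_le hS h₀ ht
  have hη : 0 ≤ ε ^ 2 * (1 + |t|) := by positivity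
  have hK6 : 1 ≤ convConst s ^ 6 := one_le_pow₀ hK
  have hsub : ‖a t - a₀‖ ≤ 3 := (norm_sub_le _ _).trans (by linarith)
  have ha0 : ∀ k, ‖a₀ k‖ ≤ 288 * convConst s ^ 6 := fun k =>
    (a₀.norm_apply_le k).trans (by linarith)
  have hq0 : ‖quad s t a₀ n‖ ≤ 288 * convConst s ^ 6 :=
    (Seq.norm_apply_le _ n).trans ((norm_conv_self_le _ h₀).trans (by
      have := hpow 1 (by norm_num)
      rw [pow_one] at this
      linarith))
  have hq : ‖quad s t (a t) - quad s t a₀‖ ^ 2 ≤ 288 * convConst s ^ 6 * (ε ^ 2 * (1 + |t|)) := by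
    have : ‖quad s t (a t) - quad s t a₀‖ ≤ convConst s * (2 + 1) * ‖a t - a₀‖ :=
      (norm_conv_self_sub_le _ _ _).trans (by gcongr)
    calc _ ≤ (convConst s * (2 + 1) * ‖a t - a₀‖) ^ 2 := by gcongr
      _ = 9 * convConst s ^ 2 * ‖a t - a₀‖ ^ 2 := by ring
      _ ≤ 9 * convConst s ^ 2 * (32 * convConst s ^ 4 * (ε ^ 2 * (1 + |t|))) := by gcongr
      _ = _ := by ring
  have hδ : ∀ k, ‖a t k - a₀ k‖ ^ 2 ≤ 288 * convConst s ^ 6 * (ε ^ 2 * (1 + |t|)) := fun k => by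
    calc ‖a t k - a₀ k‖ ^ 2 ≤ ‖a t - a₀‖ ^ 2 := by gcongr; exact norm_seq_sub_apply_le _ _ k
      _ ≤ 32 * convConst s ^ 4 * (ε ^ 2 * (1 + |t|)) := h1
      _ ≤ 288 * convConst s ^ 6 * (ε ^ 2 * (1 + |t|)) := by
          gcongr ?_ * ?_ * _
          · norm_num
          · exact hpow _ (by norm_num)
  have hr : ∀ k, ‖a t k - a₀ k - ε * firstOrder s t a₀ k‖
      ≤ 288 * convConst s ^ 6 * (ε ^ 2 * (1 + |t|)) := fun k => by
    refine (norm_seq_sub_smul_apply_le _ _ _ _ k).trans (h2.trans ?_)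
    gcongr ?_ * ?_ * _
    · norm_num
    · exact hpow _ (by norm_num)
  refine norm_mul_mul_sub_le (by linarith) hη hq0 (ha0 m) (ha0 p)
    ((norm_seq_sub_apply_le _ _ p).trans (by linarith))
    (le_trans (by gcongr; exact norm_seq_sub_apply_le _ _ n) hq) (hδ m) (hδ p) ?_ (hr m) (hr p)
  refine (norm_seq_sub_smul_apply_le _ _ _ _ n).trans (h3.trans ?_)
  gcongr ?_ * ?_ * _
  · norm_num
  · exact hpow _ (by norm_num)

lemma quad_neg (t : ℝ) (a : Seq) : quad s t (-a) = quad s t a := by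
  simp [quad]

lemma firstOrder_neg (t : ℝ) (a : Seq) : firstOrder s t (-a) = firstOrder s t a := by
  simp [firstOrder, normalQuad]

/-- The quadratic expressions are even and the coordinates and `quadFirstOrder` are odd. This parity
makes the first order correction vanish in expectation, so the error in the theorem is ε³ and not
ε². -/
lemma quinticTerm_neg (n m p : ℤ × ℤ) (t : ℝ) (a : Seq) :
    quinticTerm s n m p t (-a) = -quinticTerm s n m p t a := by
  have h : quadFirstOrder s t (-a) = -quadFirstOrder s t a := by
    simp only [quadFirstOrder, firstOrder_neg, map_neg, neg_apply]
    abel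
  simp only [quinticTerm, quad_neg, firstOrder_neg, h, lp.coeFn_neg, Pi.neg_apply]
  ring

lemma continuous_eval (n : ℤ × ℤ) : Continuous fun a : Seq => a n := (evalSeq n).continuous

lemma continuous_quad_right (t : ℝ) : Continuous fun a : Seq => quad s t a :=
  continuous_quad continuous_const continuous_id

lemma continuous_firstOrder (t : ℝ) : Continuous fun a : Seq => firstOrder s t a :=
  ((continuous_normalQuad continuous_const continuous_id).sub
    (continuous_normalQuad continuous_const continuous_id)).fun_const_smul _

lemma continuous_quartic (n m p : ℤ × ℤ) (t : ℝ) :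
    Continuous fun a : Seq => quartic s n m p t a :=
  (((continuous_eval n).comp (continuous_quad_right t)).mul (continuous_eval m)).mul
    (continuous_eval p)

lemma continuous_quinticTerm (n m p : ℤ × ℤ) (t : ℝ) :
    Continuous fun a : Seq => quinticTerm s n m p t a := by
  have h1 := continuous_firstOrder (s := s) t
  have h2 : Continuous fun a : Seq => quadFirstOrder s t a :=
    (continuous_conv (fun _ _ => continuous_const) h1 continuous_id).add
      (continuous_conv (fun _ _ => continuous_const) continuous_id h1)
  have h3 := continuous_quad_right (s := s) t
  have e := continuous_eval
  exact ((((e n).comp h2).mul (e m)).mul (e p)).add ((((e n).comp h3).mul ((e m).comp h1)).mul (e p))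
    |>.add ((((e n).comp h3).mul (e m)).mul ((e p).comp h1))

/-- The derivative of a product of three coefficients of a solution. -/
lemma IsMild.hasDerivAt_mul_mul {ε T : ℝ} {a₀ : Seq} {a : ℝ → Seq} (h : IsMild s ε T a₀ a)
    {t : ℝ} (ht : |t| < T) {n m p : ℤ × ℤ} (hn : n.1 ≠ 0) (hm : m.1 ≠ 0) (hp : p.1 ≠ 0) :
    HasDerivAt (fun τ => a τ n * a τ m * a τ p)
      (-(Complex.I * (ε / 2)) * (n.1 * quartic s n m p t (a t) + m.1 * quartic s m p n t (a t)
        + p.1 * quartic s p n m t (a t))) t := by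
  have hc : ∀ k : ℤ × ℤ, k.1 ≠ 0 → HasDerivAt (fun τ => a τ k)
      (-(Complex.I * (ε / 2)) * (k.1 * quad s t (a t) k)) t := fun k hk => by
    have h1 := ((evalSeq k).hasFDerivAt.restrictScalars ℝ).comp_hasDerivAt t (h.hasDerivAt ht)
    have hk' : (k.1 : ℂ) ≠ 0 := by exact_mod_cast hk
    have h2 := h1.const_mul (k.1 : ℂ)
    refine (h2.congr_deriv ?_).congr_of_eventuallyEq (Eventually.of_forall fun τ => ?_)
    · simp only [ContinuousLinearMap.coe_restrictScalars', evalSeq_apply, lp.coeFn_smul,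
        Pi.smul_apply, smul_eq_mul]
      ring
    · simp only [Function.comp_apply, evalSeq_apply, antideriv_apply]
      field_simp
  refine (((hc n hn).mul (hc m hm)).mul (hc p hp)).congr_deriv ?_
  simp only [quartic, Pi.mul_apply]
  ring

end Expansion

/-! ### Translation between functions in H^s and sequences, and the solution theory of KP-II. -/

section Sobolev

lemma size_rpow_mul_eq {s : ℝ} {n : ℤ × ℤ} {c : ℂ} (h : n.1 = 0 → c = 0) :
    size n ^ (2 * s) * ‖c‖ ^ 2 = ‖(weight s n : ℂ) * c‖ ^ 2 := by
  by_cases hn : n.1 = 0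
  · simp [h hn]
  · rw [weight_eq s hn, norm_mul, Complex.norm_real, mul_pow,
      Real.norm_of_nonneg (Real.rpow_nonneg (size_nonneg n) s), mul_comm 2 s,
      Real.rpow_mul (size_nonneg n), Real.rpow_two]

lemma MemHs.memℓp {s : ℝ} {f : Torus → ℝ} (h : MemHs s f) :
    Memℓp (fun n => (weight s n : ℂ) * coeff f n) 2 := by
  rw [memℓp_two_iff]
  exact h.summable.congr fun n => size_rpow_mul_eq (h.coeff_zero n)

open scoped Classical in
/-- The sequence `|n|^s f_n`. -/
def toSeq (s : ℝ) (f : Torus → ℝ) : Seq :=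
  if h : Memℓp (fun n => (weight s n : ℂ) * coeff f n) 2 then ⟨_, h⟩ else 0

lemma MemHs.toSeq_apply {s : ℝ} {f : Torus → ℝ} (h : MemHs s f) (n : ℤ × ℤ) :
    toSeq s f n = weight s n * coeff f n := by
  rw [toSeq, dif_pos h.memℓp]

lemma toSeq_congr {s : ℝ} {f g : Torus → ℝ} (h : f =ᵐ[torusMeasure] g) : toSeq s f = toSeq s g := by
  have : coeff f = coeff g := funext fun n => coeff_congr h n
  unfold toSeq
  rw [this]

lemma MemHs.norm_toSeq {s : ℝ} {f : Torus → ℝ} (h : MemHs s f) : ‖toSeq s f‖ = hsNorm s f := by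
  rw [hsNorm, ← Real.sqrt_sq (norm_nonneg (toSeq s f)), ← (toSeq s f).hasSum_norm_sq.tsum_eq]
  congr 1
  refine tsum_congr fun n => ?_
  rw [h.toSeq_apply, size_rpow_mul_eq (h.coeff_zero n)]

lemma MemHs.hsNorm_sub {s : ℝ} {f g : Torus → ℝ} (hf : MemHs s f) (hg : MemHs s g) :
    hsNorm s (fun z => f z - g z) = ‖toSeq s f - toSeq s g‖ := by
  rw [hsNorm, ← Real.sqrt_sq (norm_nonneg (toSeq s f - toSeq s g)),
    ← (toSeq s f - toSeq s g).hasSum_norm_sq.tsum_eq]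
  congr 1
  refine tsum_congr fun n => ?_
  rw [coeff_sub hf.memLp hg.memLp, size_rpow_mul_eq (fun hn => by
    rw [hf.coeff_zero n hn, hg.coeff_zero n hn, sub_zero])]
  simp only [lp.coeFn_sub, Pi.sub_apply, hf.toSeq_apply, hg.toSeq_apply, mul_sub]

lemma MemHs.toSeq_zero_mode {s : ℝ} {f : Torus → ℝ} (h : MemHs s f) {n : ℤ × ℤ} (hn : n.1 = 0) :
    toSeq s f n = 0 := by
  rw [h.toSeq_apply, h.coeff_zero n hn, mul_zero]

lemma MemHs.toSeq_neg {s : ℝ} {f : Torus → ℝ} (h : MemHs s f) (n : ℤ × ℤ) :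
    toSeq s f (-n) = conj (toSeq s f n) := by
  rw [h.toSeq_apply, h.toSeq_apply, coeff_neg, weight_neg, map_mul, Complex.conj_ofReal]

/-- The multiplier of the linear group. -/
def rotation (t : ℝ) : Mult :=
  ⟨fun n => Complex.exp (Complex.I * ((omega n * t : ℝ) : ℂ)), fun _ => (norm_exp_I_mul _).le⟩

lemma rotation_apply (t : ℝ) (n : ℤ × ℤ) :
    rotation t n = Complex.exp (Complex.I * ((omega n * t : ℝ) : ℂ)) := rfl

lemma continuous_rotation (n : ℤ × ℤ) : Continuous fun t => rotation t n := by
  simp only [rotation_apply]; fun_prop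

lemma rotation_zero (n : ℤ × ℤ) : rotation 0 n = 1 := by simp [rotation_apply]

lemma rotation_mul_neg (t : ℝ) (n : ℤ × ℤ) : rotation t n * rotation (-t) n = 1 := by
  rw [rotation_apply, rotation_apply, ← Complex.exp_add, ← mul_add, ← Complex.ofReal_add]
  simp

lemma omega_neg (n : ℤ × ℤ) : omega (-n) = -omega n := by
  simp only [omega, Prod.fst_neg, Prod.snd_neg, Int.cast_neg]
  rw [div_neg, Odd.neg_pow (by decide), neg_sq]
  ring

lemma rotation_neg_index (t : ℝ) (n : ℤ × ℤ) : rotation t (-n) = conj (rotation t n) := by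
  rw [rotation_apply, rotation_apply, ← Complex.exp_conj, omega_neg]
  congr 1
  simp

lemma hasDerivAt_rotation (t : ℝ) (n : ℤ × ℤ) :
    HasDerivAt (fun τ => rotation τ n) (Complex.I * omega n * rotation t n) t := by
  have h1 : HasDerivAt (fun x : ℝ => Complex.I * ((omega n * x : ℝ) : ℂ))
      (Complex.I * (omega n : ℂ)) t := by
    have := ((hasDerivAt_id t).const_mul (omega n)).ofReal_comp.const_mul Complex.I
    simpa using this
  refine h1.cexp.congr_deriv ?_
  rw [rotation_apply]; ring

variable {s : ℝ} [hs : Fact (1 < s)]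

/-- The phases of the two factors and of the kernel combine to the phase of the output. The kernel
omits interactions with a vanishing first component, which is harmless because those coefficients of
f are zero. -/
lemma quad_rotation_toSeq {f : Torus → ℝ} (h : MemHs s f) (t : ℝ) {n : ℤ × ℤ} (hn : n.1 ≠ 0) :
    quad s t (mulSeq s (rotation (-t)) (toSeq s f)) n
      = rotation (-t) n * (weight s n * coeff (fun z => f z ^ 2) n) := by
  refine (hasSum_conv (kerNL t) _ _ n).unique ?_
  have h1 := ((hasSum_coeff_sq h.memLp n).mul_left (weight s n : ℂ)).mul_left (rotation (-t) n)
  convert! h1 using 1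
  funext k
  simp only [convTerm, mulSeq_apply, h.toSeq_apply]
  change symb (fun _ _ => 1) t k (n - k) * _ * _ = _
  unfold symb
  split_ifs with hg
  · have hk := (weight_pos s k).ne'
    have hl := (weight_pos s (n - k)).ne'
    have hk' : (weight s k : ℂ) ≠ 0 := by exact_mod_cast hk
    have hl' : (weight s (n - k) : ℂ) ≠ 0 := by exact_mod_cast hl
    have he : Complex.exp (Complex.I * ((res k (n - k) * t : ℝ) : ℂ)) * (rotation (-t) k *
        rotation (-t) (n - k)) = rotation (-t) n := by
      simp only [rotation_apply, ← Complex.exp_add, res, add_sub_cancel]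
      congr 1
      push_cast
      ring
    rw [← he, ratio, add_sub_cancel]
    push_cast
    field_simp
  · rcases not_and_or.1 hg with h0 | h0
    · rw [not_not] at h0
      rw [h.coeff_zero k h0]; ring
    · rcases not_and_or.1 h0 with h0 | h0
      · rw [not_not] at h0
        rw [h.coeff_zero (n - k) h0]; ring
      · exact absurd hn (by simpa using h0)

lemma mulSeq_rotation_cancel (t : ℝ) (a : Seq) :
    mulSeq s (rotation t) (mulSeq s (rotation (-t)) a) = a := by
  ext n
  rw [mulSeq_apply, mulSeq_apply, ← mul_assoc, rotation_mul_neg, one_mul]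

/-- The coordinates of the integrated equation. -/
lemma isMild_eq_iff {ε : ℝ} {a₀ : Seq} {a : ℝ → Seq} (ha : Continuous a) (t : ℝ) :
    (antideriv s (a t) = antideriv s a₀ + ∫ τ in (0 : ℝ)..t, (-(Complex.I * (ε / 2))) • quad s τ (a τ))
      ↔ ∀ n : ℤ × ℤ, n.1 ≠ 0 → a t n = a₀ n
        + ∫ τ in (0 : ℝ)..t, -(Complex.I * (ε / 2)) * (n.1 * quad s τ (a τ) n) := by
  have hc := continuous_smul_quad (s := s) ha (-(Complex.I * ((ε : ℂ) / 2)))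
  have hi : ∀ n : ℤ × ℤ, (∫ τ in (0 : ℝ)..t, (-(Complex.I * ((ε : ℂ) / 2))) • quad s τ (a τ)) n
      = ∫ τ in (0 : ℝ)..t, (-(Complex.I * ((ε : ℂ) / 2))) * quad s τ (a τ) n := fun n =>
    integral_seq_apply hc 0 t n
  have hi' : ∀ n : ℤ × ℤ, ∫ τ in (0 : ℝ)..t, -(Complex.I * ((ε : ℂ) / 2)) * (n.1 * quad s τ (a τ) n)
      = n.1 * ∫ τ in (0 : ℝ)..t, (-(Complex.I * ((ε : ℂ) / 2))) * quad s τ (a τ) n := fun n => by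
    rw [← intervalIntegral.integral_const_mul]
    congr 1; funext τ; ring
  constructor
  · intro h n hn
    have hn' : (n.1 : ℂ) ≠ 0 := by exact_mod_cast hn
    have h1 := congrArg (fun x : Seq => x n) h
    simp only [lp.coeFn_add, Pi.add_apply, antideriv_apply] at h1
    rw [hi] at h1
    rw [hi']
    have h2 := congrArg (fun x => (n.1 : ℂ) * x) h1
    simp only [mul_add, mul_inv_cancel_left₀ hn'] at h2
    exact h2
  · intro h
    ext n
    simp only [lp.coeFn_add, Pi.add_apply, antideriv_apply]
    rw [hi]
    by_cases hn : n.1 = 0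
    · have : ∀ τ, quad s τ (a τ) n = 0 := fun τ => conv_eq_zero (t := τ) rfl _ _ hn
      simp [hn, this]
    · have hn' : (n.1 : ℂ) ≠ 0 := by exact_mod_cast hn
      rw [h n hn, hi']
      field_simp

/-- Coefficientwise, conjugation by the linear group removes the dispersion from the distributional
equation and leaves the quadratic term, which is then integrated in time. Clamping extends the curve
continuously to the whole line. -/
lemma IsSolution.isMild {ε T : ℝ} (hT : 0 ≤ T) {J : Set ℝ} (hJ : ∀ t, |t| ≤ T → t ∈ J)
    {f : Torus → ℝ} {u : ℝ → Torus → ℝ} (h : IsSolution s ε J f u) :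
    IsMild s ε T (toSeq s f)
      (fun t => mulSeq s (rotation (-clampTime T t)) (toSeq s (u (clampTime T t)))) := by
  have hcJ : ∀ t, clampTime T t ∈ J := fun t => hJ _ (abs_clampTime_le hT t)
  have hcont : Continuous fun t => mulSeq s (rotation (-clampTime T t)) (toSeq s (u (clampTime T t))) := by
    rw [continuous_iff_continuousAt]
    intro t₀
    refine tendsto_mulSeq (fun n => ?_) ?_
    · exact ((continuous_rotation n).comp (continuous_clampTime T).neg).tendsto t₀
    · rw [tendsto_iff_norm_sub_tendsto_zero]
      have h1 : Tendsto (clampTime T) (𝓝 t₀) (𝓝[J] (clampTime T t₀)) :=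
        tendsto_nhdsWithin_iff.2 ⟨(continuous_clampTime T).tendsto t₀, Eventually.of_forall hcJ⟩
      refine ((h.continuous _ (hcJ t₀)).comp h1).congr fun t => ?_
      exact (h.memHs _ (hcJ t)).hsNorm_sub (h.memHs _ (hcJ t₀))
  have h0 : clampTime T 0 = 0 := clampTime_of_abs_le (by rwa [abs_zero])
  have hinit : mulSeq s (rotation (-clampTime T 0)) (toSeq s (u (clampTime T 0))) = toSeq s f := by
    rw [h0, toSeq_congr h.initial]
    ext n
    rw [mulSeq_apply, neg_zero, rotation_zero, one_mul]
  refine ⟨hcont, hinit, fun t ht n hn => ?_, fun t ht => ?_⟩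
  · rw [mulSeq_apply, (h.memHs _ (hcJ t)).toSeq_zero_mode hn, mul_zero]
  · rw [isMild_eq_iff hcont t]
    intro n hn
    have hn' : (n.1 : ℂ) ≠ 0 := by exact_mod_cast hn
    have hq : Continuous fun τ => -(Complex.I * ((ε : ℂ) / 2)) * (n.1 * quad s τ
        (mulSeq s (rotation (-clampTime T τ)) (toSeq s (u (clampTime T τ)))) n) :=
      continuous_const.mul (continuous_const.mul ((continuous_eval n).comp
        (continuous_quad_curve hcont)))
    have hI := intervalIntegral.integral_eq_sub_of_hasDeriv_right
      (f := fun τ => mulSeq s (rotation (-clampTime T τ)) (toSeq s (u (clampTime T τ))) n)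
      (a := 0) (b := t) ((continuous_eval n).comp hcont).continuousOn (fun τ hτ => by
        have hτ' := mem_of_mem_uIoo ht hτ
        have hτJ : τ ∈ J := hJ τ hτ'.le
        obtain ⟨d, hd, he⟩ := h.equation n τ hτJ
        have hJn : J ∈ 𝓝 τ := mem_of_superset (eventually_abs_le hτ') fun x hx => hJ x hx
        have hd' := hd.hasDerivAt hJn
        have hr : HasDerivAt (fun x => rotation (-x) n)
            (-(Complex.I * omega n * rotation (-τ) n)) τ := by
          have := (hasDerivAt_rotation (-τ) n).scomp τ (hasDerivAt_neg τ)
          simpa [Function.comp_def] using this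
        have h2 := hr.mul (hd'.const_mul (weight s n : ℂ))
        refine HasDerivAt.hasDerivWithinAt ((h2.congr_deriv ?_).congr_of_eventuallyEq ?_)
          (f' := -(Complex.I * ((ε : ℂ) / 2)) * (n.1 * quad s τ
            (mulSeq s (rotation (-clampTime T τ)) (toSeq s (u (clampTime T τ)))) n))
        · rw [clampTime_of_abs_le hτ'.le, quad_rotation_toSeq (h.memHs τ hτJ) τ hn]
          -- The equation carries an outer ∂ₓ; it determines d only after division by i n_1, which
          -- is nonzero here.
          have hdd : d = Complex.I * omega n * coeff (u τ) n
              - Complex.I * (ε / 2) * (n.1 * coeff (fun z => u τ z ^ 2) n) := by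
            have ho : (omega n : ℂ) = (n.1 : ℂ) ^ 3 - (n.2 : ℂ) ^ 2 / (n.1 : ℂ) := by
              simp [omega]
            have hI3 : Complex.I ^ 3 = -Complex.I := by rw [pow_succ, Complex.I_sq]; ring
            have he' : Complex.I * n.1 * (d - (Complex.I * omega n * coeff (u τ) n
              - Complex.I * (ε / 2) * (n.1 * coeff (fun z => u τ z ^ 2) n))) = 0 := by
              rw [← he, ho]
              simp only [mul_pow, hI3, Complex.I_sq]
              field_simp
              linear_combination (2 * coeff (u τ) n * n.2 ^ 2) * Complex.I_sq
            have := (mul_eq_zero.1 he').resolve_left (mul_ne_zero Complex.I_ne_zero hn')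
            exact sub_eq_zero.1 this
          rw [hdd]
          ring
        · filter_upwards [eventually_abs_le hτ'] with x hx
          rw [mulSeq_apply, clampTime_of_abs_le hx, (h.memHs x (hJ x hx)).toSeq_apply]
          rfl)
      (hq.intervalIntegrable _ _)
    rw [hI, hinit]
    ring

/-- The reflection of a sequence; real valued functions correspond to its fixed points. -/
def conjSeq (a : Seq) : Seq :=
  ⟨fun n => conj (a (-n)), memℓp_two_iff.2 (by
    have := (Equiv.neg (ℤ × ℤ)).summable_iff.2 a.hasSum_norm_sq.summable
    exact this.congr fun n => by simp)⟩

lemma conjSeq_apply (a : Seq) (n : ℤ × ℤ) : conjSeq a n = conj (a (-n)) := rfl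

lemma norm_conjSeq (a : Seq) : ‖conjSeq a‖ = ‖a‖ := by
  rw [← Real.sqrt_sq (norm_nonneg a), ← Real.sqrt_sq (norm_nonneg (conjSeq a)),
    ← a.hasSum_norm_sq.tsum_eq, ← (conjSeq a).hasSum_norm_sq.tsum_eq,
    ← (Equiv.neg (ℤ × ℤ)).tsum_eq (fun n => ‖a n‖ ^ 2)]
  congr 2
  funext n
  simp [conjSeq_apply]

lemma continuous_conjSeq : Continuous conjSeq := by
  refine (Isometry.of_dist_eq fun a b => ?_).continuous
  rw [dist_eq_norm, dist_eq_norm, ← norm_conjSeq (a - b)]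
  congr 1
  ext n
  simp [conjSeq_apply]

lemma res_neg (k l : ℤ × ℤ) : res (-k) (-l) = -res k l := by
  rw [res, res, ← neg_add, omega_neg, omega_neg, omega_neg]; ring

lemma ratio_neg (s : ℝ) (k l : ℤ × ℤ) : ratio s (-k) (-l) = ratio s k l := by
  rw [ratio, ratio, ← neg_add, weight_neg, weight_neg, weight_neg]

lemma good_neg {k l : ℤ × ℤ} : Good (-k) (-l) ↔ Good k l := by
  simp only [Good, ← neg_add, Prod.fst_neg, ne_eq, neg_eq_zero]

lemma kerNL_neg (t : ℝ) (k l : ℤ × ℤ) : kerNL t (-k) (-l) = conj (kerNL t k l) := by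
  change symb (fun _ _ => 1) t (-k) (-l) = conj (symb (fun _ _ => 1) t k l)
  unfold symb
  by_cases h : Good k l
  · rw [if_pos h, if_pos (good_neg.2 h), res_neg, map_mul, ← Complex.exp_conj]
    simp
  · rw [if_neg h, if_neg (fun h' => h (good_neg.1 h')), map_zero]

lemma quad_conjSeq (t : ℝ) (a : Seq) (n : ℤ × ℤ) :
    quad s t (conjSeq a) n = conj (quad s t a (-n)) := by
  change conv s (kerNL t) _ _ n = conj (conv s (kerNL t) _ _ (-n))
  rw [conv_apply, conv_apply, Complex.conj_tsum, ← (Equiv.neg (ℤ × ℤ)).tsum_eq]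
  refine tsum_congr fun k => ?_
  obtain ⟨l, hl⟩ : ∃ l, l = -n - k := ⟨_, rfl⟩
  have e1 : n - -k = -l := by rw [hl]; abel
  simp only [convTerm, Equiv.neg_apply, conjSeq_apply, map_mul, Complex.conj_ofReal]
  rw [e1, ← hl, ratio_neg, kerNL_neg, neg_neg, neg_neg]

lemma IsMild.conj {ε T : ℝ} {a₀ : Seq} {a : ℝ → Seq} (h : IsMild s ε T a₀ a) :
    IsMild s ε T (conjSeq a₀) (fun t => conjSeq (a t)) := by
  have hc : Continuous fun t => conjSeq (a t) := continuous_conjSeq.comp h.cont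
  refine ⟨hc, by rw [h.init], fun t ht n hn => ?_, fun t ht => ?_⟩
  · rw [conjSeq_apply, h.zero_mode t ht (-n) (by simpa using hn), map_zero]
  · have h1 := (isMild_eq_iff h.cont t).1 (h.eq t ht)
    rw [isMild_eq_iff hc t]
    intro n hn
    have h2 := h1 (-n) (by simpa using hn)
    have hI : (starRingEnd ℂ) (∫ τ in (0 : ℝ)..t,
        -(Complex.I * ((ε : ℂ) / 2)) * (((-n).1 : ℂ) * quad s τ (a τ) (-n)))
        = ∫ τ in (0 : ℝ)..t, -(Complex.I * ((ε : ℂ) / 2)) * (n.1 * quad s τ (conjSeq (a τ)) n) := by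
      have e : ∀ τ, -(Complex.I * ((ε : ℂ) / 2)) * (n.1 * quad s τ (conjSeq (a τ)) n)
          = (starRingEnd ℂ) (-(Complex.I * ((ε : ℂ) / 2)) * (((-n).1 : ℂ) * quad s τ (a τ) (-n))) :=
        fun τ => by
          have h2 : (starRingEnd ℂ) (2 : ℂ) = 2 := map_ofNat _ 2
          rw [quad_conjSeq]
          simp [h2]
      simp only [e, intervalIntegral, integral_conj, map_sub]
    rw [conjSeq_apply, conjSeq_apply, h2, map_add, hI]

/-- The reflected curve solves the same equation with the same datum, so the Lipschitz estimate
identifies it with the original one. -/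
lemma IsMild.apply_neg {ε T : ℝ} (hS : Small s ε T) {a₀ : Seq} (h₀ : ‖a₀‖ ≤ 1) {a : ℝ → Seq}
    (h : IsMild s ε T a₀ a) (hreal : ∀ n, a₀ (-n) = conj (a₀ n)) {t : ℝ} (ht : |t| ≤ T)
    (n : ℤ × ℤ) : a t (-n) = conj (a t n) := by
  have hc : conjSeq a₀ = a₀ := by
    ext n
    rw [conjSeq_apply, hreal, Complex.conj_conj]
  have h1 := (hc ▸ h.conj : IsMild s ε T a₀ _).dist_le hS h₀ h₀ h ht
  rw [sub_self, norm_zero, mul_zero] at h1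
  have h2 := sub_eq_zero.1 (norm_le_zero_iff.1 h1)
  conv_lhs => rw [← h2]
  rw [conjSeq_apply, neg_neg]

/-- Uniqueness: the coefficients of a solution are given by the flow. -/
lemma IsSolution.coeff_eq {ε T : ℝ} (hS : Small s ε T) {J : Set ℝ} (hJ : ∀ t, |t| ≤ T → t ∈ J)
    {f : Torus → ℝ} (hf : MemHs s f) (hf1 : hsNorm s f ≤ 1) {u : ℝ → Torus → ℝ}
    (h : IsSolution s ε J f u) {t : ℝ} (ht : |t| ≤ T) (n : ℤ × ℤ) :
    coeff (u t) n = rotation t n * ((weight s n : ℂ)⁻¹ * flow s ε (toSeq s f) t n) := by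
  have h₀ : ‖toSeq s f‖ ≤ 1 := hf.norm_toSeq.trans_le hf1
  have h1 := (h.isMild hS.time_nonneg hJ).dist_le hS h₀ h₀
    (isMild_flow hS h₀ fun n hn => hf.toSeq_zero_mode hn) ht
  rw [sub_self, norm_zero, mul_zero] at h1
  have h2 := sub_eq_zero.1 (norm_le_zero_iff.1 h1)
  rw [← h2, clampTime_of_abs_le ht, mulSeq_apply, (h.memHs t (hJ t ht)).toSeq_apply]
  have h3 := rotation_mul_neg t n
  have h4 : (weight s n : ℂ) ≠ 0 := by exact_mod_cast (weight_pos s n).ne'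
  calc coeff (u t) n = (rotation t n * rotation (-t) n) * coeff (u t) n := by rw [h3, one_mul]
    _ = _ := by field_simp

lemma one_le_weight (n : ℤ × ℤ) : 1 ≤ weight s n :=
  Real.one_le_rpow (le_max_left _ _) (by linarith [hs.out])

/-- Undo the weight and the phase in the flow, and realise the coefficients at each time separately
by a real L² function. The choices at different times need not be related, as every condition
depends on the coefficients only. -/
lemma exists_isSolution {ε : ℝ} {J : Set ℝ} (h0J : (0 : ℝ) ∈ J) (hJ : ∀ t ∈ J, Small s ε |t|)
    {f : Torus → ℝ} (hf : MemHs s f) (hf1 : hsNorm s f ≤ 1) :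
    ∃ w : ℝ → Torus → ℝ, IsSolution s ε J f w := by
  have h₀ : ‖toSeq s f‖ ≤ 1 := hf.norm_toSeq.trans_le hf1
  have hz : ∀ n : ℤ × ℤ, n.1 = 0 → toSeq s f n = 0 := fun n hn => hf.toSeq_zero_mode hn
  set a := flow s ε (toSeq s f) with ha
  have hm : ∀ t ∈ J, IsMild s ε |t| (toSeq s f) a := fun t ht => isMild_flow (hJ t ht) h₀ hz
  have hac : Continuous a := (hm 0 h0J).cont
  have hex : ∀ t, ∃ g : Torus → ℝ, t ∈ J → MemLp g 2 torusMeasure ∧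
      ∀ n, (weight s n : ℂ) * coeff g n = rotation t n * a t n := by
    intro t
    by_cases ht : t ∈ J
    · set b : Seq := mulSeq s ⟨fun n => ((weight s n)⁻¹ : ℝ), fun n => by
        rw [Complex.norm_real, Real.norm_of_nonneg (inv_nonneg.2 (weight_pos s n).le)]
        exact inv_le_one_of_one_le₀ (one_le_weight n)⟩ (mulSeq s (rotation t) (a t)) with hb
      have hbn : ∀ n, b n = ((weight s n : ℂ))⁻¹ * (rotation t n * a t n) := fun n => by
        refine (mulSeq_apply _ _ n).trans ?_
        rw [mulSeq_apply]
        simp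
      obtain ⟨g, hg, hgc⟩ := exists_coeff_eq b fun n => by
        rw [hbn, hbn, weight_neg, rotation_neg_index,
          (hm t ht).apply_neg (hJ t ht) h₀ hf.toSeq_neg le_rfl]
        simp
      refine ⟨g, fun _ => ⟨hg, fun n => ?_⟩⟩
      have h4 : (weight s n : ℂ) ≠ 0 := by exact_mod_cast (weight_pos s n).ne'
      rw [hgc, hbn, mul_inv_cancel_left₀ h4]
    · exact ⟨0, fun h => absurd h ht⟩
  choose w hw using hex
  have hw2 : ∀ t ∈ J, ∀ n, coeff (w t) n = (weight s n : ℂ)⁻¹ * (rotation t n * a t n) :=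
    fun t ht n => by
      have h4 : (weight s n : ℂ) ≠ 0 := by exact_mod_cast (weight_pos s n).ne'
      rw [← (hw t ht).2 n, inv_mul_cancel_left₀ h4]
  have hmem : ∀ t ∈ J, MemHs s (w t) := fun t ht => by
    have hcz : ∀ n : ℤ × ℤ, n.1 = 0 → coeff (w t) n = 0 := fun n hn => by
      rw [hw2 t ht, (hm t ht).zero_mode t le_rfl n hn]; ring
    refine ⟨(hw t ht).1, hcz, ?_⟩
    refine (a t).hasSum_norm_sq.summable.congr fun n => ?_
    rw [size_rpow_mul_eq (hcz n), (hw t ht).2, norm_mul, rotation_apply, norm_exp_I_mul, one_mul]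
  have hseq : ∀ t ∈ J, toSeq s (w t) = mulSeq s (rotation t) (a t) := fun t ht => by
    ext n
    rw [(hmem t ht).toSeq_apply, (hw t ht).2, mulSeq_apply]
  refine ⟨w, hmem, fun t₀ ht₀ => ?_, ?_, fun n t ht => ?_⟩
  · have h1 : Tendsto (fun t => mulSeq s (rotation t) (a t)) (𝓝[J] t₀)
        (𝓝 (mulSeq s (rotation t₀) (a t₀))) :=
      (tendsto_mulSeq (fun n => (continuous_rotation n).tendsto t₀)
        (hac.tendsto t₀)).mono_left nhdsWithin_le_nhds
    refine (tendsto_iff_norm_sub_tendsto_zero.1 h1).congr' ?_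
    filter_upwards [self_mem_nhdsWithin] with t ht
    rw [(hmem t ht).hsNorm_sub (hmem t₀ ht₀), hseq t ht, hseq t₀ ht₀]
  · refine ae_eq_of_coeff_eq (hw 0 h0J).1 hf.memLp fun n => ?_
    have h4 : (weight s n : ℂ) ≠ 0 := by exact_mod_cast (weight_pos s n).ne'
    rw [hw2 0 h0J, rotation_zero, one_mul, (hm 0 h0J).init, hf.toSeq_apply,
      inv_mul_cancel_left₀ h4]
  · by_cases hn : n.1 = 0
    · refine ⟨0, ?_, ?_⟩
      · refine (hasDerivWithinAt_const t J (0 : ℂ)).congr (fun x hx => ?_) ?_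
        · exact (hmem x hx).coeff_zero n hn
        · exact (hmem t ht).coeff_zero n hn
      · rw [(hmem t ht).coeff_zero n hn, hn]
        simp
    · have hn' : (n.1 : ℂ) ≠ 0 := by exact_mod_cast hn
      have h4 : (weight s n : ℂ) ≠ 0 := by exact_mod_cast (weight_pos s n).ne'
      have hq : Continuous fun τ => -(Complex.I * ((ε : ℂ) / 2)) * (n.1 * quad s τ (a τ) n) :=
        continuous_const.mul (continuous_const.mul ((continuous_eval n).comp
          (continuous_quad_curve hac)))
      have hd : HasDerivWithinAt (fun τ => a τ n)
          (-(Complex.I * ((ε : ℂ) / 2)) * (n.1 * quad s t (a t) n)) J t := by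
        have h1 := ((hq.integral_hasStrictDerivAt 0 t).hasDerivAt.const_add
          (toSeq s f n)).hasDerivWithinAt (s := J)
        refine h1.congr (fun x hx => ?_) ?_
        · exact (isMild_eq_iff hac x).1 ((hm x hx).eq x le_rfl) n hn
        · exact (isMild_eq_iff hac t).1 ((hm t ht).eq t le_rfl) n hn
      have hd2 := (((hasDerivAt_rotation t n).hasDerivWithinAt (s := J)).mul hd).const_mul
        ((weight s n : ℂ)⁻¹)
      refine ⟨_, hd2.congr (fun x hx => hw2 x hx n) (hw2 t ht n), ?_⟩
      have hqe : quad s t (a t) n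
          = rotation (-t) n * (weight s n * coeff (fun z => w t z ^ 2) n) := by
        rw [← quad_rotation_toSeq (hmem t ht) t hn, hseq t ht]
        have := mulSeq_rotation_cancel (s := s) (-t) (a t)
        rw [neg_neg] at this
        rw [this]
      have ho : (omega n : ℂ) = (n.1 : ℂ) ^ 3 - (n.2 : ℂ) ^ 2 / (n.1 : ℂ) := by
        simp [omega]
      have hI3 : Complex.I ^ 3 = -Complex.I := by rw [pow_succ, Complex.I_sq]; ring
      have hr := rotation_mul_neg t n
      have hqr : rotation t n * quad s t (a t) n = weight s n * coeff (fun z => w t z ^ 2) n := by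
        rw [hqe, ← mul_assoc, hr, one_mul]
      rw [hw2 t ht n]
      have e1 : (weight s n : ℂ)⁻¹ * (Complex.I * omega n * rotation t n * a t n
          + rotation t n * (-(Complex.I * ((ε : ℂ) / 2)) * (n.1 * quad s t (a t) n)))
          = Complex.I * omega n * ((weight s n : ℂ)⁻¹ * (rotation t n * a t n))
            - Complex.I * (ε / 2) * (n.1 * coeff (fun z => w t z ^ 2) n) := by
        have : coeff (fun z => w t z ^ 2) n
            = (weight s n : ℂ)⁻¹ * (rotation t n * quad s t (a t) n) := by
          rw [hqr, inv_mul_cancel_left₀ h4]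
        rw [this]; ring
      rw [e1, ho]
      simp only [mul_pow, hI3, Complex.I_sq]
      generalize (weight s n : ℂ)⁻¹ * (rotation t n * a t n) = c
      field_simp
      linear_combination (-(2 * c * n.2 ^ 2)) * Complex.I_sq

end Sobolev

/-! ### Measurability of the sequence attached to a family of coefficients, and of the flow. -/

section RandomSequence

/-- The sequence with the modes `(0, n₂)` removed. -/
def cutoff (c : ℤ × ℤ → ℂ) (n : ℤ × ℤ) : ℂ := if n.1 = 0 then 0 else c n

lemma cutoff_of_ne {n : ℤ × ℤ} (hn : n.1 ≠ 0) (c : ℤ × ℤ → ℂ) : cutoff c n = c n := if_neg hn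

/-- The families of coefficients whose nonzero modes form a sequence in the unit ball. -/
def unitData : Set (ℤ × ℤ → ℂ) := {c | ∀ F : Finset (ℤ × ℤ), ∑ n ∈ F, ‖cutoff c n‖ ^ 2 ≤ 1}

lemma memℓp_cutoff {c : ℤ × ℤ → ℂ} (h : c ∈ unitData) : Memℓp (cutoff c) 2 :=
  memℓp_two_iff.2 (summable_of_sum_le (fun _ => sq_nonneg _) h)

open scoped Classical in
/-- The sequence of a family of coefficients in the unit ball, and zero otherwise. -/
def assemble (c : ℤ × ℤ → ℂ) : Seq := if h : c ∈ unitData then ⟨cutoff c, memℓp_cutoff h⟩ else 0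

lemma assemble_apply {c : ℤ × ℤ → ℂ} (h : c ∈ unitData) (n : ℤ × ℤ) :
    assemble c n = cutoff c n := by
  rw [assemble, dif_pos h]

lemma assemble_of_notMem {c : ℤ × ℤ → ℂ} (h : c ∉ unitData) : assemble c = 0 := by
  rw [assemble, dif_neg h]

lemma norm_assemble_le (c : ℤ × ℤ → ℂ) : ‖assemble c‖ ≤ 1 := by
  by_cases h : c ∈ unitData
  · rw [← sq_le_one_iff₀ (norm_nonneg _), ← (assemble c).hasSum_norm_sq.tsum_eq]
    simp only [assemble_apply h]
    exact ((memℓp_two_iff.1 (memℓp_cutoff h)).tsum_le_of_sum_le h)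
  · simp [assemble_of_notMem h]

lemma assemble_zero_mode (c : ℤ × ℤ → ℂ) {n : ℤ × ℤ} (hn : n.1 = 0) : assemble c n = 0 := by
  by_cases h : c ∈ unitData
  · rw [assemble_apply h, cutoff, if_pos hn]
  · simp [assemble_of_notMem h]

lemma norm_assemble_apply_le (c : ℤ × ℤ → ℂ) (n : ℤ × ℤ) : ‖assemble c n‖ ≤ 1 :=
  ((assemble c).norm_apply_le n).trans (norm_assemble_le c)

/-- Multiplication of a family of coefficients by a phase. -/
lemma assemble_phase {χ c : ℤ × ℤ → ℂ} (hχ : ∀ n, ‖χ n‖ = 1) (n : ℤ × ℤ) :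
    assemble (fun k => χ k * c k) n = χ n * assemble c n := by
  have e : ∀ k, cutoff (fun k => χ k * c k) k = χ k * cutoff c k := fun k => by
    unfold cutoff; split_ifs <;> simp
  have hiff : (fun k => χ k * c k) ∈ unitData ↔ c ∈ unitData := by
    simp only [unitData, Set.mem_ofPred_eq, e, norm_mul, hχ, one_mul]
  by_cases h : c ∈ unitData
  · rw [assemble_apply h, assemble_apply (hiff.2 h), e]
  · simp [assemble_of_notMem h, assemble_of_notMem (mt hiff.1 h)]

lemma measurable_cutoff (n : ℤ × ℤ) : Measurable fun c : ℤ × ℤ → ℂ => cutoff c n := by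
  unfold cutoff
  split_ifs
  · exact measurable_const
  · exact measurable_pi_apply n

lemma measurableSet_unitData : MeasurableSet unitData := by
  rw [unitData, Set.ofPred_forall]
  refine MeasurableSet.iInter fun F => measurableSet_le ?_ measurable_const
  exact Finset.measurable_sum _ fun n _ => (measurable_cutoff n).norm.pow_const 2

/-- A pointwise limit of finite sums of coordinate vectors, cut off to a set described by countably
many measurable conditions. -/
lemma stronglyMeasurable_assemble : StronglyMeasurable assemble := by
  classical
  have h1 : ∀ F : Finset (ℤ × ℤ), StronglyMeasurable fun c : ℤ × ℤ → ℂ =>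
      if c ∈ unitData then ∑ n ∈ F, (lp.single 2 n (cutoff c n) : Seq) else 0 := fun F => by
    refine StronglyMeasurable.ite measurableSet_unitData ?_ stronglyMeasurable_const
    refine Finset.stronglyMeasurable_fun_sum _ fun n _ => ?_
    exact (lp.singleContinuousLinearMap ℂ (fun _ : ℤ × ℤ => ℂ) 2 n).continuous.comp_stronglyMeasurable
      (measurable_cutoff n).stronglyMeasurable
  refine stronglyMeasurable_of_tendsto atTop h1 (tendsto_pi_nhds.2 fun c => ?_)
  by_cases h : c ∈ unitData
  · simp only [if_pos h]
    have := lp.hasSum_single (p := 2) (by norm_num) (assemble c)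
    simp only [assemble_apply h] at this
    exact this
  · simp only [if_neg h, assemble_of_notMem h]
    exact tendsto_const_nhds

variable {s : ℝ} [hs : Fact (1 < s)]

/-- The sequences in the unit ball without the modes `(0, n₂)`. -/
def unitBall : Set Seq := {a | ‖a‖ ≤ 1 ∧ ∀ n : ℤ × ℤ, n.1 = 0 → a n = 0}

lemma assemble_mem (c : ℤ × ℤ → ℂ) : assemble c ∈ unitBall :=
  ⟨norm_assemble_le c, fun _ hn => assemble_zero_mode c hn⟩

lemma isMild_flow_assemble {ε T : ℝ} (hS : Small s ε T) (c : ℤ × ℤ → ℂ) :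
    IsMild s ε T (assemble c) (flow s ε (assemble c)) :=
  isMild_flow hS (norm_assemble_le c) fun _ hn => assemble_zero_mode c hn

/-- The flow is defined by choice, but it is Lipschitz in the datum on the unit ball; measurability
follows from continuity there. -/
lemma stronglyMeasurable_flow {ε T : ℝ} (hS : Small s ε T) {t : ℝ} (ht : |t| ≤ T) :
    StronglyMeasurable fun c : ℤ × ℤ → ℂ => flow s ε (assemble c) t := by
  have h1 : Continuous fun a : unitBall => flow s ε a.1 t := by
    refine LipschitzWith.continuous (K := 4) (LipschitzWith.of_dist_le_mul fun a b => ?_)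
    rw [dist_eq_norm, Subtype.dist_eq, dist_eq_norm]
    exact (isMild_flow hS a.2.1 a.2.2).dist_le hS a.2.1 b.2.1 (isMild_flow hS b.2.1 b.2.2) ht
  have h2 : StronglyMeasurable fun c => (⟨assemble c, assemble_mem c⟩ : unitBall) :=
    (Embedding.comp_stronglyMeasurable_iff Topology.IsEmbedding.subtypeVal).1
      stronglyMeasurable_assemble
  exact h1.comp_stronglyMeasurable h2

end RandomSequence

/-! ### Phase invariance of the law of the datum and the vanishing of unpaired moments. -/

section RandomData

/-- The indices with a positive first component. -/
abbrev PosIndex : Type := {n : ℤ × ℤ // 0 < n.1}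

/-- The extension of a family by `x_{-n} = conj x_n`. -/
def extend (x : PosIndex → ℂ) (n : ℤ × ℤ) : ℂ :=
  if h : 0 < n.1 then x ⟨n, h⟩
  else if h' : n.1 < 0 then conj (x ⟨-n, Int.neg_pos_of_neg h'⟩) else 0

lemma measurable_extend : Measurable extend := by
  refine measurable_pi_lambda _ fun n => ?_
  unfold extend
  split_ifs
  · exact measurable_pi_apply _
  · exact Complex.continuous_conj.measurable.comp (measurable_pi_apply _)
  · exact measurable_const

lemma extend_phase {ϑ : ℤ × ℤ → ℝ} (hϑ : ∀ n, ϑ (-n) = -ϑ n) (x : PosIndex → ℂ) (n : ℤ × ℤ) :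
    extend (fun k => Complex.exp (Complex.I * ϑ k) * x k) n
      = Complex.exp (Complex.I * ϑ n) * extend x n := by
  unfold extend
  split_ifs with h1 h2
  · rfl
  · rw [map_mul, ← Complex.exp_conj, hϑ]
    simp
  · simp

variable {Ω : Type*} [MeasurableSpace Ω] {P : Measure Ω} {s : ℝ}
  {lam : ℤ × ℤ → ℂ} {g : ℤ × ℤ → Ω → ℂ} {u₀ : Ω → Torus → ℝ}

/-- The family of the weighted random coefficients `|n|^s λ_n g_n`. -/
def data (s : ℝ) (lam : ℤ × ℤ → ℂ) (g : ℤ × ℤ → Ω → ℂ) (ω : Ω) (n : ℤ × ℤ) : ℂ :=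
  weight s n * (lam n * extend (fun k => g k ω) n)

/-- The sequence of the initial datum. -/
def randomSeq (s : ℝ) (lam : ℤ × ℤ → ℂ) (g : ℤ × ℤ → Ω → ℂ) (ω : Ω) : Seq :=
  assemble (data s lam g ω)

omit [MeasurableSpace Ω] in
lemma norm_randomSeq_le (ω : Ω) : ‖randomSeq s lam g ω‖ ≤ 1 := norm_assemble_le _

omit [MeasurableSpace Ω] in
lemma norm_randomSeq_apply_le (ω : Ω) (n : ℤ × ℤ) : ‖randomSeq s lam g ω n‖ ≤ 1 :=
  norm_assemble_apply_le _ n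

namespace IsRandomDatum

lemma extend_eq (h : IsRandomDatum P s lam g u₀) {n : ℤ × ℤ} (hn : n.1 ≠ 0) (ω : Ω) :
    extend (fun k => g k ω) n = g n ω := by
  unfold extend
  split_ifs with h1 h2
  · rfl
  · have := h.g_neg (-n) (by simpa using hn) ω
    rw [neg_neg] at this
    rw [this]
  · omega

lemma data_eq (h : IsRandomDatum P s lam g u₀) {n : ℤ × ℤ} (hn : n.1 ≠ 0) (ω : Ω) :
    data s lam g ω n = weight s n * (lam n * g n ω) := by
  rw [data, h.extend_eq hn]

lemma measurable_modes (h : IsRandomDatum P s lam g u₀) :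
    Measurable fun ω (k : PosIndex) => g k ω :=
  measurable_pi_lambda _ fun k => h.measurable k k.2

lemma measurable_data (h : IsRandomDatum P s lam g u₀) : Measurable (data s lam g) := by
  refine measurable_pi_lambda _ fun n => ?_
  exact (((measurable_pi_apply n).comp (measurable_extend.comp h.measurable_modes)).const_mul
    (lam n)).const_mul _

lemma stronglyMeasurable_randomSeq (h : IsRandomDatum P s lam g u₀) :
    StronglyMeasurable (randomSeq s lam g) :=
  stronglyMeasurable_assemble.comp_measurable h.measurable_data

variable [IsProbabilityMeasure P]

omit [IsProbabilityMeasure P] in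
-- By independence both joint laws are product measures, and their marginals agree by rotation
-- invariance. Different modes may thus be rotated by different angles.
lemma identDistrib_phase (h : IsRandomDatum P s lam g u₀) (ϑ : ℤ × ℤ → ℝ) :
    IdentDistrib (fun ω (k : PosIndex) => Complex.exp (Complex.I * ϑ k) * g k ω)
      (fun ω (k : PosIndex) => g k ω) P P := by
  have hm : ∀ k : PosIndex, Measurable fun ω => Complex.exp (Complex.I * ϑ k) * g k ω :=
    fun k => (h.measurable k k.2).const_mul _
  refine ⟨(measurable_pi_lambda _ hm).aemeasurable, h.measurable_modes.aemeasurable, ?_⟩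
  have h1 : iIndepFun (fun (k : PosIndex) ω => Complex.exp (Complex.I * ϑ k) * g k ω) P :=
    h.indep.comp (fun k z => Complex.exp (Complex.I * ϑ k) * z) fun k => measurable_id.const_mul _
  rw [h1.map_fun_eq_infinitePi_map hm,
    h.indep.map_fun_eq_infinitePi_map fun k : PosIndex => h.measurable k k.2]
  congr 1
  funext k
  exact (h.rotation k k.2 (ϑ k)).map_eq

omit [IsProbabilityMeasure P] in
/-- The law of the random coefficients is invariant under odd phases. -/
lemma integral_phase (h : IsRandomDatum P s lam g u₀) {ϑ : ℤ × ℤ → ℝ} (hϑ : ∀ n, ϑ (-n) = -ϑ n)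
    {q : (ℤ × ℤ → ℂ) → ℂ} (hq : Measurable q) :
    ∫ ω, q (fun n => Complex.exp (Complex.I * ϑ n) * data s lam g ω n) ∂P
      = ∫ ω, q (data s lam g ω) ∂P := by
  have hu : Measurable fun x : PosIndex → ℂ => q fun n => weight s n * (lam n * extend x n) :=
    hq.comp (measurable_pi_lambda _ fun n =>
      (((measurable_pi_apply n).comp measurable_extend).const_mul (lam n)).const_mul _)
  have h1 := ((h.identDistrib_phase ϑ).comp hu).integral_eq
  rw [Function.comp_def, Function.comp_def] at h1
  refine Eq.trans (integral_congr_ae (Eventually.of_forall fun ω => ?_)) h1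
  simp only [extend_phase hϑ, data]
  congr 1
  funext n
  ring

omit [IsProbabilityMeasure P] in
/-- An observable that changes sign under an odd phase has mean zero. -/
lemma integral_eq_zero_of_phase (h : IsRandomDatum P s lam g u₀) {ϑ : ℤ × ℤ → ℝ}
    (hϑ : ∀ n, ϑ (-n) = -ϑ n) {q : (ℤ × ℤ → ℂ) → ℂ} (hq : Measurable q)
    (hodd : ∀ c, q (fun n => Complex.exp (Complex.I * ϑ n) * c n) = -q c) :
    ∫ ω, q (data s lam g ω) ∂P = 0 := by
  have h1 := h.integral_phase hϑ hq
  simp only [hodd, integral_neg] at h1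
  exact self_eq_neg.1 h1.symm

/-- Odd observables have mean zero. -/
lemma integral_eq_zero_of_odd (h : IsRandomDatum P s lam g u₀) {q : Seq → ℂ} (hq : Continuous q)
    (hodd : ∀ a, q (-a) = -q a) : ∫ ω, q (randomSeq s lam g ω) ∂P = 0 := by
  -- The phase must be odd to respect the conjugation symmetry, hence π and -π on opposite half
  -- planes; both act as multiplication by -1.
  refine h.integral_eq_zero_of_phase (ϑ := fun n => if 0 < n.1 then Real.pi else
    if n.1 < 0 then -Real.pi else 0) (q := fun c => q (assemble c)) (fun n => ?_)
    (hq.comp_stronglyMeasurable stronglyMeasurable_assemble).measurable fun c => ?_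
  · have e : (-n).1 = -n.1 := rfl
    simp only [e]
    split_ifs <;> first | omega | simp
  · rw [← hodd]
    congr 1
    ext n
    rw [assemble_phase fun n => norm_exp_I_mul _]
    simp only [lp.coeFn_neg, Pi.neg_apply]
    by_cases hn : n.1 = 0
    · simp [assemble_zero_mode c hn]
    · have : Complex.exp (Complex.I * (Real.pi : ℂ)) = -1 := by
        rw [mul_comm, Complex.exp_pi_mul_I]
      have h2 : Complex.exp (Complex.I * (-(Real.pi : ℂ))) = -1 := by
        rw [mul_neg, Complex.exp_neg, this]; norm_num
      rcases lt_or_gt_of_ne hn with h1 | h1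
      · rw [if_neg (by omega), if_pos h1, Complex.ofReal_neg, h2, neg_one_mul]
      · rw [if_pos h1, this, neg_one_mul]

/-- The signed indicator function of `{j, -j}`. -/
def _root_.KPII.sgnIndicator (j n : ℤ × ℤ) : ℤ := (if n = j then 1 else 0) - (if n = -j then 1 else 0)

lemma _root_.KPII.sgnIndicator_neg (j n : ℤ × ℤ) : sgnIndicator j (-n) = -sgnIndicator j n := by
  unfold sgnIndicator
  simp only [neg_eq_iff_eq_neg, neg_neg]
  ring

/-- Rotating the single mode j by an angle θ multiplies the product by e^{iNθ}, where N counts the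
occurrences of j minus those of -j. If N ≠ 0, the angle π/N changes the sign of the product. -/
lemma integral_four_eq_zero (h : IsRandomDatum P s lam g u₀) {k l m p : ℤ × ℤ} (j : ℤ × ℤ)
    (hj : sgnIndicator j k + sgnIndicator j l + sgnIndicator j m + sgnIndicator j p ≠ 0) :
    ∫ ω, randomSeq s lam g ω k * randomSeq s lam g ω l * randomSeq s lam g ω m
      * randomSeq s lam g ω p ∂P = 0 := by
  set N := sgnIndicator j k + sgnIndicator j l + sgnIndicator j m + sgnIndicator j p with hN
  have hN' : (N : ℝ) ≠ 0 := by exact_mod_cast hj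
  refine h.integral_eq_zero_of_phase (ϑ := fun n => sgnIndicator j n * (Real.pi / N))
    (q := fun c => assemble c k * assemble c l * assemble c m * assemble c p) (fun n => ?_)
    ?_ fun c => ?_
  · rw [sgnIndicator_neg]; push_cast; ring
  · have hm : ∀ n, Measurable fun c => assemble c n := fun n =>
      ((continuous_eval n).comp_stronglyMeasurable stronglyMeasurable_assemble).measurable
    exact (((hm k).mul (hm l)).mul (hm m)).mul (hm p)
  · simp only [assemble_phase (fun n => norm_exp_I_mul _)]
    have e : Complex.exp (Complex.I * ((sgnIndicator j k * (Real.pi / N) : ℝ) : ℂ))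
        * Complex.exp (Complex.I * ((sgnIndicator j l * (Real.pi / N) : ℝ) : ℂ))
        * Complex.exp (Complex.I * ((sgnIndicator j m * (Real.pi / N) : ℝ) : ℂ))
        * Complex.exp (Complex.I * ((sgnIndicator j p * (Real.pi / N) : ℝ) : ℂ)) = -1 := by
      rw [← Complex.exp_add, ← Complex.exp_add, ← Complex.exp_add, ← Complex.exp_pi_mul_I]
      congr 1
      rw [← mul_add, ← mul_add, ← mul_add, ← Complex.ofReal_add, ← Complex.ofReal_add,
        ← Complex.ofReal_add, mul_comm]
      congr 2
      rw [← add_mul, ← add_mul, ← add_mul]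
      have : (sgnIndicator j k + sgnIndicator j l + sgnIndicator j m + sgnIndicator j p : ℝ) = N := by
        rw [hN]; push_cast; ring
      rw [this]
      field_simp
    linear_combination (assemble c k * assemble c l * assemble c m * assemble c p) * e

/-- Since the first component of k + l is nonzero, k and l cannot cancel each other and must be
matched by m and p. If one of them is matched, the other serves as the rotated mode; if neither is,
k does. -/
lemma integral_four_eq_zero_of_not_pair (h : IsRandomDatum P s lam g u₀) {k l m p : ℤ × ℤ}
    (hk : k.1 ≠ 0) (hl : l.1 ≠ 0) (hkl : (k + l).1 ≠ 0) (h1 : ¬(k = -m ∧ l = -p))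
    (h2 : ¬(k = -p ∧ l = -m)) :
    ∫ ω, randomSeq s lam g ω k * randomSeq s lam g ω l * randomSeq s lam g ω m
      * randomSeq s lam g ω p ∂P = 0 := by
  have hself : ∀ j : ℤ × ℤ, j.1 ≠ 0 → j ≠ -j := fun j hj e => by
    have := congrArg Prod.fst e
    simp only [Prod.fst_neg] at this
    omega
  have hlk : l ≠ -k := fun e => hkl (by rw [e]; simp)
  have hkl' : k ≠ -l := fun e => hkl (by rw [e]; simp)
  have hk' := hself k hk
  have hl' := hself l hl
  have key : ∀ j n : ℤ × ℤ, j.1 ≠ 0 → n ≠ -j → 0 ≤ sgnIndicator j n := fun j n _ hn => by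
    unfold sgnIndicator
    rw [if_neg hn]
    split_ifs <;> norm_num
  have hself' : ∀ j : ℤ × ℤ, j.1 ≠ 0 → sgnIndicator j j = 1 := fun j hj => by
    unfold sgnIndicator
    rw [if_pos rfl, if_neg (hself j hj)]; norm_num
  have hpair : ∀ m p : ℤ × ℤ, k = -m → l ≠ -p → sgnIndicator l k + sgnIndicator l l
      + sgnIndicator l m + sgnIndicator l p ≠ 0 := fun m p e1 e2 => by
    have e3 : m = -k := by rw [e1, neg_neg]
    rw [e3, sgnIndicator_neg, hself' l hl]
    have := key l p hl fun e => e2 (by rw [e, neg_neg])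
    omega
  by_cases hm : k = -m
  · exact h.integral_four_eq_zero l (hpair m p hm fun e => h1 ⟨hm, e⟩)
  by_cases hp : k = -p
  · refine h.integral_four_eq_zero l ?_
    have := hpair p m hp fun e => h2 ⟨hp, e⟩
    omega
  · refine h.integral_four_eq_zero k ?_
    have a1 := key k l hk hlk
    have a2 := key k m hk fun e => hm (by rw [e, neg_neg])
    have a3 := key k p hk fun e => hp (by rw [e, neg_neg])
    rw [hself' k hk]
    omega

end IsRandomDatum

end RandomData

/-! ### Fourth moments of the datum and the mean of the quartic form. -/

section Moments

variable {Ω : Type*} [MeasurableSpace Ω] {P : Measure Ω} {s : ℝ}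
  {lam : ℤ × ℤ → ℂ} {g : ℤ × ℤ → Ω → ℂ} {u₀ : Ω → Torus → ℝ}

namespace IsRandomDatum

lemma ae_hsNorm_le_one (h : IsRandomDatum P s lam g u₀) : ∀ᵐ ω ∂P, hsNorm s (u₀ ω) ≤ 1 := by
  have h1 := h.norm_eq_one
  rw [eLpNorm_exponent_top] at h1
  filter_upwards [ae_le_eLpNormEssSup (f := fun ω => hsNorm s (u₀ ω)) (μ := P)] with ω hω
  rw [h1, Real.enorm_eq_ofReal (show 0 ≤ hsNorm s (u₀ ω) from Real.sqrt_nonneg _)] at hω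
  simpa using hω

/-- Almost surely the family of coefficients lies in the unit ball, so the default value in
`assemble` occurs only on a null set and the measurable model agrees with the datum. -/
lemma ae_mem_unitData (h : IsRandomDatum P s lam g u₀) :
    ∀ᵐ ω ∂P, data s lam g ω ∈ unitData ∧ randomSeq s lam g ω = toSeq s (u₀ ω) := by
  filter_upwards [h.memHs, h.coeff_eq, h.ae_hsNorm_le_one] with ω h1 h2 h3
  have e : ∀ n, cutoff (data s lam g ω) n = toSeq s (u₀ ω) n := fun n => by
    by_cases hn : n.1 = 0
    · rw [h1.toSeq_zero_mode hn, cutoff, if_pos hn]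
    · rw [cutoff_of_ne hn, h.data_eq hn, h1.toSeq_apply, h2 n hn]
  have hmem : data s lam g ω ∈ unitData := fun F => by
    simp only [e]
    refine ((toSeq s (u₀ ω)).hasSum_norm_sq.summable.sum_le_tsum F fun _ _ => sq_nonneg _).trans ?_
    rw [(toSeq s (u₀ ω)).hasSum_norm_sq.tsum_eq, h1.norm_toSeq]
    exact pow_le_one₀ (Real.sqrt_nonneg _) h3
  refine ⟨hmem, ?_⟩
  ext n
  rw [randomSeq, assemble_apply hmem, e]

lemma ae_randomSeq_apply (h : IsRandomDatum P s lam g u₀) :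
    ∀ᵐ ω ∂P, ∀ n : ℤ × ℤ, n.1 ≠ 0 →
      randomSeq s lam g ω n = weight s n * (lam n * g n ω) := by
  filter_upwards [h.ae_mem_unitData] with ω hω n hn
  rw [randomSeq, assemble_apply hω.1, cutoff_of_ne hn, h.data_eq hn]

lemma norm_g_neg (h : IsRandomDatum P s lam g u₀) {n : ℤ × ℤ} (hn : n.1 ≠ 0) (ω : Ω) :
    ‖g (-n) ω‖ = ‖g n ω‖ := by
  rw [h.g_neg n hn, RCLike.norm_conj]

lemma exists_pos (h : IsRandomDatum P s lam g u₀) {n : ℤ × ℤ} (hn : n.1 ≠ 0) :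
    ∃ n' : PosIndex, (n'.1 = n ∨ n'.1 = -n) ∧ ∀ ω, ‖g n ω‖ = ‖g n' ω‖ := by
  rcases lt_or_gt_of_ne hn with h1 | h1
  · exact ⟨⟨-n, Int.neg_pos_of_neg h1⟩, Or.inr rfl, fun ω => (h.norm_g_neg hn ω).symm⟩
  · exact ⟨⟨n, h1⟩, Or.inl rfl, fun ω => rfl⟩

/-- The absolute moments of the random variables agree. -/
lemma integral_norm_pow_eq (h : IsRandomDatum P s lam g u₀) {n m : ℤ × ℤ} (hn : n.1 ≠ 0)
    (hm : m.1 ≠ 0) (j : ℕ) : ∫ ω, ‖g n ω‖ ^ j ∂P = ∫ ω, ‖g m ω‖ ^ j ∂P := by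
  obtain ⟨n', -, en⟩ := h.exists_pos hn
  obtain ⟨m', -, em⟩ := h.exists_pos hm
  simp only [en, em]
  exact ((h.identDistrib n' m' n'.2 m'.2).comp (measurable_norm.pow_const j)).integral_eq

/-- Independence is available for positive indices only. As |g_{-n}| = |g_n|, each index may be
replaced by its positive representative, and these are distinct precisely because m ≠ ±p. -/
lemma integral_norm_sq_mul (h : IsRandomDatum P s lam g u₀) {m p : ℤ × ℤ} (hm : m.1 ≠ 0)
    (hp : p.1 ≠ 0) (h1 : m ≠ p) (h2 : m ≠ -p) :
    ∫ ω, ‖g m ω‖ ^ 2 * ‖g p ω‖ ^ 2 ∂P = (∫ ω, ‖g m ω‖ ^ 2 ∂P) * ∫ ω, ‖g p ω‖ ^ 2 ∂P := by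
  obtain ⟨m', dm, em⟩ := h.exists_pos hm
  obtain ⟨p', dp, ep⟩ := h.exists_pos hp
  have hne : m' ≠ p' := fun e => by
    rcases dm with dm | dm <;> rcases dp with dp | dp <;> rw [e, dp] at dm
    · exact h1 dm.symm
    · exact h2 dm.symm
    · exact h2 (by rw [dm, neg_neg])
    · exact h1 (neg_inj.1 dm).symm
  simp only [em, ep]
  have hmeas : Measurable fun z : ℂ => ‖z‖ ^ 2 := measurable_norm.pow_const 2
  exact ((h.indep.indepFun hne).comp hmeas hmeas).integral_fun_mul_eq_mul_integral
    (hmeas.comp (h.measurable m' m'.2)).aestronglyMeasurable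
    (hmeas.comp (h.measurable p' p'.2)).aestronglyMeasurable

end IsRandomDatum

/-- The moment `E(|λ_m g_m λ_p g_p|²)`. -/
def pairMoment (P : Measure Ω) (lam : ℤ × ℤ → ℂ) (g : ℤ × ℤ → Ω → ℂ) (m p : ℤ × ℤ) : ℝ :=
  if m = p then ‖lam m‖ ^ 4 * ∫ ω, ‖g m ω‖ ^ 4 ∂P
  else ‖lam m‖ ^ 2 * ‖lam p‖ ^ 2 * (∫ ω, ‖g m ω‖ ^ 2 ∂P) ^ 2

namespace IsRandomDatum

lemma integral_pair (h : IsRandomDatum P s lam g u₀) {m p : ℤ × ℤ} (hm : m.1 ≠ 0)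
    (hp : p.1 ≠ 0) (hmp : m ≠ -p) :
    ∫ ω, randomSeq s lam g ω (-m) * randomSeq s lam g ω (-p) * randomSeq s lam g ω m
      * randomSeq s lam g ω p ∂P
      = ((weight s m ^ 2 * weight s p ^ 2 * pairMoment P lam g m p : ℝ) : ℂ) := by
  have e : ∀ᵐ ω ∂P, randomSeq s lam g ω (-m) * randomSeq s lam g ω (-p) * randomSeq s lam g ω m
      * randomSeq s lam g ω p = ((weight s m ^ 2 * weight s p ^ 2 * (‖lam m‖ ^ 2 * ‖lam p‖ ^ 2
        * (‖g m ω‖ ^ 2 * ‖g p ω‖ ^ 2)) : ℝ) : ℂ) := by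
    filter_upwards [h.ae_randomSeq_apply] with ω hω
    have key : ∀ n : ℤ × ℤ, n.1 ≠ 0 → randomSeq s lam g ω (-n) * randomSeq s lam g ω n
        = ((weight s n ^ 2 * (‖lam n‖ ^ 2 * ‖g n ω‖ ^ 2) : ℝ) : ℂ) := fun n hn => by
      rw [hω n hn, hω (-n) (by simpa using hn), h.lam_neg n hn, h.g_neg n hn, weight_neg]
      push_cast
      rw [← Complex.conj_mul', ← Complex.conj_mul']
      ring
    calc _ = (randomSeq s lam g ω (-m) * randomSeq s lam g ω m)
          * (randomSeq s lam g ω (-p) * randomSeq s lam g ω p) := by ring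
      _ = _ := by rw [key m hm, key p hp]; push_cast; ring
  rw [integral_congr_ae e, integral_complex_ofReal]
  congr 1
  rw [integral_const_mul, integral_const_mul, pairMoment]
  split_ifs with hc
  · subst hc
    congr 1
    rw [← pow_add]
    congr 1
    refine integral_congr_ae (Eventually.of_forall fun ω => ?_)
    simp only [← pow_add]
  · rw [h.integral_norm_sq_mul hm hp hc hmp, h.integral_norm_pow_eq hp hm, sq (∫ ω, ‖g m ω‖ ^ 2 ∂P)]

variable [IsProbabilityMeasure P]

lemma integrable_continuous (h : IsRandomDatum P s lam g u₀) {q : Seq → ℂ} (hq : Continuous q)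
    {C : ℝ} (hC : ∀ a, ‖a‖ ≤ 1 → ‖q a‖ ≤ C) : Integrable (fun ω => q (randomSeq s lam g ω)) P :=
  Integrable.of_bound (hq.comp_stronglyMeasurable h.stronglyMeasurable_randomSeq).aestronglyMeasurable
    C (Eventually.of_forall fun ω => hC _ (norm_randomSeq_le ω))

variable [hs : Fact (1 < s)]

/-- The expectation of the quartic form as a sum over the interactions. -/
lemma hasSum_integral_quartic (h : IsRandomDatum P s lam g u₀) (n m p : ℤ × ℤ) (t : ℝ) :
    HasSum (fun k => kerNL t k (n - k) * ratio s k (n - k)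
      * ∫ ω, randomSeq s lam g ω k * randomSeq s lam g ω (n - k) * randomSeq s lam g ω m
        * randomSeq s lam g ω p ∂P)
      (∫ ω, quartic s n m p t (randomSeq s lam g ω) ∂P) := by
  have hK := one_le_convConst s
  set V := randomSeq s lam g with hV
  let F : ℤ × ℤ → Ω → ℂ := fun k ω => convTerm s (kerNL t) (V ω) (V ω) n k * V ω m * V ω p
  have hF : ∀ k ω, F k ω = kerNL t k (n - k) * ratio s k (n - k)
      * (V ω k * V ω (n - k) * V ω m * V ω p) := fun k ω => by
    simp only [F, convTerm]; ring
  have hint : ∀ k, Integrable (F k) P := fun k => by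
    refine h.integrable_continuous (q := fun a => convTerm s (kerNL t) a a n k * a m * a p)
      (C := convConst s) ?_ fun a ha => ?_
    · have e := continuous_eval
      exact ((continuous_const.mul ((e k).mul (e (n - k)))).mul (e m)).mul (e p)
    · have h1 : ‖convTerm s (kerNL t) a a n k‖ ≤ convConst s * 1 * 1 :=
        ((summable_convTerm hs.out (kerNL t).2 a a n).1.le_tsum k fun _ _ => norm_nonneg _).trans
          ((tsum_norm_convTerm_le _ _ _ _).trans (by gcongr))
      rw [norm_mul, norm_mul]
      calc _ ≤ convConst s * 1 * 1 * 1 * 1 := by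
            gcongr
            · exact (a.norm_apply_le m).trans ha
            · exact (a.norm_apply_le p).trans ha
        _ = _ := by ring
  have hle : ∀ k ω, ‖F k ω‖ ≤ ‖convTerm s (kerNL t) (V ω) (V ω) n k‖ := fun k ω => by
    simp only [F, norm_mul]
    calc _ ≤ ‖convTerm s (kerNL t) (V ω) (V ω) n k‖ * 1 * 1 := by
          gcongr
          · exact norm_randomSeq_apply_le ω m
          · exact norm_randomSeq_apply_le ω p
      _ = _ := by ring
  -- Finite sums are bounded before taking the expectation, by the absolute convergence of the
  -- convolution in each realisation.
  have hsum : Summable fun k => ∫ ω, ‖F k ω‖ ∂P := by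
    refine summable_of_sum_le (c := convConst s)
      (fun k => integral_nonneg fun ω => norm_nonneg _) fun U => ?_
    rw [← integral_finsetSum _ fun k _ => (hint k).norm]
    have : ∀ ω, ∑ k ∈ U, ‖F k ω‖ ≤ convConst s := fun ω => by
      calc _ ≤ ∑ k ∈ U, ‖convTerm s (kerNL t) (V ω) (V ω) n k‖ := Finset.sum_le_sum fun k _ => hle k ω
        _ ≤ ∑' k, ‖convTerm s (kerNL t) (V ω) (V ω) n k‖ :=
            (summable_convTerm hs.out (kerNL t).2 _ _ n).1.sum_le_tsum U fun _ _ => norm_nonneg _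
        _ ≤ convConst s * ‖V ω‖ * ‖V ω‖ := tsum_norm_convTerm_le _ _ _ _
        _ ≤ convConst s * 1 * 1 := by
            have := norm_randomSeq_le (s := s) (lam := lam) (g := g) ω
            gcongr
        _ = _ := by ring
    calc _ ≤ ∫ ω, convConst s ∂P := integral_mono (integrable_finsetSum _ fun k _ => (hint k).norm)
            (integrable_const _) this
      _ = _ := by simp
  have key := hasSum_integral_of_summable_integral_norm hint hsum
  have e1 : ∀ ω, ∑' k, F k ω = quartic s n m p t (V ω) := fun ω =>
    (((hasSum_conv (kerNL t) (V ω) (V ω) n).mul_right (V ω m)).mul_right (V ω p)).tsum_eq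
  have e2 : ∀ k, ∫ ω, F k ω ∂P = kerNL t k (n - k) * ratio s k (n - k)
      * ∫ ω, V ω k * V ω (n - k) * V ω m * V ω p ∂P := fun k => by
    simp only [hF]
    exact integral_const_mul _ _
  simpa only [e1, e2] using key

lemma _root_.KPII.kerNL_of_not_good (t : ℝ) {k l : ℤ × ℤ} (hg : ¬Good k l) : kerNL t k l = 0 := by
  change symb (fun _ _ => 1) t k l = 0
  exact if_neg hg

lemma _root_.KPII.kerNL_of_good (t : ℝ) {k l : ℤ × ℤ} (hg : Good k l) :
    kerNL t k l = Complex.exp (Complex.I * ((res k l * t : ℝ) : ℂ)) := by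
  change symb (fun _ _ => 1) t k l = _
  rw [symb, if_pos hg]; simp

/-- A surviving pairing would force n = k + (n - k) = -m - p. -/
lemma integral_quartic_of_ne (h : IsRandomDatum P s lam g u₀) {n m p : ℤ × ℤ}
    (hnmp : n + m + p ≠ 0) (t : ℝ) : ∫ ω, quartic s n m p t (randomSeq s lam g ω) ∂P = 0 := by
  refine (h.hasSum_integral_quartic n m p t).unique ?_
  convert! hasSum_zero using 1
  funext k
  by_cases hg : Good k (n - k)
  · rw [h.integral_four_eq_zero_of_not_pair hg.1 hg.2.1 hg.2.2, mul_zero]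
    · rintro ⟨h1, h2⟩
      refine hnmp ?_
      rw [sub_eq_iff_eq_add.1 h2, h1]; abel
    · rintro ⟨h1, h2⟩
      refine hnmp ?_
      rw [sub_eq_iff_eq_add.1 h2, h1]; abel
  · rw [kerNL_of_not_good t hg]; simp

/-- Only the splittings k = -m and k = -p of n contribute. They coincide when m = p, whence the
factor 1 instead of 2; the ratio of weights leaves one power of each of the three weights. -/
lemma integral_quartic (h : IsRandomDatum P s lam g u₀) {n m p : ℤ × ℤ} (hn : n.1 ≠ 0)
    (hm : m.1 ≠ 0) (hp : p.1 ≠ 0) (hnmp : n + m + p = 0) (t : ℝ) :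
    ∫ ω, quartic s n m p t (randomSeq s lam g ω) ∂P
      = ((weight s n * weight s m * weight s p : ℝ) : ℂ)
        * Complex.exp (Complex.I * ((-(omega n + omega m + omega p) * t : ℝ) : ℂ))
        * (((if m = p then 1 else 2) * pairMoment P lam g m p : ℝ) : ℂ) := by
  have en : n = -m + -p := by rw [← sub_eq_zero, ← hnmp]; abel
  have hne : m ≠ -p := fun e => hn (by rw [en, e]; simp)
  have hgood : ∀ m p : ℤ × ℤ, m.1 ≠ 0 → p.1 ≠ 0 → n = -m + -p → Good (-m) (-p) :=
    fun m p hm hp en => ⟨by simpa using hm, by simpa using hp, en ▸ hn⟩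
  have hval : ∀ m p : ℤ × ℤ, m.1 ≠ 0 → p.1 ≠ 0 → n = -m + -p →
      kerNL t (-m) (-p) * ratio s (-m) (-p) * ((weight s m ^ 2 * weight s p ^ 2
        * pairMoment P lam g m p : ℝ) : ℂ) = ((weight s n * weight s m * weight s p : ℝ) : ℂ)
        * Complex.exp (Complex.I * ((-(omega n + omega m + omega p) * t : ℝ) : ℂ))
        * ((pairMoment P lam g m p : ℝ) : ℂ) := fun m p hm hp en => by
    have e1 : res (-m) (-p) = -(omega n + omega m + omega p) := by
      rw [res, ← en, omega_neg, omega_neg]; ring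
    have e2 : ratio s (-m) (-p) * (weight s m ^ 2 * weight s p ^ 2 * pairMoment P lam g m p)
        = weight s n * weight s m * weight s p * pairMoment P lam g m p := by
      have := (weight_pos s m).ne'
      have := (weight_pos s p).ne'
      rw [ratio, ← en, weight_neg, weight_neg]
      field_simp
    rw [kerNL_of_good t (hgood m p hm hp en), e1, mul_assoc, ← Complex.ofReal_mul, e2]
    push_cast; ring
  have hsym : pairMoment P lam g p m = pairMoment P lam g m p := by
    unfold pairMoment
    by_cases hc : m = p
    · rw [hc]
    · rw [if_neg hc, if_neg (Ne.symm hc), h.integral_norm_pow_eq hp hm]; ring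
  have hn1 : n - -m = -p := by rw [en]; abel
  have hn2 : n - -p = -m := by rw [en]; abel
  have hz : ∀ k ∉ ({-m, -p} : Finset (ℤ × ℤ)), kerNL t k (n - k) * ratio s k (n - k)
      * ∫ ω, randomSeq s lam g ω k * randomSeq s lam g ω (n - k) * randomSeq s lam g ω m
        * randomSeq s lam g ω p ∂P = 0 := fun k hk => by
    simp only [Finset.mem_insert, Finset.mem_singleton, not_or] at hk
    by_cases hg : Good k (n - k)
    · rw [h.integral_four_eq_zero_of_not_pair hg.1 hg.2.1 hg.2.2 (fun e => hk.1 e.1)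
        (fun e => hk.2 e.1), mul_zero]
    · rw [kerNL_of_not_good t hg]; simp
  rw [(h.hasSum_integral_quartic n m p t).unique (hasSum_sum_of_ne_finset_zero hz)]
  have f1 := hval m p hm hp en
  rw [← h.integral_pair hm hp hne] at f1
  by_cases hc : m = p
  · have : ({-m, -p} : Finset (ℤ × ℤ)) = {-m} := by rw [hc]; simp
    rw [this, Finset.sum_singleton, hn1, f1, if_pos hc, one_mul]
  · have f2 := hval p m hp hm (by rw [en, add_comm])
    rw [← h.integral_pair hp hm fun e => hne (by rw [e, neg_neg])] at f2
    have e : ∀ ω, randomSeq s lam g ω (-p) * randomSeq s lam g ω (-m) * randomSeq s lam g ω m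
        * randomSeq s lam g ω p = randomSeq s lam g ω (-p) * randomSeq s lam g ω (-m)
          * randomSeq s lam g ω p * randomSeq s lam g ω m := fun ω => by ring
    rw [Finset.sum_pair (fun e => hc (neg_inj.1 e)), hn1, hn2, f1]
    simp only [e]
    rw [f2, if_neg hc, hsym]
    have e3 : omega n + omega p + omega m = omega n + omega m + omega p := by ring
    rw [e3]
    push_cast; ring

end IsRandomDatum

end Moments

/-! ### The differential equation for third moments and its comparison with the explicit first order
term. -/

section ThirdMoments

variable {s : ℝ} [hs : Fact (1 < s)]

lemma norm_quartic_le (n m p : ℤ × ℤ) (t : ℝ) {a : Seq} {M : ℝ} (ha : ‖a‖ ≤ M) :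
    ‖quartic s n m p t a‖ ≤ convConst s * M ^ 4 := by
  have hM : 0 ≤ M := (norm_nonneg _).trans ha
  have hK := one_le_convConst s
  rw [quartic, norm_mul, norm_mul]
  calc _ ≤ convConst s * M ^ 2 * M * M := by
        gcongr
        · exact (Seq.norm_apply_le _ n).trans (norm_conv_self_le _ ha)
        · exact (a.norm_apply_le m).trans ha
        · exact (a.norm_apply_le p).trans ha
    _ = _ := by ring

lemma norm_quinticTerm_le_of_norm_le_one (n m p : ℤ × ℤ) (t : ℝ) {a : Seq} (ha : ‖a‖ ≤ 1) :
    ‖quinticTerm s n m p t a‖ ≤ 4 * convConst s ^ 2 := by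
  have hK := one_le_convConst s
  have h1 := norm_firstOrder_le (s := s) t ha
  have h2 := norm_quadFirstOrder_le (s := s) t ha
  have h3 : ‖quad s t a‖ ≤ convConst s * 1 ^ 2 := norm_conv_self_le _ ha
  have e : ∀ (x : Seq) k, ‖x k‖ ≤ ‖x‖ := Seq.norm_apply_le
  have b1 : ‖quadFirstOrder s t a n * a m * a p‖ ≤ 2 * convConst s ^ 2 * 1 * 1 := by
    rw [norm_mul, norm_mul]
    gcongr
    · exact (e _ _).trans h2
    · exact (e _ _).trans ha
    · exact (e _ _).trans ha
  have b2 : ‖quad s t a n * firstOrder s t a m * a p‖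
      ≤ convConst s * 1 ^ 2 * convConst s * 1 := by
    rw [norm_mul, norm_mul]
    gcongr
    · exact (e _ _).trans h3
    · exact (e _ _).trans h1
    · exact (e _ _).trans ha
  have b3 : ‖quad s t a n * a m * firstOrder s t a p‖
      ≤ convConst s * 1 ^ 2 * 1 * convConst s := by
    rw [norm_mul, norm_mul]
    gcongr
    · exact (e _ _).trans h3
    · exact (e _ _).trans ha
    · exact (e _ _).trans h1
  calc _ ≤ 2 * convConst s ^ 2 * 1 * 1 + convConst s * 1 ^ 2 * convConst s * 1
        + convConst s * 1 ^ 2 * 1 * convConst s :=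
        (norm_add_le _ _).trans (add_le_add ((norm_add_le _ _).trans (add_le_add b1 b2)) b3)
    _ = _ := by ring

variable {Ω : Type*} [MeasurableSpace Ω] {P : Measure Ω} [IsProbabilityMeasure P]
  {lam : ℤ × ℤ → ℂ} {g : ℤ × ℤ → Ω → ℂ} {u₀ : Ω → Torus → ℝ}

variable (s) in
/-- The solution in the interaction representation with the random initial datum. -/
def randomFlow (ε : ℝ) (lam : ℤ × ℤ → ℂ) (g : ℤ × ℤ → Ω → ℂ) (ω : Ω) : ℝ → Seq :=
  flow s ε (randomSeq s lam g ω)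

omit [MeasurableSpace Ω] in
lemma isMild_randomFlow {ε T : ℝ} (hS : Small s ε T) (ω : Ω) :
    IsMild s ε T (randomSeq s lam g ω) (randomFlow s ε lam g ω) :=
  isMild_flow_assemble hS _

/-- The third moment in the interaction representation. -/
def thirdMoment (P : Measure Ω) (s ε : ℝ) [Fact (1 < s)] (lam : ℤ × ℤ → ℂ) (g : ℤ × ℤ → Ω → ℂ)
    (n m p : ℤ × ℤ) (t : ℝ) : ℂ :=
  ∫ ω, randomFlow s ε lam g ω t n * randomFlow s ε lam g ω t m * randomFlow s ε lam g ω t p ∂P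

namespace IsRandomDatum

lemma integrable_comp_randomFlow (h : IsRandomDatum P s lam g u₀) {ε T : ℝ} (hS : Small s ε T)
    {t : ℝ} (ht : |t| ≤ T) {q : Seq → ℂ} (hq : Continuous q) {C : ℝ}
    (hC : ∀ a, ‖a‖ ≤ 2 → ‖q a‖ ≤ C) : Integrable (fun ω => q (randomFlow s ε lam g ω t)) P :=
  Integrable.of_bound (hq.comp_stronglyMeasurable
    ((stronglyMeasurable_flow hS ht).comp_measurable h.measurable_data)).aestronglyMeasurable
    C (Eventually.of_forall fun ω => hC _ ((isMild_randomFlow hS ω).norm_le hS (norm_randomSeq_le ω) ht))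

lemma integrable_triple (h : IsRandomDatum P s lam g u₀) {ε T : ℝ} (hS : Small s ε T)
    {t : ℝ} (ht : |t| ≤ T) (n m p : ℤ × ℤ) : Integrable (fun ω => randomFlow s ε lam g ω t n
      * randomFlow s ε lam g ω t m * randomFlow s ε lam g ω t p) P := by
  have e := continuous_eval
  refine h.integrable_comp_randomFlow hS ht (q := fun a => a n * a m * a p) (C := 2 * 2 * 2)
    (((e n).mul (e m)).mul (e p)) fun a ha => ?_
  rw [norm_mul, norm_mul]
  gcongr <;> exact (a.norm_apply_le _).trans ha

lemma integrable_quartic (h : IsRandomDatum P s lam g u₀) {ε T : ℝ} (hS : Small s ε T)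
    {t : ℝ} (ht : |t| ≤ T) (n m p : ℤ × ℤ) :
    Integrable (fun ω => quartic s n m p t (randomFlow s ε lam g ω t)) P :=
  h.integrable_comp_randomFlow hS ht (continuous_quartic n m p t)
    fun _ ha => norm_quartic_le n m p t ha

/-- The a priori bound dominates the time derivative uniformly in the randomness, so one may
differentiate under the expectation. -/
lemma hasDerivAt_thirdMoment (h : IsRandomDatum P s lam g u₀) {ε T : ℝ} (hS : Small s ε T)
    {t : ℝ} (ht : |t| < T) {n m p : ℤ × ℤ} (hn : n.1 ≠ 0) (hm : m.1 ≠ 0) (hp : p.1 ≠ 0) :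
    HasDerivAt (thirdMoment P s ε lam g n m p)
      (-(Complex.I * (ε / 2)) * (n.1 * ∫ ω, quartic s n m p t (randomFlow s ε lam g ω t) ∂P
        + m.1 * ∫ ω, quartic s m p n t (randomFlow s ε lam g ω t) ∂P
        + p.1 * ∫ ω, quartic s p n m t (randomFlow s ε lam g ω t) ∂P)) t := by
  set a := randomFlow s ε lam g with ha
  have hi := fun n m p => h.integrable_quartic hS ht.le n m p
  let F' : ℝ → Ω → ℂ := fun τ ω => -(Complex.I * (ε / 2)) * (n.1 * quartic s n m p τ (a ω τ)
    + m.1 * quartic s m p n τ (a ω τ) + p.1 * quartic s p n m τ (a ω τ))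
  have hF' : Integrable (F' t) P :=
    ((((hi n m p).const_mul _).add ((hi m p n).const_mul _)).add ((hi p n m).const_mul _)).const_mul _
  have h1 := hasDerivAt_integral_of_dominated_loc_of_deriv_le (μ := P) (x₀ := t) (F' := F')
    (F := fun τ ω => a ω τ n * a ω τ m * a ω τ p) (s := Set.Ioo (-T) T)
    (bound := fun _ => ‖-(Complex.I * (ε / 2) : ℂ)‖ * (‖(n.1 : ℂ)‖ * (convConst s * 2 ^ 4)
      + ‖(m.1 : ℂ)‖ * (convConst s * 2 ^ 4) + ‖(p.1 : ℂ)‖ * (convConst s * 2 ^ 4)))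
    (Ioo_mem_nhds (abs_lt.1 ht).1 (abs_lt.1 ht).2) ?_
    (h.integrable_triple hS ht.le n m p) hF'.aestronglyMeasurable ?_ (integrable_const _) ?_
  · refine h1.2.congr_deriv ?_
    simp only [F']
    rw [integral_const_mul,
      integral_add (((hi n m p).const_mul _).fun_add ((hi m p n).const_mul _))
        ((hi p n m).const_mul _), integral_add ((hi n m p).const_mul _) ((hi m p n).const_mul _),
      integral_const_mul, integral_const_mul, integral_const_mul]
  · filter_upwards [eventually_abs_le ht] with τ hτ
    exact (h.integrable_triple hS hτ n m p).aestronglyMeasurable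
  · refine Eventually.of_forall fun ω τ hτ => ?_
    have hb : ‖a ω τ‖ ≤ 2 :=
      (isMild_randomFlow hS ω).norm_le hS (norm_randomSeq_le ω) (abs_le.2 ⟨hτ.1.le, hτ.2.le⟩)
    simp only [F']
    rw [norm_mul]
    gcongr
    refine (norm_add_le _ _).trans (add_le_add ((norm_add_le _ _).trans (add_le_add ?_ ?_)) ?_) <;>
    · rw [norm_mul]
      gcongr
      exact norm_quartic_le _ _ _ _ hb
  · exact Eventually.of_forall fun ω τ hτ =>
      (isMild_randomFlow hS ω).hasDerivAt_mul_mul (abs_lt.2 hτ) hn hm hp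

/-- The term of order ε in the expansion of the quartic form is odd in the datum and has mean zero;
only the error of order ε² is left. -/
lemma norm_integral_quartic_sub_le (h : IsRandomDatum P s lam g u₀) {ε T : ℝ} (hS : Small s ε T)
    {t : ℝ} (ht : |t| ≤ T) (n m p : ℤ × ℤ) :
    ‖∫ ω, quartic s n m p t (randomFlow s ε lam g ω t) ∂P
      - ∫ ω, quartic s n m p t (randomSeq s lam g ω) ∂P‖
      ≤ quarticConst s * (ε ^ 2 * (1 + |t|)) := by
  have h0 : ∫ ω, quinticTerm s n m p t (randomSeq s lam g ω) ∂P = 0 :=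
    h.integral_eq_zero_of_odd (continuous_quinticTerm n m p t) (quinticTerm_neg n m p t)
  have i1 := h.integrable_quartic hS ht n m p
  have i2 : Integrable (fun ω => quartic s n m p t (randomSeq s lam g ω)) P :=
    h.integrable_continuous (continuous_quartic n m p t) fun _ ha => norm_quartic_le n m p t ha
  have i3 : Integrable (fun ω => quinticTerm s n m p t (randomSeq s lam g ω)) P :=
    h.integrable_continuous (continuous_quinticTerm n m p t)
      fun _ ha => norm_quinticTerm_le_of_norm_le_one n m p t ha
  have e : ∫ ω, quartic s n m p t (randomFlow s ε lam g ω t) ∂P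
      - ∫ ω, quartic s n m p t (randomSeq s lam g ω) ∂P
      = ∫ ω, (quartic s n m p t (randomFlow s ε lam g ω t)
        - (quartic s n m p t (randomSeq s lam g ω)
          + ε * quinticTerm s n m p t (randomSeq s lam g ω))) ∂P := by
    rw [integral_sub i1 (i2.fun_add (i3.const_mul _)), integral_add i2 (i3.const_mul _),
      integral_const_mul, h0, mul_zero, add_zero]
  rw [e]
  have := norm_integral_le_of_norm_le_const (μ := P) (Eventually.of_forall fun ω =>
    (isMild_randomFlow (lam := lam) (g := g) hS ω).norm_quartic_sub_le hS (norm_randomSeq_le ω)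
      ht n m p)
  simpa using this

omit hs [IsProbabilityMeasure P] in
-- If m = p then n_1 = -2m_1, which is how the diagonal fourth moment becomes a correction with the
-- factor m_1 and the opposite sign. The index k is free because all modes have the same absolute
-- moments.
lemma half_mul_pairMoment (h : IsRandomDatum P s lam g u₀) {n m p k : ℤ × ℤ} (hm : m.1 ≠ 0)
    (hk : k.1 ≠ 0) (hnmp : n + m + p = 0) :
    (n.1 : ℝ) * ((if m = p then 1 else 2) * pairMoment P lam g m p)
      = 2 * ((∫ ω, ‖g k ω‖ ^ 2 ∂P) ^ 2 * (n.1 * ‖lam m‖ ^ 2 * ‖lam p‖ ^ 2)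
        - ((∫ ω, ‖g k ω‖ ^ 4 ∂P) - 2 * (∫ ω, ‖g k ω‖ ^ 2 ∂P) ^ 2)
          * (if m = p then (m.1 : ℝ) * ‖lam m‖ ^ 4 else 0)) := by
  rw [pairMoment, h.integral_norm_pow_eq hm hk 2, h.integral_norm_pow_eq hm hk 4]
  split_ifs with hc
  · subst hc
    have h1 := congrArg Prod.fst hnmp
    simp only [Prod.fst_add, Prod.fst_zero] at h1
    have h2 : (n.1 : ℝ) = -2 * m.1 := by
      have : n.1 = -2 * m.1 := by linarith
      rw [this]; push_cast; ring
    rw [h2]; ring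
  · ring

/-- The first order term of the third moment solves the averaged equation. -/
lemma hasDerivAt_momentTerm (h : IsRandomDatum P s lam g u₀) {n m p : ℤ × ℤ} (hn : n.1 ≠ 0)
    (hm : m.1 ≠ 0) (hp : p.1 ≠ 0) (t : ℝ) :
    HasDerivAt (fun τ => ((weight s n * weight s m * weight s p : ℝ) : ℂ)
        * Complex.exp (Complex.I * ((-(omega n + omega m + omega p) * τ : ℝ) : ℂ))
        * momentTerm P lam g n m p τ)
      (-(Complex.I / 2) * (n.1 * ∫ ω, quartic s n m p t (randomSeq s lam g ω) ∂P
        + m.1 * ∫ ω, quartic s m p n t (randomSeq s lam g ω) ∂P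
        + p.1 * ∫ ω, quartic s p n m t (randomSeq s lam g ω) ∂P)) t := by
  have c1 : m + p + n = n + m + p := by abel
  have c2 : p + n + m = n + m + p := by abel
  by_cases hnmp : n + m + p = 0
  · have w1 : omega m + omega p + omega n = omega n + omega m + omega p := by ring
    have w2 : omega p + omega n + omega m = omega n + omega m + omega p := by ring
    rw [h.integral_quartic hn hm hp hnmp, h.integral_quartic hm hp hn (c1.trans hnmp),
      h.integral_quartic hp hn hm (c2.trans hnmp), w1, w2]
    set W := omega n + omega m + omega p with hW
    -- For n + m + p = 0 the sum of the three frequencies is the value of the resonance function at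
    -- (n, m), hence nonzero.
    have hW0 : (W : ℂ) ≠ 0 := by
      have hp' : p = -(n + m) := by rw [eq_neg_iff_add_eq_zero, add_comm]; exact hnmp
      have hg : Good n m := ⟨hn, hm, fun e => hp (by rw [hp', Prod.fst_neg, e, neg_zero])⟩
      have : W = res n m := by rw [hW, hp', omega_neg, res]; ring
      rw [this]
      exact_mod_cast res_ne_zero hg
    have f1 := h.half_mul_pairMoment hm hn hnmp
    have f2 := h.half_mul_pairMoment hp hn (c1.trans hnmp)
    have f3 := h.half_mul_pairMoment (n := p) (p := m) hn hn (c2.trans hnmp)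
    simp only [momentTerm, if_pos hnmp]
    set B : ℝ := (∫ ω, ‖g n ω‖ ^ 2 ∂P) ^ 2
            * ((n.1 : ℝ) * ‖lam m‖ ^ 2 * ‖lam p‖ ^ 2
              + (m.1 : ℝ) * ‖lam p‖ ^ 2 * ‖lam n‖ ^ 2
              + (p.1 : ℝ) * ‖lam n‖ ^ 2 * ‖lam m‖ ^ 2)
          - ((∫ ω, ‖g n ω‖ ^ 4 ∂P) - 2 * (∫ ω, ‖g n ω‖ ^ 2 ∂P) ^ 2)
            * ((if m = p then (m.1 : ℝ) * ‖lam m‖ ^ 4 else 0)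
              + (if p = n then (p.1 : ℝ) * ‖lam p‖ ^ 4 else 0)
              + (if n = m then (n.1 : ℝ) * ‖lam n‖ ^ 4 else 0)) with hB
    have hsum : (n.1 : ℝ) * ((if m = p then 1 else 2) * pairMoment P lam g m p)
        + m.1 * ((if p = n then 1 else 2) * pairMoment P lam g p n)
        + p.1 * ((if n = m then 1 else 2) * pairMoment P lam g n m) = 2 * B := by
      rw [f1, f2, f3, hB]; ring
    generalize (if m = p then 1 else 2) * pairMoment P lam g m p = x₁ at hsum ⊢
    generalize (if p = n then 1 else 2) * pairMoment P lam g p n = x₂ at hsum ⊢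
    generalize (if n = m then 1 else 2) * pairMoment P lam g n m = x₃ at hsum ⊢
    have hsum' := congrArg (fun x : ℝ => (x : ℂ)) hsum
    simp only [Complex.ofReal_add, Complex.ofReal_mul, Complex.ofReal_intCast,
      Complex.ofReal_ofNat] at hsum'
    have hexp : HasDerivAt (fun τ : ℝ => Complex.exp (Complex.I * ((-W * τ : ℝ) : ℂ)))
        (-Complex.I * W * Complex.exp (Complex.I * ((-W * t : ℝ) : ℂ))) t := by
      have h1 : HasDerivAt (fun x : ℝ => Complex.I * ((-W * x : ℝ) : ℂ))
          (Complex.I * ((-W : ℝ) : ℂ)) t := by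
        have := ((hasDerivAt_id t).const_mul (-W)).ofReal_comp.const_mul Complex.I
        simpa using this
      refine h1.cexp.congr_deriv ?_
      push_cast; ring
    -- After multiplication by the phase the first order term is the weights times (e^{-iWτ} - 1)
    -- W⁻¹ B, a form that is readily differentiated.
    have h2 := (((hexp.sub_const 1).const_mul
      ((weight s n * weight s m * weight s p : ℝ) : ℂ)).mul_const ((W : ℂ)⁻¹ * (B : ℂ)))
    refine (h2.congr_deriv ?_).congr_of_eventuallyEq (Eventually.of_forall fun τ => ?_)
    · simp only [Complex.ofReal_mul]
      generalize Complex.exp (Complex.I * ((-W : ℝ) * t)) = E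
      linear_combination (-Complex.I * (weight s n * weight s m * weight s p) * E * B)
        * mul_inv_cancel₀ hW0
        + (Complex.I / 2 * (weight s n * weight s m * weight s p) * E) * hsum'
    · have e1 : Complex.exp (Complex.I * ((-W * τ : ℝ) : ℂ)) * Complex.exp (Complex.I * W * τ) = 1 := by
        rw [← Complex.exp_add]
        push_cast
        rw [show Complex.I * (-W * τ) + Complex.I * W * τ = (0 : ℂ) by ring, Complex.exp_zero]
      simp only [← hW, div_eq_mul_inv]
      linear_combination (-(((weight s n * weight s m * weight s p : ℝ) : ℂ)
        * (W : ℂ)⁻¹ * B)) * e1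
  · rw [h.integral_quartic_of_ne hnmp, h.integral_quartic_of_ne (by rwa [c1]),
      h.integral_quartic_of_ne (by rwa [c2])]
    simp only [momentTerm, if_neg hnmp, mul_zero, add_zero]
    exact hasDerivAt_const _ _

/-- Both quantities vanish at time zero, the third moment by oddness, and their derivatives are
compared on [-|t|, |t|]. Smallness is assumed up to 2|t| so that the endpoints are interior times,
where the derivatives are available. -/
lemma norm_thirdMoment_sub_le (h : IsRandomDatum P s lam g u₀) {ε t : ℝ}
    (hS : Small s ε (2 * |t|)) {n m p : ℤ × ℤ} (hn : n.1 ≠ 0) (hm : m.1 ≠ 0) (hp : p.1 ≠ 0) :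
    ‖thirdMoment P s ε lam g n m p t - ε * (((weight s n * weight s m * weight s p : ℝ) : ℂ)
        * Complex.exp (Complex.I * ((-(omega n + omega m + omega p) * t : ℝ) : ℂ))
        * momentTerm P lam g n m p t)‖
      ≤ (ε / 2) * ((|(n.1 : ℝ)| + |(m.1 : ℝ)| + |(p.1 : ℝ)|)
        * (quarticConst s * (ε ^ 2 * (1 + |t|)))) * |t| := by
  have hε := hS.eps_nonneg
  set Z : ℝ → ℂ := fun τ => ((weight s n * weight s m * weight s p : ℝ) : ℂ)
        * Complex.exp (Complex.I * ((-(omega n + omega m + omega p) * τ : ℝ) : ℂ))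
        * momentTerm P lam g n m p τ with hZ
  have h0 : thirdMoment P s ε lam g n m p 0 - ε * Z 0 = 0 := by
    have e1 : momentTerm P lam g n m p 0 = 0 := by simp [momentTerm]
    have e2 : thirdMoment P s ε lam g n m p 0 = 0 := by
      have := h.integral_eq_zero_of_odd (q := fun a => a n * a m * a p)
        (((continuous_eval n).mul (continuous_eval m)).mul (continuous_eval p)) (fun a => by
          simp only [lp.coeFn_neg, Pi.neg_apply]; ring)
      simpa only [thirdMoment, (isMild_randomFlow hS _).init] using this
    simp only [hZ, e1, e2]
    simp
  -- At t = 0 the doubled interval has no interior, so this case is settled directly.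
  rcases eq_or_ne t 0 with rfl | ht0
  · rw [show ((weight s n * weight s m * weight s p : ℝ) : ℂ)
        * Complex.exp (Complex.I * ((-(omega n + omega m + omega p) * (0 : ℝ) : ℝ) : ℂ))
        * momentTerm P lam g n m p 0 = Z 0 from rfl, h0]
    simp
  have hd : ∀ τ ∈ Set.Icc (-|t|) |t|, HasDerivWithinAt
      (fun τ => thirdMoment P s ε lam g n m p τ - ε * Z τ)
      (-(Complex.I * (ε / 2)) * (n.1 * (∫ ω, quartic s n m p τ (randomFlow s ε lam g ω τ) ∂P
          - ∫ ω, quartic s n m p τ (randomSeq s lam g ω) ∂P)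
        + m.1 * (∫ ω, quartic s m p n τ (randomFlow s ε lam g ω τ) ∂P
          - ∫ ω, quartic s m p n τ (randomSeq s lam g ω) ∂P)
        + p.1 * (∫ ω, quartic s p n m τ (randomFlow s ε lam g ω τ) ∂P
          - ∫ ω, quartic s p n m τ (randomSeq s lam g ω) ∂P))) (Set.Icc (-|t|) |t|) τ := fun τ hτ => by
    have hτ' : |τ| < 2 * |t| := lt_of_le_of_lt (abs_le.2 hτ) (by linarith [abs_pos.2 ht0])
    refine (((h.hasDerivAt_thirdMoment hS hτ' hn hm hp).sub
      ((h.hasDerivAt_momentTerm hn hm hp τ).const_mul (ε : ℂ))).congr_deriv ?_).hasDerivWithinAt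
    ring
  have hb : ∀ τ ∈ Set.Icc (-|t|) |t|, ‖-(Complex.I * (ε / 2)) * (n.1 *
        (∫ ω, quartic s n m p τ (randomFlow s ε lam g ω τ) ∂P
          - ∫ ω, quartic s n m p τ (randomSeq s lam g ω) ∂P)
        + m.1 * (∫ ω, quartic s m p n τ (randomFlow s ε lam g ω τ) ∂P
          - ∫ ω, quartic s m p n τ (randomSeq s lam g ω) ∂P)
        + p.1 * (∫ ω, quartic s p n m τ (randomFlow s ε lam g ω τ) ∂P
          - ∫ ω, quartic s p n m τ (randomSeq s lam g ω) ∂P))‖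
      ≤ (ε / 2) * ((|(n.1 : ℝ)| + |(m.1 : ℝ)| + |(p.1 : ℝ)|)
        * (quarticConst s * (ε ^ 2 * (1 + |t|)))) := fun τ hτ => by
    have hτ' : |τ| ≤ |t| := abs_le.2 hτ
    have hτ2 : |τ| ≤ 2 * |t| := hτ'.trans (by linarith [abs_nonneg t])
    have hQ := quarticConst_pos (s := s)
    have key : ∀ n m p : ℤ × ℤ, ‖(n.1 : ℂ) * (∫ ω, quartic s n m p τ (randomFlow s ε lam g ω τ) ∂P
          - ∫ ω, quartic s n m p τ (randomSeq s lam g ω) ∂P)‖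
        ≤ |(n.1 : ℝ)| * (quarticConst s * (ε ^ 2 * (1 + |t|))) := fun n m p => by
      rw [norm_mul, Complex.norm_intCast]
      gcongr
      exact (h.norm_integral_quartic_sub_le hS hτ2 n m p).trans (by gcongr)
    rw [norm_mul, norm_neg, norm_mul, Complex.norm_I, one_mul, norm_eps_half hε, add_mul, add_mul]
    gcongr
    exact (norm_add_le _ _).trans (add_le_add ((norm_add_le _ _).trans
      (add_le_add (key n m p) (key m p n))) (key p n m))
  have := Convex.norm_image_sub_le_of_norm_hasDerivWithin_le hd hb (convex_Icc _ _)
    (x := 0) (y := t) ⟨by simp, abs_nonneg t⟩ ⟨neg_abs_le t, le_abs_self t⟩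
  rw [h0, sub_zero, sub_zero, Real.norm_eq_abs] at this
  exact this

end IsRandomDatum

omit hs in
-- Since |n_1| ≤ |n| ≤ |n|^s, the lost derivative is paid for by the weight of the same index, and
-- the decay in the other two remains.
lemma fst_mul_size_rpow_le (hs1 : 1 < s) {n m p : ℤ × ℤ} (hn : n.1 ≠ 0) (hm : m.1 ≠ 0)
    (hp : p.1 ≠ 0) {μ : ℝ} (hμ : 0 < μ) (hle : μ ≤ size m * size p) :
    |(n.1 : ℝ)| * (weight s n * weight s m * weight s p)⁻¹ ≤ μ ^ (-s) := by
  have h1 := one_le_size hn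
  have h2 := one_le_size hm
  have h3 := one_le_size hp
  have hwn : |(n.1 : ℝ)| ≤ weight s n := by
    rw [weight_eq s hn]
    exact (abs_fst_le_size n).trans (Real.self_le_rpow_of_one_le h1 hs1.le)
  have hwm := weight_pos s m
  have hwp := weight_pos s p
  have hwn' := weight_pos s n
  calc |(n.1 : ℝ)| * (weight s n * weight s m * weight s p)⁻¹
      ≤ weight s n * (weight s n * weight s m * weight s p)⁻¹ := by gcongr
    _ = (weight s m * weight s p)⁻¹ := by field_simp
    _ = (size m * size p) ^ (-s) := by
        rw [weight_eq s hm, weight_eq s hp, Real.rpow_neg (by positivity),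
          Real.mul_rpow (by positivity) (by positivity)]
    _ ≤ μ ^ (-s) := Real.rpow_le_rpow_of_nonpos hμ hle (by linarith)

omit hs in
lemma sum_fst_mul_le (hs1 : 1 < s) {n m p : ℤ × ℤ} (hn : n.1 ≠ 0) (hm : m.1 ≠ 0)
    (hp : p.1 ≠ 0) :
    (|(n.1 : ℝ)| + |(m.1 : ℝ)| + |(p.1 : ℝ)|) * (weight s n * weight s m * weight s p)⁻¹
      ≤ 3 * (min (min (size n * size m) (size m * size p)) (size p * size n)) ^ (-s) := by
  set μ := min (min (size n * size m) (size m * size p)) (size p * size n) with hμ'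
  have h1 := one_le_size hn
  have h2 := one_le_size hm
  have h3 := one_le_size hp
  have hμ : 0 < μ := by
    rw [hμ']
    exact lt_min (lt_min (by positivity) (by positivity)) (by positivity)
  have b1 := fst_mul_size_rpow_le hs1 hn hm hp hμ ((min_le_left _ _).trans (min_le_right _ _))
  have b2 := fst_mul_size_rpow_le hs1 hm hp hn hμ (min_le_right _ _)
  have b3 := fst_mul_size_rpow_le hs1 hp hn hm hμ ((min_le_left _ _).trans (min_le_left _ _))
  rw [show weight s m * weight s p * weight s n = weight s n * weight s m * weight s p by ring] at b2
  rw [show weight s p * weight s n * weight s m = weight s n * weight s m * weight s p by ring] at b3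
  linarith

end ThirdMoments

/-! ### The weighted sum of the first order terms. -/

section WeightedSum

variable {Ω : Type*} [MeasurableSpace Ω] {P : Measure Ω} [IsProbabilityMeasure P] {s : ℝ}
  {lam : ℤ × ℤ → ℂ} {g : ℤ × ℤ → Ω → ℂ} {u₀ : Ω → Torus → ℝ}

/-- The moment `E(|V_m V_p|²)` of the weighted coefficients. -/
def weightedPair (P : Measure Ω) (s : ℝ) (lam : ℤ × ℤ → ℂ) (g : ℤ × ℤ → Ω → ℂ)
    (q : (ℤ × ℤ) × (ℤ × ℤ)) : ℝ :=
  ∫ ω, ‖randomSeq s lam g ω q.1‖ ^ 2 * ‖randomSeq s lam g ω q.2‖ ^ 2 ∂P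

omit [IsProbabilityMeasure P] in
lemma weightedPair_nonneg (q : (ℤ × ℤ) × (ℤ × ℤ)) : 0 ≤ weightedPair P s lam g q :=
  integral_nonneg fun _ => by positivity

/-- For numbers of absolute value at least 1, a sum is bounded by twice the product; so |n_1| = |m_1
+ p_1| ≤ 2|m_1 p_1|. -/
lemma abs_fst_sq_le {n m p : ℤ × ℤ} (hm : m.1 ≠ 0) (hp : p.1 ≠ 0) (hnmp : n + m + p = 0) :
    |(n.1 : ℝ)| ^ 2 ≤ 2 * |(n.1 : ℝ) * m.1 * p.1| := by
  have h1 := one_le_abs_cast hm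
  have h2 := one_le_abs_cast hp
  have e : (n.1 : ℝ) = -((m.1 : ℝ) + p.1) := by
    have := congrArg Prod.fst hnmp
    simp only [Prod.fst_add, Prod.fst_zero] at this
    have : n.1 = -(m.1 + p.1) := by linarith
    rw [this]; push_cast; ring
  have h3 : |(n.1 : ℝ)| ≤ 2 * (|(m.1 : ℝ)| * |(p.1 : ℝ)|) := by
    rw [e, abs_neg]
    refine (abs_add_le _ _).trans ?_
    nlinarith
  calc |(n.1 : ℝ)| ^ 2 = |(n.1 : ℝ)| * |(n.1 : ℝ)| := sq _
    _ ≤ |(n.1 : ℝ)| * (2 * (|(m.1 : ℝ)| * |(p.1 : ℝ)|)) := by gcongr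
    _ = _ := by rw [abs_mul, abs_mul]; ring

/-- The sum over the triples `n + m + p = 0` of a summable function of two of the indices. -/
lemma summable_triples {f : (ℤ × ℤ) × (ℤ × ℤ) → ℝ} (hf : Summable f)
    (π : (ℤ × ℤ) × (ℤ × ℤ) × (ℤ × ℤ) → (ℤ × ℤ) × (ℤ × ℤ))
    (e : (ℤ × ℤ) × (ℤ × ℤ) → (ℤ × ℤ) × (ℤ × ℤ) × (ℤ × ℤ)) (hπ : ∀ q, π (e q) = q)
    (he : ∀ q, (e q).1 + (e q).2.1 + (e q).2.2 = 0)
    (hr : ∀ q, q.1 + q.2.1 + q.2.2 = 0 → e (π q) = q) :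
    Summable fun q : (ℤ × ℤ) × (ℤ × ℤ) × (ℤ × ℤ) =>
      if q.1 + q.2.1 + q.2.2 = 0 then f (π q) else 0 := by
  have hinj : Function.Injective e := fun x y hxy => by rw [← hπ x, ← hπ y, hxy]
  rw [← hinj.summable_iff fun q hq => if_neg fun h0 => hq ⟨π q, hr q h0⟩]
  refine hf.congr fun q => ?_
  simp only [Function.comp_apply, if_pos (he q), hπ]

namespace IsRandomDatum

/-- Summed over all pairs before the expectation, the products give the fourth power of the norm of
the datum, which is at most 1. -/
lemma summable_weightedPair (h : IsRandomDatum P s lam g u₀) :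
    Summable (weightedPair P s lam g) := by
  have hint : ∀ q : (ℤ × ℤ) × (ℤ × ℤ), Integrable (fun ω => ‖randomSeq s lam g ω q.1‖ ^ 2
      * ‖randomSeq s lam g ω q.2‖ ^ 2) P := fun q => by
    refine Integrable.of_bound (C := 1 ^ 2 * 1 ^ 2) ?_ (Eventually.of_forall fun ω => ?_)
    · have e := fun n => (continuous_eval n).norm.pow 2
      exact (((e q.1).mul (e q.2)).comp_stronglyMeasurable
        h.stronglyMeasurable_randomSeq).aestronglyMeasurable
    · rw [Real.norm_of_nonneg (by positivity)]
      gcongr <;> exact norm_randomSeq_apply_le ω _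
  refine summable_of_sum_le (c := 1) weightedPair_nonneg fun U => ?_
  simp only [weightedPair]
  rw [← integral_finsetSum _ fun q _ => hint q]
  have hb : ∀ ω, ∑ q ∈ U, ‖randomSeq s lam g ω q.1‖ ^ 2 * ‖randomSeq s lam g ω q.2‖ ^ 2 ≤ 1 :=
    fun ω => by
      have hV := (randomSeq s lam g ω).hasSum_norm_sq
      have hm := hV.summable.mul_of_nonneg hV.summable (fun _ => sq_nonneg _) fun _ => sq_nonneg _
      refine (hm.sum_le_tsum U fun _ _ => by positivity).trans ?_
      rw [← hV.summable.tsum_mul_tsum hV.summable hm, hV.tsum_eq]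
      have := pow_le_one₀ (n := 2) (norm_nonneg _) (norm_randomSeq_le (s := s) (lam := lam) (g := g) ω)
      exact mul_le_one₀ this (sq_nonneg _) this
  calc _ ≤ ∫ _, (1 : ℝ) ∂P := integral_mono (integrable_finsetSum _ fun q _ => hint q)
          (integrable_const _) hb
    _ = 1 := by simp

omit [IsProbabilityMeasure P] in
lemma weight_mul_pairMoment (h : IsRandomDatum P s lam g u₀) {m p : ℤ × ℤ} (hm : m.1 ≠ 0)
    (hp : p.1 ≠ 0) (hmp : m ≠ -p) :
    weight s m ^ 2 * weight s p ^ 2 * pairMoment P lam g m p = weightedPair P s lam g (m, p) := by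
  have h1 := h.integral_pair hm hp hmp
  rw [← Complex.ofReal_inj, ← h1, weightedPair, ← integral_complex_ofReal]
  refine integral_congr_ae ?_
  filter_upwards [h.ae_randomSeq_apply] with ω hω
  have key : ∀ n : ℤ × ℤ, n.1 ≠ 0 → randomSeq s lam g ω (-n) * randomSeq s lam g ω n
      = ((‖randomSeq s lam g ω n‖ ^ 2 : ℝ) : ℂ) := fun n hn => by
    have : randomSeq s lam g ω (-n) = conj (randomSeq s lam g ω n) := by
      rw [hω n hn, hω (-n) (by simpa using hn), h.lam_neg n hn, h.g_neg n hn, weight_neg]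
      simp
    rw [this, Complex.conj_mul']
    push_cast; rfl
  push_cast at key ⊢
  linear_combination (randomSeq s lam g ω (-p) * randomSeq s lam g ω p) * key m hm
    + (‖randomSeq s lam g ω m‖ : ℂ) ^ 2 * key p hp

variable [hs : Fact (1 < s)]

omit hs [IsProbabilityMeasure P] in
lemma momentTerm_eq (h : IsRandomDatum P s lam g u₀) {n m p : ℤ × ℤ} (hn : n.1 ≠ 0)
    (hm : m.1 ≠ 0) (hp : p.1 ≠ 0) (hnmp : n + m + p = 0) (t : ℝ) :
    momentTerm P lam g n m p t
      = (1 - Complex.exp (Complex.I * ((omega n + omega m + omega p : ℝ) : ℂ) * (t : ℂ)))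
        / ((omega n + omega m + omega p : ℝ) : ℂ)
        * (((n.1 * ((if m = p then 1 else 2) * pairMoment P lam g m p)
          + m.1 * ((if p = n then 1 else 2) * pairMoment P lam g p n)
          + p.1 * ((if n = m then 1 else 2) * pairMoment P lam g n m)) / 2 : ℝ) : ℂ) := by
  rw [h.half_mul_pairMoment hm hn hnmp,
    h.half_mul_pairMoment hp hn (show m + p + n = 0 by rw [← hnmp]; abel),
    h.half_mul_pairMoment (n := p) (p := m) hn hn (show p + n + m = 0 by rw [← hnmp]; abel),
    momentTerm, if_pos hnmp]
  congr 2
  ring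

omit [IsProbabilityMeasure P] in
-- The zero sum is used twice: n_1 costs only √X, and the weight of n is bounded by the product of
-- the weights of m and p, which completes the squares in the pair moment.
lemma weight_mul_fst_mul_pairMoment_le (h : IsRandomDatum P s lam g u₀) {n m p : ℤ × ℤ}
    (hn : n.1 ≠ 0) (hm : m.1 ≠ 0) (hp : p.1 ≠ 0) (hnmp : n + m + p = 0) {X : ℝ}
    (hX : X = |(n.1 : ℝ) * m.1 * p.1|) :
    weight s n * weight s m * weight s p
      * |(n.1 : ℝ) * ((if m = p then 1 else 2) * pairMoment P lam g m p)|
      ≤ 8 * 2 ^ s * (Real.sqrt X * weightedPair P s lam g (m, p)) := by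
  have hs1 := hs.out
  have en : n = -(m + p) := by rw [eq_neg_iff_add_eq_zero, ← add_assoc]; exact hnmp
  have hne : m ≠ -p := fun e => hn (by rw [en, e]; simp)
  have hX0 : 0 ≤ X := hX ▸ abs_nonneg _
  have hpm : 0 ≤ pairMoment P lam g m p := by
    unfold pairMoment
    split_ifs
    · exact mul_nonneg (by positivity) (integral_nonneg fun _ => by positivity)
    · positivity
  have h1 : |(n.1 : ℝ)| ≤ 2 * Real.sqrt X := by
    refine le_of_sq_le_sq ?_ (by positivity)
    have := abs_fst_sq_le hm hp hnmp
    rw [mul_pow, Real.sq_sqrt hX0, hX]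
    linarith [abs_nonneg ((n.1 : ℝ) * m.1 * p.1)]
  have hwm := one_le_weight (s := s) m
  have hwp := one_le_weight (s := s) p
  have h2 : weight s n ≤ 2 ^ s * 2 * (weight s m * weight s p) := by
    rw [en, weight_neg]
    refine (weight_add_le (by linarith) m p).trans ?_
    rw [mul_assoc]
    gcongr
    nlinarith
  have h3 : |(if m = p then (1 : ℝ) else 2)| ≤ 2 := by split_ifs <;> norm_num
  rw [abs_mul, abs_mul, abs_of_nonneg hpm, ← h.weight_mul_pairMoment hm hp hne]
  calc _ ≤ 2 ^ s * 2 * (weight s m * weight s p) * weight s m * weight s p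
        * (2 * Real.sqrt X * (2 * pairMoment P lam g m p)) := by gcongr
    _ = _ := by ring

omit [IsProbabilityMeasure P] in
-- The factor √X of the sum and the √X from the derivative are balanced by the resonance
-- denominator, which is at least 3X. The oscillating numerator is at most 2 at all times, so the
-- majorant is independent of t.
lemma weighted_momentTerm_le (h : IsRandomDatum P s lam g u₀) (n m p : ℤ × ℤ) (t : ℝ) :
    Real.sqrt |(n.1 : ℝ) * m.1 * p.1| * (size n * size m * size p) ^ s
        * ‖momentTerm P lam g n m p t‖
      ≤ if n + m + p = 0 then 8 * 2 ^ s * (weightedPair P s lam g (m, p)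
        + weightedPair P s lam g (p, n) + weightedPair P s lam g (n, m)) else 0 := by
  by_cases hnmp : n + m + p = 0
  swap
  · rw [if_neg hnmp, momentTerm, if_neg hnmp]; simp
  rw [if_pos hnmp]
  have hr : 0 ≤ 8 * 2 ^ s * (weightedPair P s lam g (m, p)
        + weightedPair P s lam g (p, n) + weightedPair P s lam g (n, m)) := by
    have := weightedPair_nonneg (P := P) (s := s) (lam := lam) (g := g)
    have h1 := this (m, p)
    have h2 := this (p, n)
    have h3 := this (n, m)
    positivity
  -- The square root vanishes in these cases, so the conventional value of the dispersion relation
  -- at n_1 = 0 plays no role.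
  by_cases hn : n.1 = 0
  · simpa [hn] using hr
  by_cases hm : m.1 = 0
  · simpa [hm] using hr
  by_cases hp : p.1 = 0
  · simpa [hp] using hr
  set X := |(n.1 : ℝ) * m.1 * p.1| with hX
  have hX1 : 1 ≤ X := by
    rw [hX, abs_mul, abs_mul]
    exact one_le_mul_of_one_le_of_one_le (one_le_mul_of_one_le_of_one_le (one_le_abs_cast hn)
      (one_le_abs_cast hm)) (one_le_abs_cast hp)
  have b1 := h.weight_mul_fst_mul_pairMoment_le hn hm hp hnmp hX
  have b2 := h.weight_mul_fst_mul_pairMoment_le hm hp hn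
    (show m + p + n = 0 by rw [← hnmp]; abel) (X := X) (by rw [hX]; congr 1; ring)
  have b3 := h.weight_mul_fst_mul_pairMoment_le hp hn hm
    (show p + n + m = 0 by rw [← hnmp]; abel) (X := X) (by rw [hX]; congr 1; ring)
  have hω : 3 * X ≤ |omega n + omega m + omega p| := by
    have hp' : p = -(n + m) := by rw [eq_neg_iff_add_eq_zero, add_comm]; exact hnmp
    have hg : Good n m := ⟨hn, hm, fun e => hp (by rw [hp', Prod.fst_neg, e, neg_zero])⟩
    have e1 : omega n + omega m + omega p = res n m := by rw [hp', omega_neg, res]; ring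
    have e2 : X = |(n.1 : ℝ)| * |(m.1 : ℝ)| * |((n + m).1 : ℝ)| := by
      rw [hX, hp', abs_mul, abs_mul, Prod.fst_neg, Int.cast_neg, abs_neg]
    rw [e1, e2]
    exact le_abs_res hg
  have hW : 0 < weight s n * weight s m * weight s p :=
    mul_pos (mul_pos (weight_pos s n) (weight_pos s m)) (weight_pos s p)
  have hsz : (size n * size m * size p) ^ s = weight s n * weight s m * weight s p := by
    rw [weight_eq s hn, weight_eq s hm, weight_eq s hp,
      Real.mul_rpow (mul_nonneg (size_nonneg n) (size_nonneg m)) (size_nonneg p),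
      Real.mul_rpow (size_nonneg n) (size_nonneg m)]
  rw [hsz, h.momentTerm_eq hn hm hp hnmp, norm_mul, norm_div, Complex.norm_real, Complex.norm_real,
    Real.norm_eq_abs, Real.norm_eq_abs]
  have he : ‖1 - Complex.exp (Complex.I * ((omega n + omega m + omega p : ℝ) : ℂ) * (t : ℂ))‖ ≤ 2 := by
    refine (norm_sub_le _ _).trans ?_
    rw [mul_assoc, ← Complex.ofReal_mul, norm_exp_I_mul, norm_one]
    norm_num
  set S := weightedPair P s lam g (m, p) + weightedPair P s lam g (p, n)
    + weightedPair P s lam g (n, m) with hS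
  set x₁ := (n.1 : ℝ) * ((if m = p then 1 else 2) * pairMoment P lam g m p)
  set x₂ := (m.1 : ℝ) * ((if p = n then 1 else 2) * pairMoment P lam g p n)
  set x₃ := (p.1 : ℝ) * ((if n = m then 1 else 2) * pairMoment P lam g n m)
  set W := weight s n * weight s m * weight s p with hWdef
  have hsum : W * |(x₁ + x₂ + x₃) / 2| ≤ 4 * 2 ^ s * (Real.sqrt X * S) := by
    rw [show weight s m * weight s p * weight s n = W by rw [hWdef]; ring] at b2
    rw [show weight s p * weight s n * weight s m = W by rw [hWdef]; ring] at b3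
    have h1 : |(x₁ + x₂ + x₃) / 2| ≤ (|x₁| + |x₂| + |x₃|) / 2 := by
      rw [abs_div, abs_two]
      gcongr
      exact abs_add_three _ _ _
    calc W * |(x₁ + x₂ + x₃) / 2| ≤ W * ((|x₁| + |x₂| + |x₃|) / 2) := by gcongr
      _ ≤ _ := by rw [hS]; linarith
  have hS0 : 0 ≤ S := nonneg_of_mul_nonneg_right hr (by positivity)
  calc Real.sqrt X * W * (_ / |omega n + omega m + omega p| * |(x₁ + x₂ + x₃) / 2|)
      ≤ Real.sqrt X * W * (2 / (3 * X) * |(x₁ + x₂ + x₃) / 2|) := by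
        have : 0 < 3 * X := by linarith
        gcongr
    _ = Real.sqrt X * (2 / (3 * X)) * (W * |(x₁ + x₂ + x₃) / 2|) := by ring
    _ ≤ Real.sqrt X * (2 / (3 * X)) * (4 * 2 ^ s * (Real.sqrt X * S)) := by gcongr
    _ = (Real.sqrt X * Real.sqrt X) * (2 / (3 * X)) * (4 * 2 ^ s * S) := by ring
    _ = 2 / 3 * (4 * 2 ^ s * S) := by
        rw [Real.mul_self_sqrt (by linarith)]
        field_simp
    _ ≤ 8 * 2 ^ s * S := by
        have : 0 ≤ 2 ^ s * S := by positivity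
        linarith

/-- The weighted sum of the first order terms is bounded uniformly in time. -/
lemma exists_bound_tsum_momentTerm (h : IsRandomDatum P s lam g u₀) : ∃ B : ℝ, ∀ t : ℝ,
    Summable (fun q : (ℤ × ℤ) × (ℤ × ℤ) × (ℤ × ℤ) =>
      Real.sqrt |(q.1.1 : ℝ) * (q.2.1.1 : ℝ) * (q.2.2.1 : ℝ)|
        * (size q.1 * size q.2.1 * size q.2.2) ^ s * ‖momentTerm P lam g q.1 q.2.1 q.2.2 t‖) ∧
    ∑' q : (ℤ × ℤ) × (ℤ × ℤ) × (ℤ × ℤ),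
      Real.sqrt |(q.1.1 : ℝ) * (q.2.1.1 : ℝ) * (q.2.2.1 : ℝ)|
        * (size q.1 * size q.2.1 * size q.2.2) ^ s
        * ‖momentTerm P lam g q.1 q.2.1 q.2.2 t‖ ≤ B := by
  have hw := h.summable_weightedPair
  have s1 := summable_triples hw (fun q => (q.2.1, q.2.2)) (fun q => (-q.1 - q.2, q.1, q.2))
    (fun _ => rfl) (fun q => by dsimp only; abel) (fun q hq => by
      have : -q.2.1 - q.2.2 = q.1 := by rw [eq_comm, ← sub_eq_zero, ← hq]; abel
      simp [this])
  have s2 := summable_triples hw (fun q => (q.2.2, q.1)) (fun q => (q.2, -q.1 - q.2, q.1))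
    (fun _ => rfl) (fun q => by dsimp only; abel) (fun q hq => by
      have : -q.2.2 - q.1 = q.2.1 := by rw [eq_comm, ← sub_eq_zero, ← hq]; abel
      simp [this])
  have s3 := summable_triples hw (fun q => (q.1, q.2.1)) (fun q => (q.1, q.2, -q.1 - q.2))
    (fun _ => rfl) (fun q => by dsimp only; abel) (fun q hq => by
      have : -q.1 - q.2.1 = q.2.2 := by rw [eq_comm, ← sub_eq_zero, ← hq]; abel
      simp [this])
  have hsum : Summable fun q : (ℤ × ℤ) × (ℤ × ℤ) × (ℤ × ℤ) => if q.1 + q.2.1 + q.2.2 = 0 then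
      8 * 2 ^ s * (weightedPair P s lam g (q.2.1, q.2.2) + weightedPair P s lam g (q.2.2, q.1)
        + weightedPair P s lam g (q.1, q.2.1)) else 0 := by
    refine (((s1.add s2).add s3).mul_left (8 * 2 ^ s)).congr fun q => ?_
    split_ifs <;> simp
  have hle := fun t (q : (ℤ × ℤ) × (ℤ × ℤ) × (ℤ × ℤ)) =>
    h.weighted_momentTerm_le q.1 q.2.1 q.2.2 t
  have hs' := fun t => Summable.of_nonneg_of_le (fun q : (ℤ × ℤ) × (ℤ × ℤ) × (ℤ × ℤ) =>
    mul_nonneg (mul_nonneg (Real.sqrt_nonneg _) (Real.rpow_nonneg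
      (mul_nonneg (mul_nonneg (size_nonneg _) (size_nonneg _)) (size_nonneg _)) s))
    (norm_nonneg _)) (hle t) hsum
  exact ⟨_, fun t => ⟨hs' t, (hs' t).tsum_le_tsum (hle t) hsum⟩⟩

end IsRandomDatum

end WeightedSum

/-! ### Uniqueness on the physical side and the moment expansion for arbitrary solutions. -/

section Solutions

variable {Ω : Type*} [MeasurableSpace Ω] {P : Measure Ω} {s : ℝ} [hs : Fact (1 < s)]
  {lam : ℤ × ℤ → ℂ} {g : ℤ × ℤ → Ω → ℂ} {u₀ : Ω → Torus → ℝ}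

lemma IsSolution.ae_eq {ε : ℝ} {J : Set ℝ} (hJ : ∀ t ∈ J, Small s ε |t|)
    (hconn : ∀ t ∈ J, ∀ τ, |τ| ≤ |t| → τ ∈ J) {f : Torus → ℝ} (hf : MemHs s f)
    (hf1 : hsNorm s f ≤ 1) {u v : ℝ → Torus → ℝ} (hu : IsSolution s ε J f u)
    (hv : IsSolution s ε J f v) {t : ℝ} (ht : t ∈ J) : u t =ᵐ[torusMeasure] v t :=
  ae_eq_of_coeff_eq (hu.memHs t ht).memLp (hv.memHs t ht).memLp fun n => by
    rw [hu.coeff_eq (hJ t ht) (hconn t ht) hf hf1 le_rfl,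
      hv.coeff_eq (hJ t ht) (hconn t ht) hf hf1 le_rfl]

variable (s) in
/-- The factor between the coefficients of `u` and those of the interaction representation. -/
def momentPhase (n m p : ℤ × ℤ) (t : ℝ) : ℂ :=
  ((weight s n * weight s m * weight s p : ℝ) : ℂ)⁻¹
    * Complex.exp (Complex.I * (((omega n + omega m + omega p) * t : ℝ) : ℂ))

omit hs in
lemma norm_momentPhase (n m p : ℤ × ℤ) (t : ℝ) :
    ‖momentPhase s n m p t‖ = (weight s n * weight s m * weight s p)⁻¹ := by
  rw [momentPhase, norm_mul, norm_exp_I_mul, mul_one, norm_inv, Complex.norm_real,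
    Real.norm_of_nonneg (mul_pos (mul_pos (weight_pos s n) (weight_pos s m)) (weight_pos s p)).le]

omit hs in
lemma momentPhase_mul (n m p : ℤ × ℤ) (t : ℝ) :
    momentPhase s n m p t * (((weight s n * weight s m * weight s p : ℝ) : ℂ)
      * Complex.exp (Complex.I * ((-(omega n + omega m + omega p) * t : ℝ) : ℂ))) = 1 := by
  have hW : ((weight s n * weight s m * weight s p : ℝ) : ℂ) ≠ 0 := by
    exact_mod_cast (mul_pos (mul_pos (weight_pos s n) (weight_pos s m)) (weight_pos s p)).ne'
  rw [momentPhase, mul_mul_mul_comm, inv_mul_cancel₀ hW, one_mul, ← Complex.exp_add, ← mul_add,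
    ← Complex.ofReal_add, neg_mul, add_neg_cancel, Complex.ofReal_zero, mul_zero, Complex.exp_zero]

namespace IsRandomDatum

/-- By uniqueness any family of solutions has the coefficients of the measurable flow almost surely,
so no measurability of u in the random parameter has to be assumed. -/
lemma ae_coeff_mul_eq (h : IsRandomDatum P s lam g u₀) {ε : ℝ} {J : Set ℝ} {t : ℝ}
    (hS : Small s ε |t|) (hJ : ∀ τ, |τ| ≤ |t| → τ ∈ J) {u : Ω → ℝ → Torus → ℝ}
    (hu : ∀ᵐ ω ∂P, IsSolution s ε J (u₀ ω) (u ω)) (n m p : ℤ × ℤ) :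
    ∀ᵐ ω ∂P, momentPhase s n m p t * (randomFlow s ε lam g ω t n * randomFlow s ε lam g ω t m
        * randomFlow s ε lam g ω t p)
      = coeff (u ω t) n * coeff (u ω t) m * coeff (u ω t) p := by
  filter_upwards [hu, h.memHs, h.ae_hsNorm_le_one, h.ae_mem_unitData] with ω h1 h2 h3 h4
  have e := fun n => h1.coeff_eq hS hJ h2 h3 le_rfl n
  rw [e n, e m, e p, ← h4.2, momentPhase, add_mul, add_mul, Complex.ofReal_add, Complex.ofReal_add,
    mul_add, mul_add, Complex.exp_add, Complex.exp_add]
  simp only [rotation_apply, randomFlow]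
  push_cast
  rw [mul_inv, mul_inv]
  ring

variable [IsProbabilityMeasure P]

/-- The expansion of the third moments of the solution. -/
lemma norm_integral_coeff_sub_le (h : IsRandomDatum P s lam g u₀) {ε : ℝ} {J : Set ℝ} {t : ℝ}
    (hS : Small s ε (2 * |t|)) (hJ : ∀ τ, |τ| ≤ |t| → τ ∈ J) {u : Ω → ℝ → Torus → ℝ}
    (hu : ∀ᵐ ω ∂P, IsSolution s ε J (u₀ ω) (u ω)) {n m p : ℤ × ℤ} (hn : n.1 ≠ 0) (hm : m.1 ≠ 0)
    (hp : p.1 ≠ 0) :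
    Integrable (fun ω => coeff (u ω t) n * coeff (u ω t) m * coeff (u ω t) p) P ∧
    ‖∫ ω, coeff (u ω t) n * coeff (u ω t) m * coeff (u ω t) p ∂P
        - ε * momentTerm P lam g n m p t‖
      ≤ ε ^ 3 * (2 * quarticConst s * (min (min (size n * size m) (size m * size p))
        (size p * size n)) ^ (-s) * |t| * (1 + |t|)) := by
  have hε := hS.eps_nonneg
  have h2t : |t| ≤ 2 * |t| := by linarith [abs_nonneg t]
  have hS' : Small s ε |t| := ⟨hε, abs_nonneg t, hS.eps_le, le_trans (by gcongr) hS.time_le⟩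
  have hae := h.ae_coeff_mul_eq hS' hJ hu n m p
  refine ⟨((h.integrable_triple hS h2t n m p).const_mul _).congr hae, ?_⟩
  have e : ∫ ω, coeff (u ω t) n * coeff (u ω t) m * coeff (u ω t) p ∂P
        - ε * momentTerm P lam g n m p t
      = momentPhase s n m p t * (thirdMoment P s ε lam g n m p t
        - ε * (((weight s n * weight s m * weight s p : ℝ) : ℂ)
        * Complex.exp (Complex.I * ((-(omega n + omega m + omega p) * t : ℝ) : ℂ))
        * momentTerm P lam g n m p t)) := by
    rw [← integral_congr_ae hae, integral_const_mul, thirdMoment]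
    linear_combination (ε * momentTerm P lam g n m p t) * momentPhase_mul (s := s) n m p t
  rw [e, norm_mul, norm_momentPhase]
  have hQ := quarticConst_pos (s := s)
  have hW : 0 < weight s n * weight s m * weight s p :=
    mul_pos (mul_pos (weight_pos s n) (weight_pos s m)) (weight_pos s p)
  have hb := sum_fst_mul_le hs.out hn hm hp
  set μ := (min (min (size n * size m) (size m * size p)) (size p * size n)) ^ (-s)
  have hμ : 0 ≤ μ := by
    have : 0 ≤ 3 * μ := le_trans (by positivity) hb
    linarith
  calc _ ≤ (weight s n * weight s m * weight s p)⁻¹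
        * ((ε / 2) * ((|(n.1 : ℝ)| + |(m.1 : ℝ)| + |(p.1 : ℝ)|)
        * (quarticConst s * (ε ^ 2 * (1 + |t|)))) * |t|) := by
        gcongr
        exact h.norm_thirdMoment_sub_le hS hn hm hp
    _ = ((|(n.1 : ℝ)| + |(m.1 : ℝ)| + |(p.1 : ℝ)|) * (weight s n * weight s m * weight s p)⁻¹)
        * (ε ^ 3 / 2 * (quarticConst s * |t| * (1 + |t|))) := by ring
    _ ≤ (3 * μ) * (ε ^ 3 / 2 * (quarticConst s * |t| * (1 + |t|))) := by gcongr
    -- Rounding 3 up to 4 gives the integer factor 2 in the final constant.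
    _ ≤ (4 * μ) * (ε ^ 3 / 2 * (quarticConst s * |t| * (1 + |t|))) := by gcongr; norm_num
    _ = _ := by ring

end IsRandomDatum

omit hs in
-- The factor 2000 is twice the 1000 in `Small`, to make room for the doubled interval used in the
-- comparison of moments.
lemma small_of_mem_timeInterval {ε t : ℝ} (hε : 0 ≤ ε) (hε₁ : ε < 1 / (100 * convConst s))
    (ht : t ∈ timeInterval (1 / (2000 * convConst s ^ 2)) ε) : Small s ε (2 * |t|) := by
  have hK := one_le_convConst s
  refine ⟨hε, by positivity, ?_, ?_⟩
  · rw [lt_div_iff₀ (by positivity)] at hε₁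
    linarith
  · have ht' : ε ^ 2 * |t| ≤ 1 / (2000 * convConst s ^ 2) := ht
    rw [le_div_iff₀ (by positivity)] at ht'
    linarith

omit hs in
lemma mem_timeInterval_of_abs_le {T₁ ε t τ : ℝ} (ht : t ∈ timeInterval T₁ ε) (hτ : |τ| ≤ |t|) :
    τ ∈ timeInterval T₁ ε :=
  (mul_le_mul_of_nonneg_left hτ (sq_nonneg ε)).trans ht

end Solutions

end KPII

end

theorem theorem2 (s : ℝ) (hs : 1 < s) :
    ∃ ε₁ T₁ C : ℝ, 0 < ε₁ ∧ 0 < T₁ ∧ 0 < C ∧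
      ∀ (Ω : Type*) [MeasurableSpace Ω] (P : Measure Ω) [IsProbabilityMeasure P]
        (lam : ℤ × ℤ → ℂ) (g : ℤ × ℤ → Ω → ℂ) (u₀ : Ω → KPII.Torus → ℝ),
        KPII.IsRandomDatum P s lam g u₀ →
        -- the weighted sum of the first order terms is bounded uniformly in time
        -- (the weight vanishes if one of the first components does)
        (∃ B : ℝ, ∀ t : ℝ,
          Summable (fun q : (ℤ × ℤ) × (ℤ × ℤ) × (ℤ × ℤ) =>
            Real.sqrt |(q.1.1 : ℝ) * (q.2.1.1 : ℝ) * (q.2.2.1 : ℝ)|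
              * (KPII.size q.1 * KPII.size q.2.1 * KPII.size q.2.2) ^ s
              * ‖KPII.momentTerm P lam g q.1 q.2.1 q.2.2 t‖) ∧
          ∑' q : (ℤ × ℤ) × (ℤ × ℤ) × (ℤ × ℤ),
            Real.sqrt |(q.1.1 : ℝ) * (q.2.1.1 : ℝ) * (q.2.2.1 : ℝ)|
              * (KPII.size q.1 * KPII.size q.2.1 * KPII.size q.2.2) ^ s
              * ‖KPII.momentTerm P lam g q.1 q.2.1 q.2.2 t‖ ≤ B) ∧
        ∀ ε : ℝ, 0 ≤ ε → ε < ε₁ →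
          -- almost surely there is one and only one solution on the time interval
          (∀ᵐ ω ∂P, ∃ w : ℝ → KPII.Torus → ℝ,
            KPII.IsSolution s ε (KPII.timeInterval T₁ ε) (u₀ ω) w ∧
            ∀ w' : ℝ → KPII.Torus → ℝ,
              KPII.IsSolution s ε (KPII.timeInterval T₁ ε) (u₀ ω) w' →
              ∀ t ∈ KPII.timeInterval T₁ ε, w' t =ᵐ[KPII.torusMeasure] w t) ∧
          -- the expansion of the third moments of the solution
          ∀ u : Ω → ℝ → KPII.Torus → ℝ,
            (∀ᵐ ω ∂P, KPII.IsSolution s ε (KPII.timeInterval T₁ ε) (u₀ ω) (u ω)) →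
            ∃ R : ℤ × ℤ → ℤ × ℤ → ℤ × ℤ → ℝ → ℂ,
              ∀ n m p : ℤ × ℤ, n.1 ≠ 0 → m.1 ≠ 0 → p.1 ≠ 0 →
              ∀ t ∈ KPII.timeInterval T₁ ε,
                Integrable (fun ω => KPII.coeff (u ω t) n * KPII.coeff (u ω t) m
                  * KPII.coeff (u ω t) p) P ∧
                ∫ ω, KPII.coeff (u ω t) n * KPII.coeff (u ω t) m * KPII.coeff (u ω t) p ∂P
                  = (ε : ℂ) * KPII.momentTerm P lam g n m p t + (ε : ℂ) ^ 3 * R n m p t ∧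
                ‖R n m p t‖ ≤
                  C * (min (min (KPII.size n * KPII.size m) (KPII.size m * KPII.size p))
                      (KPII.size p * KPII.size n)) ^ (-s) * |t| * (1 + |t|) := by
  have : Fact (1 < s) := ⟨hs⟩
  have hK := KPII.one_le_convConst s
  have hQ := KPII.quarticConst_pos (s := s)
  refine ⟨1 / (100 * KPII.convConst s), 1 / (2000 * KPII.convConst s ^ 2),
    2 * KPII.quarticConst s, by positivity, by positivity, by positivity, ?_⟩
  intro Ω _ P _ lam g u₀ h
  refine ⟨h.exists_bound_tsum_momentTerm, fun ε hε hε₁ => ?_⟩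
  have hS := fun t ht => KPII.small_of_mem_timeInterval (t := t) hε hε₁ ht
  have hS' : ∀ t ∈ KPII.timeInterval (1 / (2000 * KPII.convConst s ^ 2)) ε,
      KPII.Small s ε |t| := fun t ht =>
    ⟨hε, abs_nonneg t, (hS t ht).eps_le, le_trans (by gcongr; linarith [abs_nonneg t])
      (hS t ht).time_le⟩
  have hJ : ∀ t ∈ KPII.timeInterval (1 / (2000 * KPII.convConst s ^ 2)) ε, ∀ τ, |τ| ≤ |t| →
      τ ∈ KPII.timeInterval (1 / (2000 * KPII.convConst s ^ 2)) ε :=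
    fun t ht τ hτ => KPII.mem_timeInterval_of_abs_le ht hτ
  constructor
  · filter_upwards [h.memHs, h.ae_hsNorm_le_one] with ω h1 h2
    have h0 : (0 : ℝ) ∈ KPII.timeInterval (1 / (2000 * KPII.convConst s ^ 2)) ε := by
      simp only [KPII.timeInterval, Set.mem_ofPred_eq, abs_zero, mul_zero]
      positivity
    obtain ⟨w, hw⟩ := KPII.exists_isSolution h0 hS' h1 h2
    exact ⟨w, hw, fun w' hw' t ht => hw'.ae_eq hS' hJ h1 h2 hw ht⟩
  · intro u hu
    -- The remainder is defined by division by ε³.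
    refine ⟨fun n m p t => (∫ ω, KPII.coeff (u ω t) n * KPII.coeff (u ω t) m
      * KPII.coeff (u ω t) p ∂P - (ε : ℂ) * KPII.momentTerm P lam g n m p t) / (ε : ℂ) ^ 3, ?_⟩
    intro n m p hn hm hp t ht
    obtain ⟨hi, hb⟩ := h.norm_integral_coeff_sub_le (hS t ht) (hJ t ht) hu hn hm hp
    refine ⟨hi, ?_⟩
    beta_reduce
    -- For ε = 0 the quotient is 0 by convention; the estimate with right-hand side zero then says
    -- that the third moment itself vanishes, so the expansion still holds.
    rcases hε.eq_or_lt with rfl | hpos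
    · rw [zero_pow three_ne_zero, zero_mul] at hb
      have h0 := norm_le_zero_iff.1 hb
      have hr : 0 ≤ (min (min (KPII.size n * KPII.size m) (KPII.size m * KPII.size p))
          (KPII.size p * KPII.size n)) ^ (-s) := by
        have := KPII.size_nonneg
        exact Real.rpow_nonneg (le_min (le_min (mul_nonneg (this n) (this m))
          (mul_nonneg (this m) (this p))) (mul_nonneg (this p) (this n))) _
      constructor
      · rw [h0, zero_div, mul_zero, add_zero]
        exact sub_eq_zero.1 h0
      · rw [h0, zero_div, norm_zero]
        positivity
    · have hε0 : (ε : ℂ) ^ 3 ≠ 0 := pow_ne_zero 3 (by exact_mod_cast hpos.ne')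
      constructor
      · rw [mul_div_cancel₀ _ hε0]; ring
      · rw [norm_div, norm_pow, Complex.norm_real, Real.norm_of_nonneg hε,
          div_le_iff₀ (by positivity), mul_comm _ (ε ^ 3)]
        exact hb
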